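/- Let $X$ be a real random variable with distribution function $F(x)=P[X\le x]$ such that $E|X|=\infty$. Let $F^{n*}$ be the $n$-fold convolution of the law of $X$ ($F^{0*}$ being the unit mass at $0$), and let $U(I)=\sum_{n=0}^\infty F^{n*}(I)$ be the renewal measure. Call $F$ transient if $U([-y,y])<\infty$ for all $y>0$, and arithmetic if $X/h_0\in\mathbb{Z}$ almost surely for some $h_0>0$. For $x\ge 0$ put $$H(x)=P[X>x]+P[X<-x],\qquad K(x)=P[X>x]-P[X<-x],\qquad A(x)=\int_0^x K(t)\,dt .$$ Suppose that (Ha) $\displaystyle \frac{A(x)}{xH(x)}\to\infty$ as $x\to\infty$; (Hb) $\displaystyle \int_{x_0}^\infty \frac{H(t)}{A(t)^2}\,dt<\infty$ for some $x_0>0$; and define $m(x)$ for $x>x_0$ by $\displaystyle \frac1{m(x)}=\int_x^\infty\frac{H(t)}{A(t)^2}\,dt$. Suppose further that (Hc) the limit $\displaystyle \kappa=\lim_{x\to\infty}\frac{m(x)}{A(x)}$ exists. Then $F$ is transient. If moreover $F$ is non-arithmetic, then for each $h>0$, $$m(|x|)\,\frac{U\big((x,x+h]\big)}{h}\longrightarrow\begin{cases}\tfrac12(1+\kappa)&\text{as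 }x\to+\infty,\\[1mm]\tfrac12(1-\kappa)&\text{as }x\to-\infty.\end{cases}$$ -/

import Mathlib

open MeasureTheory Set Filter Topology

namespace Renewal

/-- The `n`-fold convolution power `F^{n*}`, with `F^{0*}` the unit mass at `0`;
it is the law of `S_n` for the random walk started at `0` with step law `F`. -/
noncomputable def convPow (F : Measure ℝ) : ℕ → Measure ℝ
  | 0 => Measure.dirac 0
  | n + 1 => Measure.conv (convPow F n) F

/-- The renewal (Green) measure `U = ∑_{n ≥ 0} F^{n*}`, with values in `[0, ∞]`. -/
noncomputable def U (F : Measure ℝ) : Measure ℝ :=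
  Measure.sum (fun n => convPow F n)

/-- `F` is transient if `U [-y, y] < ∞` for all `y > 0`. -/
def Transient (F : Measure ℝ) : Prop :=
  ∀ y : ℝ, 0 < y → U F (Icc (-y) y) < ⊤

/-- `F` is arithmetic if, for some `h₀ > 0`, `X / h₀` is a.s. an integer (`X` having law `F`). -/
def Arithmetic (F : Measure ℝ) : Prop :=
  ∃ h₀ : ℝ, 0 < h₀ ∧ ∀ᵐ x ∂F, ∃ k : ℤ, x / h₀ = k

/-- `H x = 1 - F(x) + F(-x-0) = P[X > x] + P[X < -x]`. -/
noncomputable def H (F : Measure ℝ) (x : ℝ) : ℝ :=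
  F.real (Ioi x) + F.real (Iio (-x))

/-- `K x = 1 - F(x) - F(-x-0) = P[X > x] - P[X < -x]`. -/
noncomputable def K (F : Measure ℝ) (x : ℝ) : ℝ :=
  F.real (Ioi x) - F.real (Iio (-x))

/-- `A x = ∫_0^x K(t) dt`. -/
noncomputable def A (F : Measure ℝ) (x : ℝ) : ℝ :=
  ∫ t in (0 : ℝ)..x, K F t

/-- `A(x) / (x H(x)) → ∞` as `x → ∞`. -/
def Ha (F : Measure ℝ) : Prop :=
  Tendsto (fun x : ℝ => A F x / (x * H F x)) atTop atTop

/-- `∫_{x₀}^∞ H(t) / A(t)² dt < ∞` for some `x₀ > 0`.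
The integral is taken in `[0, ∞]`, so a positive number divided by `0` counts as `∞`. -/
def Hb (F : Measure ℝ) : Prop :=
  ∃ x₀ : ℝ, 0 < x₀ ∧
    ∫⁻ t in Ioi x₀, ENNReal.ofReal (H F t) / ENNReal.ofReal (A F t ^ 2) < ⊤

/-- `m`, defined by `1 / m(x) = ∫_x^∞ H(t) / A(t)² dt`
(meaningful for `x > x₀` with `x₀` as in `Hb`). -/
noncomputable def m (F : Measure ℝ) (x : ℝ) : ℝ :=
  (∫ t in Ioi x, H F t / A F t ^ 2)⁻¹

/-- `m(x) / A(x) → κ` as `x → ∞`, which includes the condition `Hb` that makes `m` meaningful. -/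
def Hc (F : Measure ℝ) (κ : ℝ) : Prop :=
  Hb F ∧ Tendsto (fun x : ℝ => m F x / A F x) atTop (𝓝 κ)

end Renewal

namespace Renewal

/-- The triangle function supported by `[-a, a]`. -/
noncomputable def tri (a θ : ℝ) : ℝ := max 0 (1 - |θ| / a)

/-- The Fejér kernel, the cosine transform of `tri a`. -/
noncomputable def kern (a z : ℝ) : ℝ := ∫ θ in (0 : ℝ)..a, 2 * (1 - θ / a) * Real.cos (θ * z)

lemma continuous_tri (a : ℝ) : Continuous (tri a) := by
  unfold tri; fun_prop

lemma tri_nonneg (a θ : ℝ) : 0 ≤ tri a θ := le_max_left _ _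

lemma tri_neg (a θ : ℝ) : tri a (-θ) = tri a θ := by simp [tri]

lemma tri_zero (a : ℝ) : tri a 0 = 1 := by simp [tri]

lemma tri_le_one {a : ℝ} (ha : 0 < a) (θ : ℝ) : tri a θ ≤ 1 := by
  have : 0 ≤ |θ| / a := by positivity
  simp only [tri, max_le_iff]; constructor <;> linarith

lemma tri_eq_zero {a : ℝ} (ha : 0 < a) {θ : ℝ} (h : a ≤ |θ|) : tri a θ = 0 := by
  have : 1 ≤ |θ| / a := by rwa [le_div_iff₀ ha, one_mul]
  simp only [tri, max_eq_left_iff]; linarith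

lemma tri_lipschitz {a : ℝ} (ha : 0 < a) (x y : ℝ) : |tri a x - tri a y| ≤ |x - y| / a := by
  refine (abs_max_sub_max_le_max _ _ _ _).trans ?_
  have : (1 - |x| / a) - (1 - |y| / a) = -((|x| - |y|) / a) := by ring
  rw [this, abs_neg, abs_div, abs_of_pos ha, sub_self, abs_zero]
  have h2 := abs_abs_sub_abs_le x y
  exact max_le (by positivity) (by gcongr)

lemma integrable_tri_mul {a : ℝ} (ha : 0 < a) {g : ℝ → ℝ} (hg : Continuous g) :
    Integrable (fun θ => tri a θ * g θ) := by
  refine ((continuous_tri a).mul hg).integrable_of_hasCompactSupport ?_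
  refine HasCompactSupport.intro (isCompact_Icc (a := -a) (b := a)) fun x hx => ?_
  have : a ≤ |x| := by
    by_contra! h
    exact hx (abs_le.1 h.le)
  simp [tri_eq_zero ha this]

lemma integral_tri_cos {a : ℝ} (ha : 0 < a) (z : ℝ) :
    ∫ θ, tri a θ * Real.cos (θ * z) = kern a z := by
  have hint := integrable_tri_mul ha (g := fun θ => Real.cos (θ * z)) (by fun_prop)
  have h0 : ∫ θ in Ioi (0 : ℝ), tri a θ * Real.cos (θ * z) = kern a z / 2 := by
    have : ∫ θ in Ioi (0 : ℝ), tri a θ * Real.cos (θ * z)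
        = ∫ θ in (0:ℝ)..a, tri a θ * Real.cos (θ * z) := by
      rw [intervalIntegral.integral_of_le ha.le]
      refine setIntegral_eq_of_subset_of_forall_sdiff_eq_zero measurableSet_Ioi
        Ioc_subset_Ioi_self fun x hx => ?_
      rw [tri_eq_zero ha, zero_mul]
      have h1 : 0 < x := hx.1
      have h2 : ¬ (x ≤ a) := fun h => hx.2 ⟨h1, h⟩
      rw [abs_of_pos h1]; linarith
    rw [this, kern, eq_div_iff two_ne_zero, ← intervalIntegral.integral_mul_const]
    refine intervalIntegral.integral_congr fun θ hθ => ?_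
    rw [uIcc_of_le ha.le] at hθ
    have : θ / a ≤ 1 := by rw [div_le_one ha]; exact hθ.2
    simp only [tri, abs_of_nonneg hθ.1]
    rw [max_eq_right (by linarith)]; ring
  have h1 : ∫ θ in Iic (0 : ℝ), tri a θ * Real.cos (θ * z)
      = ∫ θ in Ioi (0 : ℝ), tri a θ * Real.cos (θ * z) := by
    rw [← neg_zero, ← integral_comp_neg_Ioi, neg_zero]
    refine setIntegral_congr_fun measurableSet_Ioi fun θ _ => ?_
    simp [tri_neg]
  rw [← integral_add_compl (measurableSet_Iic (a := (0:ℝ))) hint, compl_Iic, h1, h0]; ring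

lemma integral_tri_sin (a : ℝ) (z : ℝ) :
    ∫ θ, tri a θ * Real.sin (θ * z) = 0 := by
  have h := integral_neg_eq_self (fun θ => tri a θ * Real.sin (θ * z)) volume
  simp only [tri_neg, neg_mul, Real.sin_neg, mul_neg, integral_neg] at h
  linarith

lemma integral_tri_shift_cos {a : ℝ} (ha : 0 < a) (l z : ℝ) :
    ∫ θ, tri a (θ - l) * Real.cos (θ * z) = kern a z * Real.cos (l * z) := by
  rw [← integral_add_right_eq_self _ l]
  have : ∀ θ, tri a (θ + l - l) * Real.cos ((θ + l) * z)
      = tri a θ * Real.cos (θ * z) * Real.cos (l * z)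
        - tri a θ * Real.sin (θ * z) * Real.sin (l * z) := fun θ => by
    rw [add_sub_cancel_right, add_mul, Real.cos_add]; ring
  simp_rw [this]
  rw [integral_sub, integral_mul_const, integral_mul_const, integral_tri_cos ha,
    integral_tri_sin, zero_mul, sub_zero]
  · exact (integrable_tri_mul ha (by fun_prop)).mul_const _
  · exact (integrable_tri_mul ha (by fun_prop)).mul_const _

/-- The even part, doubled, of the triangle function centred at `l`. -/
noncomputable def wt (a l θ : ℝ) : ℝ := tri a (θ - l) + tri a (θ + l)

lemma continuous_wt (a l : ℝ) : Continuous (wt a l) := by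
  unfold wt; have := continuous_tri a; fun_prop

lemma wt_zero (a l : ℝ) : wt a l 0 = 2 * tri a l := by
  simp only [wt, zero_sub, tri_neg, zero_add]; ring

lemma wt_nonneg (a l θ : ℝ) : 0 ≤ wt a l θ := add_nonneg (tri_nonneg _ _) (tri_nonneg _ _)

lemma wt_le_two {a : ℝ} (ha : 0 < a) (l θ : ℝ) : wt a l θ ≤ 2 := by
  have h1 := tri_le_one ha (θ - l)
  have h2 := tri_le_one ha (θ + l)
  unfold wt; linarith

lemma wt_lipschitz {a : ℝ} (ha : 0 < a) (l x y : ℝ) :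
    |wt a l x - wt a l y| ≤ 2 / a * |x - y| := by
  have h1 := tri_lipschitz ha (x - l) (y - l)
  have h2 := tri_lipschitz ha (x + l) (y + l)
  have e1 : x - l - (y - l) = x - y := by ring
  have e2 : x + l - (y + l) = x - y := by ring
  rw [e1] at h1; rw [e2] at h2
  have : wt a l x - wt a l y = (tri a (x - l) - tri a (y - l)) + (tri a (x + l) - tri a (y + l)) := by
    unfold wt; ring
  rw [this]
  refine (abs_add_le _ _).trans ((add_le_add h1 h2).trans (le_of_eq ?_))
  ring

lemma wt_eq_zero {a l θ : ℝ} (ha : 0 < a) (h : a + |l| ≤ θ) : wt a l θ = 0 := by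
  have h1 := neg_abs_le l
  have h2 := le_abs_self l
  rw [wt, tri_eq_zero ha ((by linarith : a ≤ θ - l).trans (le_abs_self _)),
    tri_eq_zero ha ((by linarith : a ≤ θ + l).trans (le_abs_self _)), add_zero]

lemma integral_wt_cos {a l N : ℝ} (ha : 0 < a) (hN : a + |l| ≤ N) (z : ℝ) :
    ∫ θ in (0:ℝ)..N, wt a l θ * Real.cos (θ * z) = kern a z * Real.cos (l * z) := by
  have hN0 : 0 ≤ N := by have := abs_nonneg l; linarith
  have hi : Integrable (fun θ => tri a (θ - l) * Real.cos (θ * z)) := by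
    have := (integrable_tri_mul ha (g := fun θ => Real.cos ((θ + l) * z))
      (by fun_prop)).comp_sub_right l
    simpa using this
  have hi' : Integrable (fun θ => tri a (θ + l) * Real.cos (θ * z)) := by
    have := (integrable_tri_mul ha (g := fun θ => Real.cos ((θ - l) * z))
      (by fun_prop)).comp_add_right l
    simpa using this
  have h1 : ∫ θ in (0:ℝ)..N, wt a l θ * Real.cos (θ * z)
      = ∫ θ in Ioi (0:ℝ), wt a l θ * Real.cos (θ * z) := by
    rw [intervalIntegral.integral_of_le hN0]
    refine (setIntegral_eq_of_subset_of_forall_sdiff_eq_zero measurableSet_Ioi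
        Ioc_subset_Ioi_self fun x hx => ?_).symm
    have h1 : 0 < x := hx.1
    have h2 : ¬ (x ≤ N) := fun h => hx.2 ⟨h1, h⟩
    rw [wt_eq_zero ha (by linarith), zero_mul]
  have h2 : ∫ θ in Iic (0 : ℝ), tri a (θ - l) * Real.cos (θ * z)
      = ∫ θ in Ioi (0 : ℝ), tri a (θ + l) * Real.cos (θ * z) := by
    rw [← neg_zero, ← integral_comp_neg_Ioi, neg_zero]
    refine setIntegral_congr_fun measurableSet_Ioi fun θ _ => ?_
    have : -θ - l = -(θ + l) := by ring
    simp only [this, tri_neg, neg_mul, Real.cos_neg]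
  rw [h1, ← integral_tri_shift_cos ha,
    ← integral_add_compl (measurableSet_Iic (a := (0:ℝ))) hi, compl_Iic, h2,
    ← integral_add hi'.integrableOn hi.integrableOn]
  refine setIntegral_congr_fun measurableSet_Ioi fun θ _ => ?_
  simp only [wt]; ring

lemma kern_of_ne {a z : ℝ} (ha : 0 < a) (hz : z ≠ 0) :
    kern a z = 2 * (1 - Real.cos (a * z)) / (a * z ^ 2) := by
  have hd : ∀ θ ∈ uIcc (0:ℝ) a, HasDerivAt
      (fun θ => 2 * ((1 - θ / a) * (Real.sin (θ * z) / z) - Real.cos (θ * z) / (a * z ^ 2)))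
      (2 * (1 - θ / a) * Real.cos (θ * z)) θ := fun θ _ => by
    have e1 : HasDerivAt (fun θ : ℝ => θ * z) z θ := by
      simpa using (hasDerivAt_id θ).mul_const z
    have e2 := e1.sin.div_const z
    have e3 := e1.cos.div_const (a * z ^ 2)
    have e4 : HasDerivAt (fun θ : ℝ => 1 - θ / a) (-(1 / a)) θ := by
      simpa using ((hasDerivAt_id θ).div_const a).const_sub 1
    refine (((e4.mul e2).sub e3).const_mul 2).congr_deriv ?_
    field_simp
    ring
  rw [kern, intervalIntegral.integral_eq_sub_of_hasDerivAt hd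
    (Continuous.intervalIntegrable (by fun_prop) _ _)]
  field_simp
  simp
  ring

lemma kern_zero {a : ℝ} (ha : 0 < a) : kern a 0 = a := by
  have : kern a 0 = ∫ θ in (0:ℝ)..a, (2 - (2 / a) * θ) := by
    refine intervalIntegral.integral_congr fun θ _ => ?_
    simp; ring
  rw [this, intervalIntegral.integral_sub (by simp) (Continuous.intervalIntegrable (by fun_prop) _ _),
    intervalIntegral.integral_const_mul, integral_id]
  field_simp
  simp; ring

lemma continuous_kern (a : ℝ) : Continuous (kern a) := by
  unfold kern
  exact intervalIntegral.continuous_parametric_intervalIntegral_of_continuous' (by fun_prop) _ _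

lemma kern_nonneg {a : ℝ} (ha : 0 < a) (z : ℝ) : 0 ≤ kern a z := by
  rcases eq_or_ne z 0 with rfl | hz
  · rw [kern_zero ha]; exact ha.le
  · rw [kern_of_ne ha hz]
    have := Real.cos_le_one (a * z)
    have : 0 ≤ 1 - Real.cos (a * z) := by linarith
    positivity

lemma kern_neg (a z : ℝ) : kern a (-z) = kern a z := by simp [kern]

lemma kern_pos {a z : ℝ} (ha : 0 < a) (hz : a * |z| < 2 * Real.pi) : 0 < kern a z := by
  rcases eq_or_ne z 0 with rfl | hz0
  · rw [kern_zero ha]; exact ha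
  · rw [kern_of_ne ha hz0]
    have h0 : 0 < |z| := abs_pos.2 hz0
    have : Real.cos (a * z) < 1 := by
      refine lt_of_le_of_ne (Real.cos_le_one _) fun h => ?_
      have h2 : -(2 * Real.pi) < a * z := by
        have := neg_abs_le z; nlinarith
      have h3 : a * z < 2 * Real.pi := by
        have := le_abs_self z; nlinarith
      have := (Real.cos_eq_one_iff_of_lt_of_lt h2 h3).1 h
      rcases mul_eq_zero.1 this with h | h
      · exact ha.ne' h
      · exact hz0 h
    have : 0 < 1 - Real.cos (a * z) := by linarith
    positivity

lemma kern_le {a : ℝ} (ha : 0 < a) (z : ℝ) : kern a z ≤ (2 * a + 4 / a) * (1 + z ^ 2)⁻¹ := by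
  have hb : kern a z ≤ 2 * a := by
    have := intervalIntegral.norm_integral_le_of_norm_le_const (a := 0) (b := a) (C := 2)
      (f := fun θ => 2 * (1 - θ / a) * Real.cos (θ * z)) fun θ hθ => ?_
    · rw [sub_zero, abs_of_pos ha] at this
      exact (le_abs_self _).trans this
    · rw [uIoc_of_le ha.le] at hθ
      have h1 : θ / a ≤ 1 := by rw [div_le_one ha]; exact hθ.2
      have h2 : 0 ≤ θ / a := div_nonneg hθ.1.le ha.le
      rw [Real.norm_eq_abs, abs_mul, abs_mul, abs_two, abs_of_nonneg (by linarith : 0 ≤ 1 - θ / a)]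
      have := Real.abs_cos_le_one (θ * z)
      have h3 := abs_nonneg (Real.cos (θ * z))
      nlinarith
  rw [← div_eq_mul_inv, le_div_iff₀ (by positivity)]
  have : kern a z * z ^ 2 ≤ 4 / a := by
    rcases eq_or_ne z 0 with rfl | hz
    · simp; positivity
    · rw [kern_of_ne ha hz]
      have := Real.neg_one_le_cos (a * z)
      have e : 2 * (1 - Real.cos (a * z)) / (a * z ^ 2) * z ^ 2 = 2 * (1 - Real.cos (a * z)) / a := by
        field_simp
      rw [e]; gcongr; linarith
  linarith

lemma integrable_kern {a : ℝ} (ha : 0 < a) : Integrable (kern a) := by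
  refine (integrable_inv_one_add_sq.const_mul (2 * a + 4 / a)).mono'
    (continuous_kern a).aestronglyMeasurable (ae_of_all _ fun z => ?_)
  rw [Real.norm_eq_abs, abs_of_nonneg (kern_nonneg ha z)]
  exact kern_le ha z

lemma fourier_tri {a : ℝ} (ha : 0 < a) (w : ℝ) :
    FourierTransform.fourier (fun θ => (tri a θ : ℂ)) w = kern a (2 * Real.pi * w) := by
  rw [Real.fourier_real_eq_integral_exp_smul]
  have : ∀ v : ℝ, Complex.exp (↑(-2 * Real.pi * v * w) * Complex.I) • (tri a v : ℂ)
      = ((tri a v * Real.cos (v * (2 * Real.pi * w)) : ℝ) : ℂ)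
        - ((tri a v * Real.sin (v * (2 * Real.pi * w)) : ℝ) : ℂ) * Complex.I := fun v => by
    rw [Complex.exp_mul_I, ← Complex.ofReal_cos, ← Complex.ofReal_sin]
    have : -2 * Real.pi * v * w = -(v * (2 * Real.pi * w)) := by ring
    rw [this, Real.cos_neg, Real.sin_neg]
    push_cast [smul_eq_mul]; ring
  simp_rw [this]
  rw [integral_sub, integral_mul_const, integral_complex_ofReal, integral_complex_ofReal,
    integral_tri_cos ha, integral_tri_sin]
  · simp
  · exact (integrable_tri_mul ha (by fun_prop)).ofReal
  · exact (integrable_tri_mul ha (by fun_prop)).ofReal.mul_const _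

lemma integral_kern_exp {a : ℝ} (ha : 0 < a) (l : ℝ) :
    ∫ y : ℝ, Complex.exp (l * y * Complex.I) * (kern a y : ℂ) = 2 * Real.pi * tri a l := by
  have h1 : Continuous (fun θ => (tri a θ : ℂ)) := Complex.continuous_ofReal.comp (continuous_tri a)
  have h2 : Integrable (fun θ => (tri a θ : ℂ)) := by
    have := integrable_tri_mul ha (g := fun _ => 1) continuous_const
    simpa using this.ofReal (𝕜 := ℂ)
  have h4 : FourierTransform.fourier (fun θ => (tri a θ : ℂ))
      = fun w => (kern a (2 * Real.pi * w) : ℂ) := funext (fourier_tri ha)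
  have h3 : Integrable (FourierTransform.fourier (fun θ => (tri a θ : ℂ))) := by
    rw [h4]
    exact ((integrable_kern ha).comp_mul_left' (by positivity : (2 * Real.pi) ≠ 0)).ofReal
  have h5 := congrFun (h1.fourierInv_fourier_eq h2 h3) l
  rw [h4, Real.fourierInv_eq_fourier_neg, Real.fourier_real_eq_integral_exp_smul] at h5
  have h6 := Measure.integral_comp_mul_left (fun y : ℝ => Complex.exp (l * y * Complex.I) * (kern a y : ℂ))
    (2 * Real.pi)
  have h7 : ∀ v : ℝ, Complex.exp (↑(-2 * Real.pi * v * -l) * Complex.I) • (kern a (2 * Real.pi * v) : ℂ)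
      = Complex.exp (l * (2 * Real.pi * v : ℝ) * Complex.I) * (kern a (2 * Real.pi * v) : ℂ) :=
    fun v => by
      rw [smul_eq_mul]; congr 2; push_cast; ring
  simp_rw [h7] at h5
  rw [h5, abs_of_pos (by positivity)] at h6
  have : (Real.pi : ℂ) ≠ 0 := by exact_mod_cast Real.pi_ne_zero
  rw [h6, Complex.real_smul, ← mul_assoc]
  push_cast
  rw [mul_inv_cancel₀ (by simpa using this), one_mul]

lemma integral_kern {a : ℝ} (ha : 0 < a) : ∫ y, kern a y = 2 * Real.pi := by
  have := integral_kern_exp ha 0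
  simp only [Complex.ofReal_zero, zero_mul, Complex.exp_zero, one_mul, tri_zero] at this
  rw [integral_complex_ofReal] at this
  have h : ((∫ y, kern a y : ℝ) : ℂ) = ((2 * Real.pi : ℝ) : ℂ) := by rw [this]; push_cast; ring
  exact_mod_cast h

lemma integrableOn_one_sub_cos_div_sq (y : ℝ) :
    IntegrableOn (fun θ => (1 - Real.cos (θ * y)) / θ ^ 2) (Ioi 0) := by
  refine (integrable_inv_one_add_sq.const_mul (y ^ 2 + 2)).integrableOn.mono' ?_ ?_
  · exact (Measurable.aestronglyMeasurable (by fun_prop))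
  · refine (ae_restrict_mem measurableSet_Ioi).mono fun θ hθ => ?_
    have hθ : 0 < θ := hθ
    have h1 := Real.cos_le_one (θ * y)
    have h2 := Real.neg_one_le_cos (θ * y)
    have h3 := Real.one_sub_sq_div_two_le_cos (x := θ * y)
    rw [Real.norm_eq_abs, abs_of_nonneg (div_nonneg (by linarith) (by positivity)),
      ← div_eq_mul_inv, div_le_div_iff₀ (by positivity) (by positivity)]
    nlinarith [sq_nonneg (θ * y), sq_nonneg θ]

lemma integral_one_sub_cos_div_sq {y : ℝ} (hy : 0 ≤ y) :
    ∫ θ in Ioi (0:ℝ), (1 - Real.cos (θ * y)) / θ ^ 2 = Real.pi / 2 * y := by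
  have h1 : ∫ θ in Ioi (0:ℝ), (1 - Real.cos θ) / θ ^ 2 = Real.pi / 2 := by
    have hk := integral_kern one_pos
    have hi := integrable_kern one_pos
    rw [← integral_add_compl (measurableSet_Iic (a := (0:ℝ))) hi, compl_Iic] at hk
    have h2 : ∫ θ in Iic (0 : ℝ), kern 1 θ = ∫ θ in Ioi (0 : ℝ), kern 1 θ := by
      rw [← neg_zero, ← integral_comp_neg_Ioi, neg_zero]
      simp_rw [kern_neg]
    have h3 : ∫ θ in Ioi (0 : ℝ), kern 1 θ = 2 * ∫ θ in Ioi (0:ℝ), (1 - Real.cos θ) / θ ^ 2 := by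
      rw [← integral_const_mul]
      refine setIntegral_congr_fun measurableSet_Ioi fun θ hθ => ?_
      have hθ : 0 < θ := hθ
      simp only [kern_of_ne one_pos hθ.ne', one_mul]; ring
    rw [h2, h3] at hk
    linarith
  rcases hy.eq_or_lt with rfl | hy
  · simp
  have h := integral_comp_mul_right_Ioi (fun θ => (1 - Real.cos θ) / θ ^ 2) 0 hy
  rw [zero_mul, h1] at h
  have h2 : ∀ θ : ℝ, (1 - Real.cos (θ * y)) / θ ^ 2
      = y ^ 2 * ((1 - Real.cos (θ * y)) / (θ * y) ^ 2) := fun θ => by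
    rcases eq_or_ne θ 0 with rfl | h
    · simp
    · field_simp
  simp_rw [h2]
  rw [integral_const_mul, h, smul_eq_mul]
  field_simp

/-- The Dirichlet integral. -/
lemma tendsto_integral_sin_div :
    Tendsto (fun B : ℝ => ∫ u in (0:ℝ)..B, Real.sin u / u) atTop (𝓝 (Real.pi / 2)) := by
  have hi := integrableOn_one_sub_cos_div_sq 1
  have hv := integral_one_sub_cos_div_sq zero_le_one
  simp only [mul_one] at hi hv
  have h1 := intervalIntegral_tendsto_integral_Ioi 0 hi tendsto_id
  rw [hv] at h1
  have h2 : Tendsto (fun B : ℝ => (1 - Real.cos B) / B) atTop (𝓝 0) := by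
    refine squeeze_zero_norm' (a := fun B => 2 / B) ?_ (tendsto_const_nhds.div_atTop tendsto_id)
    filter_upwards [eventually_gt_atTop 0] with B hB
    have h1 := Real.cos_le_one B
    have h2 := Real.neg_one_le_cos B
    rw [Real.norm_eq_abs, abs_of_nonneg (div_nonneg (by linarith) hB.le)]
    gcongr; linarith
  have h3 := h1.add h2
  rw [add_zero] at h3
  refine h3.congr' ?_
  filter_upwards [eventually_gt_atTop 0] with B hB
  have hii : IntervalIntegrable (fun u : ℝ => Real.sin u / u) volume 0 B := by
    have : Continuous Real.sinc := Real.continuous_sinc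
    refine (this.intervalIntegrable 0 B).congr_ae ?_
    refine (ae_restrict_mem measurableSet_uIoc).mono fun u hu => ?_
    rw [uIoc_of_le hB.le] at hu
    exact Real.sinc_of_ne_zero hu.1.ne'
  have hii2 : IntervalIntegrable (fun u : ℝ => (1 - Real.cos u) / u ^ 2) volume 0 B :=
    (intervalIntegrable_iff_integrableOn_Ioc_of_le hB.le).2 (hi.mono_set Ioc_subset_Ioi_self)
  have key : ∫ u in (0:ℝ)..B, (Real.sin u / u - (1 - Real.cos u) / u ^ 2)
      = (1 - Real.cos B) / B - (1 - Real.cos 0) / 0 := by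
    refine intervalIntegral.integral_eq_sub_of_hasDerivAt_of_le hB.le
      (f := fun u => (1 - Real.cos u) / u) ?_ ?_ (hii.sub hii2)
    · intro u hu
      rcases eq_or_ne u 0 with rfl | hu0
      · have : ContinuousAt (fun u : ℝ => (1 - Real.cos u) / u) 0 := by
          rw [ContinuousAt, div_zero]
          refine squeeze_zero_norm (a := fun u : ℝ => |u|) (fun u => ?_)
            (by simpa using (continuous_abs.tendsto (0:ℝ)))
          rcases eq_or_ne u 0 with rfl | hu
          · simp
          have h3 := Real.one_sub_sq_div_two_le_cos (x := u)
          have h1 := Real.cos_le_one u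
          have hp : 0 < |u| := abs_pos.2 hu
          rw [Real.norm_eq_abs, abs_div, abs_of_nonneg (by linarith : 0 ≤ 1 - Real.cos u),
            div_le_iff₀ hp, abs_mul_abs_self]
          nlinarith [sq_nonneg u]
        exact this.continuousWithinAt
      · exact (ContinuousAt.div (by fun_prop) continuousAt_id hu0).continuousWithinAt
    · intro u hu
      have := ((Real.hasDerivAt_cos u).const_sub 1).div (hasDerivAt_id u) hu.1.ne'
      refine this.congr_deriv ?_
      have := hu.1.ne'
      simp only [id]
      field_simp
  rw [intervalIntegral.integral_sub hii hii2] at key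
  simp only [div_zero, sub_zero] at key
  simp only [id]
  linarith

end Renewal

namespace Renewal

/-- Slow variation at infinity, in the form of Potter's bounds. -/
def SlowVar (L : ℝ → ℝ) : Prop :=
  ∀ δ : ℝ, 0 < δ → ∃ x₁ : ℝ, 0 < x₁ ∧ (∀ s, x₁ ≤ s → 0 < L s) ∧
    ∀ s t, x₁ ≤ s → s ≤ t → L t ≤ L s * (t / s) ^ δ ∧ L s ≤ L t * (t / s) ^ δ

section tails

variable (F : Measure ℝ) [IsProbabilityMeasure F]

lemma antitone_measureReal_Ioi : Antitone fun x => F.real (Ioi x) :=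
  fun _ _ h => measureReal_mono (Ioi_subset_Ioi h)

lemma antitone_measureReal_Iio_neg : Antitone fun x => F.real (Iio (-x)) :=
  fun _ _ h => measureReal_mono (Iio_subset_Iio (neg_le_neg h))

lemma antitone_H : Antitone (H F) :=
  (antitone_measureReal_Ioi F).add (antitone_measureReal_Iio_neg F)

lemma H_nonneg (x : ℝ) : 0 ≤ H F x := add_nonneg measureReal_nonneg measureReal_nonneg

lemma abs_K_le_H (x : ℝ) : |K F x| ≤ H F x := by
  have h1 : 0 ≤ F.real (Ioi x) := measureReal_nonneg
  have h2 : 0 ≤ F.real (Iio (-x)) := measureReal_nonneg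
  rw [abs_le]; unfold H K; constructor <;> linarith

lemma measurable_H : Measurable (H F) := (antitone_H F).measurable

lemma measurable_K : Measurable (K F) :=
  (antitone_measureReal_Ioi F).measurable.sub (antitone_measureReal_Iio_neg F).measurable

lemma intervalIntegrable_H (a b : ℝ) : IntervalIntegrable (H F) volume a b :=
  (antitone_H F).intervalIntegrable

lemma intervalIntegrable_K (a b : ℝ) : IntervalIntegrable (K F) volume a b :=
  (antitone_measureReal_Ioi F).intervalIntegrable.sub
    (antitone_measureReal_Iio_neg F).intervalIntegrable

lemma H_eq_measureReal {x : ℝ} (hx : 0 ≤ x) : H F x = F.real {y | x < |y|} := by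
  have : {y : ℝ | x < |y|} = Ioi x ∪ Iio (-x) := by
    ext y; simp only [mem_ofPred_eq, lt_abs, mem_union, mem_Ioi, mem_Iio, lt_neg]
  rw [this, measureReal_union ?_ measurableSet_Iio]
  · rfl
  · rw [Set.disjoint_left]; intro y hy hy'
    simp only [mem_Ioi, mem_Iio] at hy hy'; linarith

lemma continuousWithinAt_measureReal_Ioi (G : Measure ℝ) [IsProbabilityMeasure G] (x : ℝ) :
    ContinuousWithinAt (fun x => G.real (Ioi x)) (Ici x) x := by
  have : (fun x => G.real (Ioi x)) = fun x => 1 - ProbabilityTheory.cdf G x := by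
    ext y
    rw [ProbabilityTheory.cdf_eq_real, ← compl_Iic, probReal_compl_eq_one_sub measurableSet_Iic]
  rw [this]
  exact continuousWithinAt_const.sub ((ProbabilityTheory.cdf G).right_continuous x)

lemma continuousWithinAt_K (x : ℝ) : ContinuousWithinAt (K F) (Ici x) x := by
  have : IsProbabilityMeasure (F.map Neg.neg) :=
    Measure.isProbabilityMeasure_map measurable_neg.aemeasurable
  have h : (fun x => F.real (Iio (-x))) = fun x => (F.map Neg.neg).real (Ioi x) := by
    ext y
    rw [map_measureReal_apply measurable_neg measurableSet_Ioi]
    congr 1; ext z; simp only [mem_Iio, mem_preimage, mem_Ioi]; exact lt_neg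
  have h2 : ContinuousWithinAt (fun x => F.real (Iio (-x))) (Ici x) x := by
    rw [h]; exact continuousWithinAt_measureReal_Ioi _ x
  exact (continuousWithinAt_measureReal_Ioi F x).sub h2

lemma continuous_A : Continuous (A F) :=
  intervalIntegral.continuous_primitive (fun a b => intervalIntegrable_K F a b) 0

lemma hasDerivWithinAt_A (x : ℝ) : HasDerivWithinAt (A F) (K F x) (Ici x) x := by
  refine intervalIntegral.integral_hasDerivWithinAt_right (t := Ioi x) (intervalIntegrable_K F 0 x) ?_ ?_
  · exact (measurable_K F).stronglyMeasurable.stronglyMeasurableAtFilter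
  · exact (continuousWithinAt_K F x).mono Ioi_subset_Ici_self

end tails

variable {F : Measure ℝ} [IsProbabilityMeasure F]

lemma Ha.eventually_bound (ha : Ha F) {ε : ℝ} (hε : 0 < ε) :
    ∀ᶠ x in atTop, 0 < A F x ∧ x * H F x ≤ ε * A F x := by
  filter_upwards [ha.eventually_ge_atTop (1 / ε), eventually_gt_atTop 0] with x hx hx0
  have h1 : 0 < A F x / (x * H F x) := lt_of_lt_of_le (by positivity) hx
  have h2 : 0 < x * H F x := by
    refine lt_of_le_of_ne (mul_nonneg hx0.le (H_nonneg F x)) fun h => ?_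
    rw [← h, div_zero] at h1; exact lt_irrefl _ h1
  have h3 : 0 < A F x := by
    have := mul_pos h1 h2
    rwa [div_mul_cancel₀ _ h2.ne'] at this
  refine ⟨h3, ?_⟩
  rw [div_le_div_iff₀ hε h2] at hx
  linarith

lemma Ha.slowVar (ha : Ha F) : SlowVar (A F) := by
  intro δ hδ
  obtain ⟨x₁, hx₁⟩ := eventually_atTop.1 ((ha.eventually_bound (half_pos hδ)).and
    (eventually_gt_atTop 0))
  have hx10 : 0 < x₁ := (hx₁ x₁ le_rfl).2
  refine ⟨x₁, hx10, fun s hs => (hx₁ s hs).1.1, fun s t hs hst => ?_⟩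
  have hs0 : 0 < s := hx10.trans_le hs
  have hAs := (hx₁ s hs).1.1
  have hderiv : ∀ (e : ℝ) (x : ℝ), x ∈ Ico s t →
      HasDerivWithinAt (fun u => A F s * (u / s) ^ e) (A F s * (x / s) ^ e * (e / x)) (Ici x) x := by
    intro e x hx
    have hxs : 0 < x := hs0.trans_le hx.1
    have h1 : HasDerivAt (fun u : ℝ => u / s) (1 / s) x := (hasDerivAt_id x).div_const s
    have h2 := (h1.rpow_const (p := e) (Or.inl (div_pos hxs hs0).ne')).const_mul (A F s)
    refine (h2.congr_deriv ?_).hasDerivWithinAt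
    rw [Real.rpow_sub_one (div_pos hxs hs0).ne']
    field_simp
  have hcont : ∀ e : ℝ, ContinuousOn (fun u => A F s * (u / s) ^ e) (Icc s t) := by
    intro e
    refine continuousOn_const.mul (ContinuousOn.rpow_const (by fun_prop) fun x hx => ?_)
    exact Or.inl (div_pos (hs0.trans_le hx.1) hs0).ne'
  have hKb : ∀ x, s ≤ x → |K F x| ≤ (δ / 2) * A F x / x := fun x hx => by
    have hx0 : 0 < x := hs0.trans_le hx
    rw [le_div_iff₀ hx0]
    have h1 := (hx₁ x (hs.trans hx)).1.2
    have h2 := abs_K_le_H F x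
    nlinarith
  have up : A F t ≤ A F s * (t / s) ^ δ := by
    refine image_le_of_liminf_slope_right_lt_deriv_boundary' (f := A F) (f' := K F)
      (continuous_A F).continuousOn
      (fun x _ r hr => (hasDerivWithinAt_A F x).liminf_right_slope_le hr) ?_ (hcont δ)
      (hderiv δ) ?_ (right_mem_Icc.2 hst)
    · simp [div_self hs0.ne']
    · intro x hx hxe
      have hx0 : 0 < x := hs0.trans_le hx.1
      have hAx := (hx₁ x (hs.trans hx.1)).1.1
      have h1 := (abs_le.1 (hKb x hx.1)).2
      rw [← hxe]
      refine h1.trans_lt ?_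
      have : 0 < δ / 2 * A F x / x := by positivity
      calc δ / 2 * A F x / x < δ / 2 * A F x / x + δ / 2 * A F x / x := by linarith
        _ = A F x * (δ / x) := by ring
  have lo : -A F t ≤ -(A F s * (t / s) ^ (-δ)) := by
    refine image_le_of_liminf_slope_right_lt_deriv_boundary' (f := fun u => -A F u)
      (f' := fun u => -K F u) (B := fun u => -(A F s * (u / s) ^ (-δ)))
      (B' := fun x => -(A F s * (x / s) ^ (-δ) * (-δ / x)))
      (continuous_A F).neg.continuousOn
      (fun x _ r hr => ((hasDerivWithinAt_A F x).fun_neg).liminf_right_slope_le hr) ?_ (hcont (-δ)).neg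
      (fun x hx => (hderiv (-δ) x hx).fun_neg) ?_ (right_mem_Icc.2 hst)
    · simp [div_self hs0.ne']
    · intro x hx hxe
      have hx0 : 0 < x := hs0.trans_le hx.1
      have hAx := (hx₁ x (hs.trans hx.1)).1.1
      have h1 := (abs_le.1 (hKb x hx.1)).1
      rw [neg_inj] at hxe
      rw [← hxe]
      have : 0 < δ / 2 * A F x / x := by positivity
      calc -K F x ≤ δ / 2 * A F x / x := by linarith
        _ < δ / 2 * A F x / x + δ / 2 * A F x / x := by linarith
        _ = -(A F x * (-δ / x)) := by ring
  refine ⟨up, ?_⟩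
  have hq : 0 < t / s := div_pos (hs0.trans_le hst) hs0
  rw [neg_le_neg_iff, Real.rpow_neg hq.le, ← div_eq_mul_inv,
    div_le_iff₀ (Real.rpow_pos_of_pos hq _)] at lo
  exact lo

lemma SlowVar.sq {L : ℝ → ℝ} (hL : SlowVar L) : SlowVar (fun x => L x ^ 2) := by
  intro δ hδ
  obtain ⟨x₁, h0, hp, h⟩ := hL (δ / 2) (half_pos hδ)
  refine ⟨x₁, h0, fun s hs => pow_pos (hp s hs) 2, fun s t hs hst => ?_⟩
  have hq : 0 ≤ t / s := div_nonneg (h0.le.trans (hs.trans hst)) (h0.le.trans hs)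
  have e : (t / s) ^ δ = ((t / s) ^ (δ / 2)) ^ 2 := by
    rw [← Real.rpow_natCast, ← Real.rpow_mul hq]; norm_num
  rw [e, ← mul_pow, ← mul_pow]
  have h1 := (hp s hs).le
  have h2 := (hp t (hs.trans hst)).le
  exact ⟨pow_le_pow_left₀ h2 (h s t hs hst).1 2, pow_le_pow_left₀ h1 (h s t hs hst).2 2⟩

lemma rpow_le_one_add {u δ : ℝ} (hu : 1 ≤ u) (h0 : 0 ≤ δ) (h1 : δ ≤ 1 / 2) :
    u ^ δ ≤ 1 + 2 * δ * √u := by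
  have hu0 : 0 ≤ u := by linarith
  have := Real.geom_mean_le_arith_mean2_weighted (w₁ := 2 * δ) (w₂ := 1 - 2 * δ) (p₁ := √u)
    (p₂ := 1) (by linarith) (by linarith) (Real.sqrt_nonneg u) zero_le_one (by ring)
  rw [Real.one_rpow, mul_one, mul_one, Real.sqrt_eq_rpow, ← Real.rpow_mul hu0] at this
  rw [Real.sqrt_eq_rpow]
  have e : 1 / 2 * (2 * δ) = δ := by ring
  rw [e] at this
  linarith

/-- A quantitative form of `L s / L t → 1`. -/
lemma SlowVar.ratio {L : ℝ → ℝ} (hL : SlowVar L) {ε : ℝ} (hε : 0 < ε) :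
    ∃ x₁ : ℝ, 0 < x₁ ∧ (∀ s, x₁ ≤ s → 0 < L s) ∧
      ∀ s t, x₁ ≤ s → x₁ ≤ t → |L s / L t - 1| ≤ ε * (√(s / t) + √(t / s)) := by
  have hδ : 0 < min (ε / 2) (1 / 2) := by positivity
  obtain ⟨x₁, h0, hp, h⟩ := hL _ hδ
  set δ := min (ε / 2) (1 / 2)
  have hδ1 : δ ≤ 1 / 2 := min_le_right _ _
  have hδε : 2 * δ ≤ ε := by have := min_le_left (ε / 2) (1 / 2); linarith
  refine ⟨x₁, h0, hp, ?_⟩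
  have key : ∀ a b q : ℝ, 0 < a → 0 < b → 1 ≤ q → a ≤ b * q ^ δ → b ≤ a * q ^ δ →
      |a / b - 1| ≤ ε * √q := by
    intro a b q ha hb hq h1 h2
    have hq' := rpow_le_one_add hq hδ.le hδ1
    have hs : 2 * δ * √q ≤ ε * √q := by gcongr
    have h3 : a / b ≤ q ^ δ := by rw [div_le_iff₀ hb]; linarith
    have h4 : 1 / q ^ δ ≤ a / b := by
      rw [div_le_div_iff₀ (by positivity) hb]; linarith
    have h5 : 1 - 2 * δ * √q ≤ 1 / q ^ δ := by
      rw [le_div_iff₀ (by positivity)]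
      have : 1 ≤ q ^ δ := Real.one_le_rpow hq hδ.le
      by_cases hc : 0 ≤ 1 - 2 * δ * √q
      · nlinarith [sq_nonneg (2 * δ * √q)]
      · push Not at hc; nlinarith
    rw [abs_le]; constructor <;> linarith
  intro s t hs ht
  have hs0 : 0 < s := h0.trans_le hs
  have ht0 : 0 < t := h0.trans_le ht
  rcases le_total s t with hst | hst
  · have := key (L s) (L t) (t / s) (hp s hs) (hp t ht) (by rwa [one_le_div hs0])
      (h s t hs hst).2 (h s t hs hst).1
    refine this.trans ?_
    gcongr
    exact le_add_of_nonneg_left (Real.sqrt_nonneg _)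
  · have := key (L s) (L t) (s / t) (hp s hs) (hp t ht) (by rwa [one_le_div ht0])
      (h t s ht hst).1 (h t s ht hst).2
    refine this.trans ?_
    gcongr
    exact le_add_of_nonneg_right (Real.sqrt_nonneg _)

lemma SlowVar.tendsto_div {L : ℝ → ℝ} (hL : SlowVar L) {u : ℝ} (hu : 0 < u) :
    Tendsto (fun x => L x / L (x / u)) atTop (𝓝 1) := by
  rw [Metric.tendsto_nhds]
  intro ε hε
  have hc : 0 < √u + √(1 / u) := by positivity
  obtain ⟨x₁, h0, hp, h⟩ := hL.ratio (div_pos hε (mul_pos two_pos hc))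
  filter_upwards [eventually_ge_atTop x₁, eventually_ge_atTop (x₁ * u), eventually_gt_atTop 0]
    with x h1 h2 h3
  rw [Real.dist_eq]
  refine (h x (x / u) h1 (by rwa [le_div_iff₀ hu])).trans_lt ?_
  have e1 : x / (x / u) = u := by field_simp
  have e2 : x / u / x = 1 / u := by field_simp
  rw [e1, e2]
  have : ε / (2 * (√u + √(1 / u))) * (√u + √(1 / u)) = ε / 2 := by field_simp
  rw [this]; linarith

lemma Hb.integrableOn (ha : Ha F) (hb : Hb F) :
    ∃ x₁ : ℝ, 0 < x₁ ∧ (∀ s, x₁ ≤ s → 0 < A F s) ∧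
      IntegrableOn (fun t => H F t / A F t ^ 2) (Ioi x₁) := by
  obtain ⟨x₀, h0, hx0⟩ := hb
  obtain ⟨x₁, hx₁⟩ := eventually_atTop.1 (ha.eventually_bound one_pos)
  refine ⟨max x₀ x₁, by positivity, fun s hs => (hx₁ s ((le_max_right _ _).trans hs)).1, ?_⟩
  have hm : Measurable fun t => H F t / A F t ^ 2 :=
    (measurable_H F).div ((continuous_A F).measurable.pow_const 2)
  refine ⟨hm.aestronglyMeasurable, ?_⟩
  rw [hasFiniteIntegral_iff_ofReal (ae_of_all _ fun t => div_nonneg (H_nonneg F t) (sq_nonneg _))]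
  refine lt_of_le_of_lt ?_ hx0
  refine le_trans (le_of_eq ?_) (lintegral_mono_set (Ioi_subset_Ioi (le_max_left x₀ x₁)))
  refine setLIntegral_congr_fun measurableSet_Ioi fun t ht => ?_
  have := (hx₁ t ((le_max_right x₀ x₁).trans (le_of_lt ht))).1
  rw [ENNReal.ofReal_div_of_pos (by positivity)]

lemma inv_A_sub_inv_A {s t : ℝ} (hst : s ≤ t) (hp : ∀ u, s ≤ u → 0 < A F u) :
    |(A F s)⁻¹ - (A F t)⁻¹| ≤ ∫ u in s..t, H F u / A F u ^ 2 := by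
  have hcA : ContinuousOn (fun u => (A F u ^ 2)⁻¹) (uIcc s t) := by
    rw [uIcc_of_le hst]
    exact ((continuous_A F).pow 2).continuousOn.inv₀ fun u hu => (pow_pos (hp u hu.1) 2).ne'
  have hiH : IntervalIntegrable (fun u => H F u / A F u ^ 2) volume s t := by
    simp_rw [div_eq_mul_inv]; exact (intervalIntegrable_H F s t).mul_continuousOn hcA
  have hiK : IntervalIntegrable (fun u => K F u / A F u ^ 2) volume s t := by
    simp_rw [div_eq_mul_inv]; exact (intervalIntegrable_K F s t).mul_continuousOn hcA
  have h := intervalIntegral.integral_eq_sub_of_hasDeriv_right_of_le hst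
    (f := fun u => -(A F u)⁻¹) (f' := fun u => K F u / A F u ^ 2)
    (((continuous_A F).continuousOn.inv₀ fun u hu => (hp u hu.1).ne').neg) (fun u hu => ?_) hiK
  · have e : (A F s)⁻¹ - (A F t)⁻¹ = ∫ u in s..t, K F u / A F u ^ 2 := by rw [h]; ring
    rw [e]
    refine (intervalIntegral.abs_integral_le_integral_abs hst).trans
      (intervalIntegral.integral_mono_on hst hiK.abs hiH fun u hu => ?_)
    rw [abs_div, abs_of_nonneg (sq_nonneg (A F u))]
    gcongr
    exact abs_K_le_H F u
  · have := ((hasDerivWithinAt_A F u).mono Ioi_subset_Ici_self).fun_inv (hp u hu.1.le).ne'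
    exact this.fun_neg.congr_deriv (by ring)

lemma lintegral_abs_eq : ∫⁻ y, ENNReal.ofReal |y| ∂F = ∫⁻ t in Ioi (0:ℝ), ENNReal.ofReal (H F t) := by
  rw [lintegral_eq_lintegral_meas_lt F (ae_of_all _ fun y => abs_nonneg y)
    (by fun_prop)]
  refine setLIntegral_congr_fun measurableSet_Ioi fun t ht => ?_
  rw [H_eq_measureReal F (le_of_lt ht), ofReal_measureReal]

lemma not_integrableOn_H (hinf : ¬ Integrable (fun x : ℝ => x) F) (x : ℝ) :
    ¬ IntegrableOn (H F) (Ioi x) := by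
  intro h
  refine hinf ⟨by fun_prop, ?_⟩
  have h1 : IntegrableOn (H F) (Ioi 0) := by
    have h2 : IntegrableOn (H F) (Ioc 0 (max x 0)) :=
      (intervalIntegrable_iff_integrableOn_Ioc_of_le (le_max_right _ _)).1
        (intervalIntegrable_H F _ _)
    have := h2.union (h.mono_set (Ioi_subset_Ioi (le_max_left x 0)))
    rwa [Ioc_union_Ioi_eq_Ioi (le_max_right _ _)] at this
  rw [hasFiniteIntegral_iff_norm]
  simp only [Real.norm_eq_abs]
  rw [lintegral_abs_eq]
  have := h1.2
  rwa [hasFiniteIntegral_iff_ofReal (ae_of_all _ fun t => H_nonneg F t)] at this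

lemma tendsto_A (hinf : ¬ Integrable (fun x : ℝ => x) F) (ha : Ha F) (hb : Hb F) :
    Tendsto (A F) atTop atTop := by
  obtain ⟨x₁, h0, hp, hi⟩ := hb.integrableOn ha
  have hmono : ∀ {s : ℝ}, x₁ ≤ s → IntegrableOn (fun t => H F t / A F t ^ 2) (Ioi s) :=
    fun hs => hi.mono_set (Ioi_subset_Ioi hs)
  have hlim0 : Tendsto (fun s => ∫ t in Ioi s, H F t / A F t ^ 2) atTop (𝓝 0) := by
    have h1 := intervalIntegral_tendsto_integral_Ioi x₁ hi tendsto_id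
    have h2 := h1.const_sub (∫ t in Ioi x₁, H F t / A F t ^ 2)
    rw [sub_self] at h2
    refine h2.congr' ?_
    filter_upwards [eventually_ge_atTop x₁] with s hs
    rw [id, ← intervalIntegral.integral_Ioi_sub_Ioi hi hs]; ring
  have hle : ∀ s t, x₁ ≤ s → s ≤ t →
      |(A F s)⁻¹ - (A F t)⁻¹| ≤ ∫ t in Ioi s, H F t / A F t ^ 2 := by
    intro s t hs hst
    refine (inv_A_sub_inv_A hst fun u hu => hp u (hs.trans hu)).trans ?_
    rw [intervalIntegral.integral_of_le hst]
    exact setIntegral_mono_set (hmono hs) (ae_of_all _ fun u => div_nonneg (H_nonneg F u) (sq_nonneg _))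
      Ioc_subset_Ioi_self.eventuallyLE
  by_contra hcon
  rw [tendsto_atTop] at hcon
  push Not at hcon
  obtain ⟨C, hC⟩ := hcon
  have hC' : ∃ᶠ x in atTop, A F x < C := by simpa using hC
  have hCpos : 0 < C := by
    obtain ⟨x, hx, hx2⟩ := (hC'.and_eventually (eventually_ge_atTop x₁)).exists
    exact (hp x hx2).trans hx
  have h1 : ∀ᶠ s in atTop, ∫ t in Ioi s, H F t / A F t ^ 2 < C⁻¹ / 2 :=
    hlim0.eventually_lt_const (by positivity)
  obtain ⟨s, hs⟩ := eventually_atTop.1 (h1.and (eventually_ge_atTop x₁))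
  have hbd : ∀ u, s ≤ u → A F u ≤ 2 * C := by
    intro u hu
    obtain ⟨t, ht, htu⟩ := (hC'.and_eventually (eventually_ge_atTop u)).exists
    have h2 := (hle u t (hs u hu).2 htu).trans (hs u hu).1.le
    have hAt := hp t ((hs u hu).2.trans htu)
    have hAu := hp u (hs u hu).2
    have h3 := inv_strictAnti₀ hAt ht
    have h4 := (abs_le.1 h2).1
    have h5 : C⁻¹ / 2 ≤ (A F u)⁻¹ := by linarith
    have h6 : C⁻¹ / 2 = (2 * C)⁻¹ := by rw [mul_inv]; ring
    rw [h6] at h5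
    exact (inv_le_inv₀ (by positivity) hAu).1 h5
  refine not_integrableOn_H hinf s ?_
  refine ((hmono (hs s le_rfl).2).const_mul ((2 * C) ^ 2)).mono'
    (measurable_H F).aestronglyMeasurable ?_
  refine (ae_restrict_mem measurableSet_Ioi).mono fun u hu => ?_
  have hu : s < u := hu
  rw [Real.norm_eq_abs, abs_of_nonneg (H_nonneg F u)]
  have hAu := hp u ((hs s le_rfl).2.trans hu.le)
  have h7 := hbd u hu.le
  have h8 : A F u ^ 2 ≤ (2 * C) ^ 2 := pow_le_pow_left₀ hAu.le h7 2
  rw [mul_div_assoc', le_div_iff₀ (by positivity), mul_comm]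
  exact mul_le_mul_of_nonneg_right h8 (H_nonneg F u)

/-- `1 / A ≤ 1 / m` near infinity. -/
lemma eventually_inv_A_le (hinf : ¬ Integrable (fun x : ℝ => x) F) (ha : Ha F) (hb : Hb F) :
    ∀ᶠ x in atTop, (A F x)⁻¹ ≤ (m F x)⁻¹ := by
  obtain ⟨x₁, h0, hp, hi⟩ := hb.integrableOn ha
  filter_upwards [eventually_ge_atTop x₁] with s hs
  have h1 : Tendsto (fun t => |(A F s)⁻¹ - (A F t)⁻¹|) atTop (𝓝 |(A F s)⁻¹ - 0|) :=
    ((tendsto_A hinf ha hb).inv_tendsto_atTop.const_sub _).abs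
  rw [sub_zero, abs_of_pos (inv_pos.2 (hp s hs))] at h1
  refine le_of_tendsto h1 ?_
  filter_upwards [eventually_ge_atTop s] with t hst
  refine (inv_A_sub_inv_A hst fun u hu => hp u (hs.trans hu)).trans ?_
  rw [intervalIntegral.integral_of_le hst, m, inv_inv]
  exact setIntegral_mono_set (hi.mono_set (Ioi_subset_Ioi hs))
    (ae_of_all _ fun u => div_nonneg (H_nonneg F u) (sq_nonneg _)) Ioc_subset_Ioi_self.eventuallyLE

end Renewal

namespace Renewal

section

variable (F : Measure ℝ) [IsProbabilityMeasure F]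

lemma integral_min_max {t : ℝ} (ht : 0 ≤ t) (G : Measure ℝ) [IsProbabilityMeasure G] :
    ∫ y, min (max y 0) t ∂G = ∫ s in (0:ℝ)..t, G.real (Ioi s) := by
  have hb : ∀ y : ℝ, |min (max y 0) t| ≤ t := fun y => by
    rw [abs_of_nonneg (le_min (le_max_right _ _) ht)]; exact min_le_right _ _
  have hint : Integrable (fun y : ℝ => min (max y 0) t) G :=
    (integrable_const t).mono' (by fun_prop) (ae_of_all _ hb)
  rw [hint.integral_eq_integral_meas_lt (ae_of_all _ fun y => le_min (le_max_right _ _) ht),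
    intervalIntegral.integral_of_le ht, integral_Ioc_eq_integral_Ioo]
  rw [setIntegral_eq_of_subset_of_forall_sdiff_eq_zero measurableSet_Ioi
    (show Ioo 0 t ⊆ Ioi 0 from Ioo_subset_Ioi_self) fun s hs => ?_]
  · refine setIntegral_congr_fun measurableSet_Ioo fun s hs => ?_
    congr 1
    ext y
    simp only [mem_ofPred_eq, lt_min_iff, lt_max_iff, mem_Ioi]
    have := hs.1; have := hs.2
    constructor
    · rintro ⟨h | h, _⟩ <;> linarith
    · intro h; exact ⟨Or.inl h, hs.2⟩
  · have h1 : 0 < s := hs.1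
    have h2 : t ≤ s := by
      by_contra! h; exact hs.2 ⟨h1, h⟩
    have : {a : ℝ | s < min (max a 0) t} = ∅ := by
      ext y; simp only [mem_ofPred_eq, lt_min_iff, mem_empty_iff_false, iff_false, not_and]
      intro _; linarith
    rw [this]; simp

/-- `A t` is the mean of the truncation of `X` to `[-t, t]`. -/
lemma A_eq_integral_trunc {t : ℝ} (ht : 0 ≤ t) :
    A F t = ∫ y, max (-t) (min y t) ∂F := by
  have : IsProbabilityMeasure (F.map Neg.neg) :=
    Measure.isProbabilityMeasure_map measurable_neg.aemeasurable
  have h1 := integral_min_max ht F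
  have h2 := integral_min_max ht (F.map Neg.neg)
  rw [integral_map measurable_neg.aemeasurable (Measurable.aestronglyMeasurable (by fun_prop))] at h2
  have h3 : ∀ s, (F.map Neg.neg).real (Ioi s) = F.real (Iio (-s)) := fun s => by
    rw [map_measureReal_apply measurable_neg measurableSet_Ioi]
    congr 1; ext z; simp only [mem_Iio, mem_preimage, mem_Ioi]; exact lt_neg
  simp_rw [h3] at h2
  have hb : ∀ y : ℝ, |min (max y 0) t| ≤ t := fun y => by
    rw [abs_of_nonneg (le_min (le_max_right _ _) ht)]; exact min_le_right _ _
  unfold A K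
  rw [intervalIntegral.integral_sub (antitone_measureReal_Ioi F).intervalIntegrable
    (antitone_measureReal_Iio_neg F).intervalIntegrable, ← h1, ← h2, ← integral_sub]
  · refine integral_congr_ae (ae_of_all _ fun y => ?_)
    change min (max y 0) t - min (max (-y) 0) t = max (-t) (min y t)
    rcases le_total 0 y with hy | hy
    · rw [max_eq_left hy, max_eq_right (by linarith : -y ≤ 0), min_eq_left ht, sub_zero,
        max_eq_right]
      have := le_min hy ht; linarith
    · rw [max_eq_right hy, max_eq_left (by linarith : 0 ≤ -y), min_eq_left ht, zero_sub,
        min_eq_left (hy.trans ht), ← max_neg_neg, neg_neg, max_comm]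
  · exact (integrable_const t).mono' (by fun_prop) (ae_of_all _ hb)
  · exact (integrable_const t).mono' (by fun_prop) (ae_of_all _ fun y => hb (-y))

/-- A truncated moment of `X` of order `3/2` at scale `1 / θ`. -/
noncomputable def trm (θ : ℝ) : ℝ := ∫ y, (min 1 (θ * |y|)) ^ (3 / 2 : ℝ) ∂F

lemma min_one_rpow_mem {θ : ℝ} (hθ : 0 ≤ θ) (y : ℝ) :
    0 ≤ (min 1 (θ * |y|)) ^ (3 / 2 : ℝ) ∧ (min 1 (θ * |y|)) ^ (3 / 2 : ℝ) ≤ 1 := by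
  have h0 : 0 ≤ min 1 (θ * |y|) := le_min zero_le_one (by positivity)
  exact ⟨Real.rpow_nonneg h0 _, Real.rpow_le_one h0 (min_le_left _ _) (by norm_num)⟩

lemma integrable_min_one_rpow {θ : ℝ} (hθ : 0 ≤ θ) :
    Integrable (fun y : ℝ => (min 1 (θ * |y|)) ^ (3 / 2 : ℝ)) F := by
  refine (integrable_const 1).mono' (Measurable.aestronglyMeasurable (by fun_prop))
    (ae_of_all _ fun y => ?_)
  rw [Real.norm_eq_abs, abs_of_nonneg (min_one_rpow_mem hθ y).1]
  exact (min_one_rpow_mem hθ y).2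

lemma integral_min_rpow_le {t : ℝ} (ht : 0 < t) :
    ∫ y, (min |y| t) ^ (3 / 2 : ℝ) ∂F ≤ 3 / 2 * ∫ s in (0:ℝ)..t, H F s * √s := by
  have hi : IntervalIntegrable (fun s => H F s * √s) volume 0 t :=
    (intervalIntegrable_H F 0 t).mul_continuousOn (by fun_prop)
  have hn : ∀ s, 0 ≤ H F s * √s := fun s => mul_nonneg (H_nonneg F s) (Real.sqrt_nonneg s)
  have hnI : 0 ≤ ∫ s in (0:ℝ)..t, H F s * √s :=
    intervalIntegral.integral_nonneg ht.le fun s _ => hn s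
  rw [← ENNReal.ofReal_le_ofReal_iff (by positivity), ofReal_integral_eq_lintegral_ofReal]
  · rw [lintegral_rpow_eq_lintegral_meas_lt_mul F
      (ae_of_all _ fun y => le_min (abs_nonneg y) ht.le) (by fun_prop) (by norm_num),
      ENNReal.ofReal_mul (by norm_num), intervalIntegral.integral_of_le ht.le,
      ofReal_integral_eq_lintegral_ofReal
        ((intervalIntegrable_iff_integrableOn_Ioc_of_le ht.le).1 hi) (ae_of_all _ hn)]
    refine mul_le_mul' le_rfl ?_
    rw [← lintegral_indicator measurableSet_Ioc, ← lintegral_indicator measurableSet_Ioi]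
    refine lintegral_mono fun s => ?_
    by_cases h0 : 0 < s
    · rw [indicator_of_mem (show s ∈ Ioi 0 from h0)]
      by_cases hst : s ≤ t
      · rw [indicator_of_mem (show s ∈ Ioc 0 t from ⟨h0, hst⟩), ENNReal.ofReal_mul (H_nonneg F s),
          H_eq_measureReal F h0.le, ofReal_measureReal, Real.sqrt_eq_rpow]
        norm_num
        gcongr
        exact fun h => h.1
      · rw [indicator_of_notMem (show s ∉ Ioc 0 t from fun h => hst h.2)]
        have : {a : ℝ | s < min |a| t} = ∅ := by
          ext y; simp only [mem_ofPred_eq, lt_min_iff, mem_empty_iff_false, iff_false, not_and]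
          intro _; linarith
        rw [this]; simp
    · rw [indicator_of_notMem (show s ∉ Ioi 0 from h0)]; exact zero_le
  · refine (integrable_const (t ^ (3 / 2 : ℝ))).mono' (Measurable.aestronglyMeasurable (by fun_prop))
      (ae_of_all _ fun y => ?_)
    have h0 : 0 ≤ min |y| t := le_min (abs_nonneg y) ht.le
    rw [Real.norm_eq_abs, abs_of_nonneg (Real.rpow_nonneg h0 _)]
    exact Real.rpow_le_rpow h0 (min_le_right _ _) (by norm_num)
  · exact ae_of_all _ fun y => Real.rpow_nonneg (le_min (abs_nonneg y) ht.le) _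

end

variable {F : Measure ℝ} [IsProbabilityMeasure F]

lemma eventually_trm_le (ha : Ha F) (hA : Tendsto (A F) atTop atTop) {ε : ℝ} (hε : 0 < ε) :
    ∀ᶠ t in atTop, t * trm F (1 / t) ≤ ε * A F t := by
  obtain ⟨x₁, h10, hp, hP⟩ := ha.slowVar (1 / 4) (by norm_num)
  obtain ⟨x₂, hx₂⟩ := eventually_atTop.1 (ha.eventually_bound (show 0 < ε / 12 by positivity))
  set z := max x₁ x₂ with hz
  have hz1 : x₁ ≤ z := le_max_left _ _
  have hz0 : 0 < z := h10.trans_le hz1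
  set C := ∫ s in (0:ℝ)..z, H F s * √s with hC
  filter_upwards [hA.eventually_ge_atTop (3 * C / ε), eventually_ge_atTop z,
    eventually_ge_atTop 1] with t htA htz ht1
  have ht0 : 0 < t := by linarith
  have hAt : 0 < A F t := hp t (hz1.trans htz)
  have hi : ∀ a b, IntervalIntegrable (fun s => H F s * √s) volume a b := fun a b =>
    (intervalIntegrable_H F a b).mul_continuousOn (by fun_prop)
  have hsplit := intervalIntegral.integral_add_adjacent_intervals (hi 0 z) (hi z t)
  have h2 : ∫ s in z..t, H F s * √s ≤ ε / 3 * A F t * √t := by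
    have hI : ∀ a, IntervalIntegrable (fun s : ℝ => s ^ (-(3 / 4) : ℝ)) volume a t := fun a =>
      intervalIntegral.intervalIntegrable_rpow' (by norm_num)
    calc ∫ s in z..t, H F s * √s
        ≤ ∫ s in z..t, ε / 12 * A F t * t ^ (1 / 4 : ℝ) * s ^ (-(3 / 4) : ℝ) := by
          refine intervalIntegral.integral_mono_on htz (hi z t) ((hI z).const_mul _) fun s hs => ?_
          have hs0 : 0 < s := hz0.trans_le hs.1
          have e1 := (hx₂ s ((le_max_right _ _).trans hs.1)).2
          have e2 := (hP s t (hz1.trans hs.1) hs.2).2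
          have e3 : H F s ≤ ε / 12 * (A F t * (t / s) ^ (1 / 4 : ℝ)) / s := by
            rw [le_div_iff₀ hs0]
            calc H F s * s = s * H F s := mul_comm _ _
              _ ≤ ε / 12 * A F s := e1
              _ ≤ _ := by gcongr
          have e4 : √s / s * (1 / s ^ (1 / 4 : ℝ)) = s ^ (-(3 / 4) : ℝ) := by
            rw [Real.sqrt_eq_rpow, one_div (s ^ _), ← Real.rpow_neg hs0.le, ← Real.rpow_sub_one hs0.ne',
              ← Real.rpow_add hs0]
            norm_num
          calc H F s * √s ≤ ε / 12 * (A F t * (t / s) ^ (1 / 4 : ℝ)) / s * √s := by gcongr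
            _ = ε / 12 * A F t * t ^ (1 / 4 : ℝ) * (√s / s * (1 / s ^ (1 / 4 : ℝ))) := by
                rw [Real.div_rpow ht0.le hs0.le]; ring
            _ = _ := by rw [e4]
      _ = ε / 12 * A F t * t ^ (1 / 4 : ℝ) * ∫ s in z..t, s ^ (-(3 / 4) : ℝ) :=
          intervalIntegral.integral_const_mul _ _
      _ ≤ ε / 12 * A F t * t ^ (1 / 4 : ℝ) * (4 * t ^ (1 / 4 : ℝ)) := by
          gcongr
          rw [integral_rpow (Or.inl (by norm_num))]
          have : 0 ≤ z ^ (-(3 / 4) + 1 : ℝ) := Real.rpow_nonneg hz0.le _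
          have e : (-(3 / 4) + 1 : ℝ) = 1 / 4 := by norm_num
          rw [e] at this ⊢
          linarith
      _ = ε / 3 * A F t * √t := by
          have : t ^ (1 / 4 : ℝ) * t ^ (1 / 4 : ℝ) = √t := by
            rw [← Real.rpow_add ht0, Real.sqrt_eq_rpow]; norm_num
          rw [← this]; ring
  have h3 : t * trm F (1 / t) * √t = ∫ y, (min |y| t) ^ (3 / 2 : ℝ) ∂F := by
    have e1 : t * √t = t ^ (3 / 2 : ℝ) := by
      rw [Real.sqrt_eq_rpow, ← Real.rpow_one_add' ht0.le (by norm_num)]; norm_num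
    rw [mul_right_comm, e1, trm, ← integral_const_mul]
    congr 1; ext y
    rw [← Real.mul_rpow ht0.le (le_min zero_le_one (by positivity)), mul_min_of_nonneg _ _ ht0.le,
      mul_one, ← mul_assoc, mul_one_div_cancel ht0.ne', one_mul, min_comm]
  have h4 := integral_min_rpow_le F ht0
  rw [← h3, ← hsplit] at h4
  have hst : 1 ≤ √t := by rwa [Real.one_le_sqrt]
  have h5 : C ≤ ε / 3 * A F t * √t := by
    rw [div_le_iff₀ hε] at htA
    have : C ≤ ε / 3 * A F t := by linarith
    have h0 : 0 ≤ ε / 3 * A F t := by positivity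
    nlinarith
  have h6 : t * trm F (1 / t) * √t ≤ ε * A F t * √t := by linarith
  exact le_of_mul_le_mul_right h6 (by linarith)

lemma eventually_trm_le' (ha : Ha F) (hA : Tendsto (A F) atTop atTop) {ε : ℝ} (hε : 0 < ε) :
    ∀ᶠ θ in 𝓝[>] (0:ℝ), trm F θ ≤ ε * (θ * A F (1 / θ)) := by
  have h := tendsto_inv_nhdsGT_zero.eventually (eventually_trm_le ha hA hε)
  filter_upwards [h, self_mem_nhdsWithin] with θ h1 hθ
  have hθ : 0 < θ := hθ
  rw [one_div, inv_inv, inv_mul_le_iff₀ hθ] at h1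
  rw [one_div]; linarith

lemma integrable_cexp (F : Measure ℝ) [IsProbabilityMeasure F] (θ : ℝ) :
    Integrable (fun x : ℝ => Complex.exp (θ * x * Complex.I)) F := by
  refine (integrable_const (1:ℝ)).mono' (by fun_prop) (ae_of_all _ fun x => ?_)
  rw [← Complex.ofReal_mul, Complex.norm_exp_ofReal_mul_I]

lemma charFun_re (F : Measure ℝ) [IsProbabilityMeasure F] (θ : ℝ) :
    (charFun F θ).re = ∫ x, Real.cos (θ * x) ∂F := by
  rw [charFun_apply_real, ← RCLike.re_eq_complex_re, ← integral_re (integrable_cexp F θ)]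
  refine integral_congr_ae (ae_of_all _ fun x => ?_)
  change (Complex.exp (θ * x * Complex.I)).re = _
  rw [← Complex.ofReal_mul, Complex.exp_ofReal_mul_I_re]

lemma charFun_im (F : Measure ℝ) [IsProbabilityMeasure F] (θ : ℝ) :
    (charFun F θ).im = ∫ x, Real.sin (θ * x) ∂F := by
  rw [charFun_apply_real, ← RCLike.im_eq_complex_im, ← integral_im (integrable_cexp F θ)]
  refine integral_congr_ae (ae_of_all _ fun x => ?_)
  change (Complex.exp (θ * x * Complex.I)).im = _
  rw [← Complex.ofReal_mul, Complex.exp_ofReal_mul_I_im]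

lemma integrable_cos (F : Measure ℝ) [IsProbabilityMeasure F] (θ : ℝ) :
    Integrable (fun x : ℝ => Real.cos (θ * x)) F :=
  (integrable_const (1:ℝ)).mono' (by fun_prop) (ae_of_all _ fun x => Real.abs_cos_le_one _)

lemma integrable_sin (F : Measure ℝ) [IsProbabilityMeasure F] (θ : ℝ) :
    Integrable (fun x : ℝ => Real.sin (θ * x)) F :=
  (integrable_const (1:ℝ)).mono' (by fun_prop) (ae_of_all _ fun x => Real.abs_sin_le_one _)

lemma one_sub_charFun_re (F : Measure ℝ) [IsProbabilityMeasure F] (θ : ℝ) :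
    (1 - charFun F θ).re = ∫ x, (1 - Real.cos (θ * x)) ∂F := by
  rw [integral_sub (integrable_const _) (integrable_cos F θ), Complex.sub_re, charFun_re]
  simp

lemma one_sub_charFun_re_nonneg (F : Measure ℝ) [IsProbabilityMeasure F] (θ : ℝ) :
    0 ≤ (1 - charFun F θ).re := by
  rw [one_sub_charFun_re]
  exact integral_nonneg fun x => sub_nonneg.2 (Real.cos_le_one _)

lemma sq_le_min_rpow {u : ℝ} (hu : 0 ≤ u) (h1 : u ≤ 1) : u ^ 2 ≤ (min 1 u) ^ (3 / 2 : ℝ) := by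
  rw [min_eq_right h1, ← Real.rpow_natCast]
  exact Real.rpow_le_rpow_of_exponent_ge' hu h1 (by norm_num) (by norm_num)

lemma one_sub_cos_le (u : ℝ) : 1 - Real.cos u ≤ 2 * (min 1 |u|) ^ (3 / 2 : ℝ) := by
  rcases le_total |u| 1 with h | h
  · have h1 := sq_le_min_rpow (abs_nonneg u) h
    have h2 := Real.one_sub_sq_div_two_le_cos (x := u)
    rw [sq_abs] at h1
    nlinarith [sq_nonneg u]
  · rw [min_eq_left h, Real.one_rpow]
    have := Real.neg_one_le_cos u
    linarith

lemma abs_sin_sub_trunc_le (u : ℝ) :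
    |Real.sin u - max (-1) (min u 1)| ≤ 2 * (min 1 |u|) ^ (3 / 2 : ℝ) := by
  rcases le_total |u| 1 with h | h
  · have h1 := sq_le_min_rpow (abs_nonneg u) h
    rw [sq_abs] at h1
    have h3 := abs_le.1 h
    rw [min_eq_left h3.2, max_eq_right h3.1, abs_sub_comm]
    have : |u - Real.sin u| ≤ u ^ 2 := by
      have h4 : ∀ v, 0 ≤ v → v ≤ 1 → |v - Real.sin v| ≤ v ^ 2 := by
        intro v h0 hv
        rw [abs_of_nonneg (by have := Real.sin_le h0; linarith)]
        rcases h0.eq_or_lt with rfl | h0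
        · simp
        · have := Real.sin_gt_sub_cube h0
          nlinarith [sq_nonneg v, pow_pos h0 2]
      rcases le_total 0 u with h0 | h0
      · exact h4 u h0 h3.2
      · have := h4 (-u) (by linarith) (by linarith)
        rw [Real.sin_neg, ← abs_neg] at this
        ring_nf at this ⊢
        linarith
    nlinarith [sq_nonneg u]
  · rw [min_eq_left h, Real.one_rpow]
    have h1 := Real.abs_sin_le_one u
    have h2 : |max (-1) (min u 1)| ≤ 1 :=
      abs_le.2 ⟨le_max_left _ _, max_le (by norm_num) (min_le_right _ _)⟩
    exact (abs_sub _ _).trans (by linarith)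

lemma one_sub_charFun_re_le {θ : ℝ} (hθ : 0 < θ) :
    (1 - charFun F θ).re ≤ 2 * trm F θ := by
  rw [one_sub_charFun_re, trm, ← integral_const_mul]
  refine integral_mono ((integrable_const _).sub (integrable_cos F θ))
    ((integrable_min_one_rpow F hθ.le).const_mul 2) fun x => ?_
  have := one_sub_cos_le (θ * x)
  rwa [abs_mul, abs_of_pos hθ] at this

lemma abs_one_sub_charFun_im_le {θ : ℝ} (hθ : 0 < θ) :
    |(1 - charFun F θ).im + θ * A F (1 / θ)| ≤ 2 * trm F θ := by
  have hi : Integrable (fun y : ℝ => max (-(1 / θ)) (min y (1 / θ))) F := by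
    refine (integrable_const (1 / θ)).mono' (by fun_prop) (ae_of_all _ fun y => ?_)
    have : 0 < 1 / θ := by positivity
    exact abs_le.2 ⟨le_max_left _ _, max_le (by linarith) (min_le_right _ _)⟩
  have e : (1 - charFun F θ).im + θ * A F (1 / θ)
      = -∫ x, (Real.sin (θ * x) - θ * max (-(1 / θ)) (min x (1 / θ))) ∂F := by
    rw [integral_sub (integrable_sin F θ) (hi.const_mul θ), integral_const_mul,
      ← A_eq_integral_trunc F (by positivity), Complex.sub_im, charFun_im]
    simp
    ring
  rw [e, abs_neg, trm, ← integral_const_mul]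
  refine abs_integral_le_integral_abs.trans (integral_mono ((integrable_sin F θ).sub
    (hi.const_mul θ)).abs ((integrable_min_one_rpow F hθ.le).const_mul 2) fun x => ?_)
  have := abs_sin_sub_trunc_le (θ * x)
  rw [abs_mul, abs_of_pos hθ] at this
  refine le_trans (le_of_eq ?_) this
  dsimp only
  rw [mul_max_of_nonneg _ _ hθ.le, mul_min_of_nonneg _ _ hθ.le, mul_neg, mul_one_div_cancel hθ.ne']

lemma norm_cexp_sub_one_le (u : ℝ) : ‖Complex.exp (u * Complex.I) - 1‖ ≤ 2 * min 1 |u| := by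
  rcases le_total |u| 1 with h | h
  · rw [min_eq_right h]
    have := Real.norm_exp_I_mul_ofReal_sub_one_le (x := u)
    rw [mul_comm] at this
    rw [Real.norm_eq_abs] at this
    linarith [abs_nonneg u]
  · rw [min_eq_left h]
    refine (norm_sub_le _ _).trans ?_
    rw [Complex.norm_exp_ofReal_mul_I]; norm_num

lemma norm_charFun_sub_le {θ h : ℝ} (hh : 0 < h) (hhθ : h ≤ θ) :
    ‖charFun F (θ + h) - charFun F θ‖ ≤ ‖1 - charFun F h‖ + 4 * √(θ / h) * trm F h := by
  have hθ : 0 < θ := hh.trans_le hhθ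
  set f : ℝ → ℂ := fun x => (Complex.exp ((θ * x : ℝ) * Complex.I) - 1) *
    (Complex.exp ((h * x : ℝ) * Complex.I) - 1)
  have hfb : ∀ x, ‖f x‖ ≤ 4 * √(θ / h) * (min 1 (h * |x|)) ^ (3 / 2 : ℝ) := by
    intro x
    have h1 := norm_cexp_sub_one_le (θ * x)
    have h2 := norm_cexp_sub_one_le (h * x)
    rw [abs_mul, abs_of_pos hθ] at h1
    rw [abs_mul, abs_of_pos hh] at h2
    set a := min 1 (θ * |x|)
    set b := min 1 (h * |x|)
    have ha0 : 0 ≤ a := le_min zero_le_one (by positivity)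
    have hb0 : 0 ≤ b := le_min zero_le_one (by positivity)
    have ha1 : a ≤ 1 := min_le_left _ _
    have hab : a ≤ θ / h * b := by
      simp only [a, b]
      rw [mul_min_of_nonneg _ _ (by positivity), mul_one, ← mul_assoc, div_mul_cancel₀ _ hh.ne']
      exact min_le_min_right _ (by rwa [one_le_div hh])
    have ha2 : a ≤ √(θ / h) * √b := by
      rw [← Real.sqrt_mul (by positivity)]
      refine Real.le_sqrt_of_sq_le ?_
      nlinarith
    have hb2 : √b * b = b ^ (3 / 2 : ℝ) := by
      rw [Real.sqrt_eq_rpow, ← Real.rpow_add_one' hb0 (by norm_num)]; norm_num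
    rw [norm_mul]
    calc _ ≤ (2 * a) * (2 * b) := by gcongr
      _ ≤ (2 * (√(θ / h) * √b)) * (2 * b) := by gcongr
      _ = 4 * √(θ / h) * (√b * b) := by ring
      _ = _ := by rw [hb2]
  have hfi : Integrable f F :=
    ((integrable_min_one_rpow F hh.le).const_mul (4 * √(θ / h))).mono' (by fun_prop)
      (ae_of_all _ hfb)
  have e : charFun F (θ + h) - charFun F θ = ∫ x, f x ∂F - (1 - charFun F h) := by
    have e1 : ∀ x : ℝ, f x = Complex.exp ((θ + h : ℝ) * x * Complex.I)
        - Complex.exp (θ * x * Complex.I) - Complex.exp (h * x * Complex.I) + 1 := fun x => by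
      have : ((θ + h : ℝ) * x * Complex.I : ℂ) = θ * x * Complex.I + h * x * Complex.I := by
        push_cast; ring
      rw [this, Complex.exp_add]
      simp only [f]; push_cast; ring
    simp_rw [e1]
    rw [integral_add, integral_sub, integral_sub, ← charFun_apply_real, ← charFun_apply_real,
      ← charFun_apply_real]
    · simp
      ring
    · exact integrable_cexp F _
    · exact integrable_cexp F _
    · exact (integrable_cexp F _).sub (integrable_cexp F _)
    · exact integrable_cexp F _
    · exact ((integrable_cexp F _).sub (integrable_cexp F _)).sub (integrable_cexp F _)
    · exact integrable_const _
  rw [e]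
  refine (norm_sub_le _ _).trans ?_
  rw [add_comm]
  gcongr
  rw [trm, ← integral_const_mul]
  exact (norm_integral_le_integral_norm _).trans (integral_mono hfi.norm
    ((integrable_min_one_rpow F hh.le).const_mul _) hfb)

lemma tendsto_one_sub_charFun_div (ha : Ha F) (hA : Tendsto (A F) atTop atTop) :
    Tendsto (fun θ : ℝ => (1 - charFun F θ) / ((θ * A F (1 / θ) : ℝ) : ℂ)) (𝓝[>] 0)
      (𝓝 (-Complex.I)) := by
  rw [Metric.tendsto_nhds]
  intro ε hε
  have hpos : ∀ᶠ θ in 𝓝[>] (0:ℝ), 0 < A F (1 / θ) := by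
    simp_rw [one_div]
    exact tendsto_inv_nhdsGT_zero.eventually (hA.eventually_gt_atTop 0)
  filter_upwards [eventually_trm_le' ha hA (show 0 < ε / 8 by positivity), hpos,
    self_mem_nhdsWithin] with θ h1 h2 hθ
  have hθ : 0 < θ := hθ
  set r := θ * A F (1 / θ)
  have hr : 0 < r := mul_pos hθ h2
  have e1 : (1 - charFun F θ) / (r : ℂ) - -Complex.I = (1 - charFun F θ + r * Complex.I) / r := by
    have : (r : ℂ) ≠ 0 := by exact_mod_cast hr.ne'
    field_simp; ring
  rw [dist_eq_norm, e1, norm_div, Complex.norm_real, Real.norm_eq_abs, abs_of_pos hr, div_lt_iff₀ hr]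
  refine (Complex.norm_le_abs_re_add_abs_im _).trans_lt ?_
  have h3 := one_sub_charFun_re_le (F := F) hθ
  have h4 := one_sub_charFun_re_nonneg F θ
  have h5 := abs_one_sub_charFun_im_le (F := F) hθ
  have e2 : (1 - charFun F θ + r * Complex.I).re = (1 - charFun F θ).re := by simp
  have e3 : (1 - charFun F θ + r * Complex.I).im = (1 - charFun F θ).im + r := by simp
  rw [e2, e3, abs_of_nonneg h4]
  have : 0 < ε * r := by positivity
  linarith

lemma eventually_pos_scaled (hA : Tendsto (A F) atTop atTop) :
    ∀ᶠ θ in 𝓝[>] (0:ℝ), 0 < θ * A F (1 / θ) := by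
  have hpos : ∀ᶠ θ in 𝓝[>] (0:ℝ), 0 < A F (1 / θ) := by
    simp_rw [one_div]
    exact tendsto_inv_nhdsGT_zero.eventually (hA.eventually_gt_atTop 0)
  filter_upwards [hpos, self_mem_nhdsWithin] with θ h2 hθ
  exact mul_pos hθ h2

/-- Near the origin `1 / (1 - φ(θ))` behaves like `i / (θ A(1/θ))`. -/
lemma tendsto_mul_inv_one_sub_charFun (ha : Ha F) (hA : Tendsto (A F) atTop atTop) :
    Tendsto (fun θ : ℝ => ((θ * A F (1 / θ) : ℝ) : ℂ) * (1 - charFun F θ)⁻¹) (𝓝[>] 0)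
      (𝓝 Complex.I) := by
  have h := (tendsto_one_sub_charFun_div ha hA).inv₀ (neg_ne_zero.2 Complex.I_ne_zero)
  rw [inv_neg, Complex.inv_I, neg_neg] at h
  refine h.congr fun θ => ?_
  rw [inv_div, div_eq_mul_inv]

end Renewal

namespace Renewal

/-- The difference between `1 - cos` and its averaged version `(π / 2) 1_{(1, ∞)}`. -/
noncomputable def psi (u : ℝ) : ℝ := 1 - Real.cos u - (Ioi (1:ℝ)).indicator (fun _ => Real.pi / 2) u

lemma measurable_psi : Measurable psi :=
  (by fun_prop : Measurable fun u : ℝ => 1 - Real.cos u).sub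
    (measurable_const.indicator measurableSet_Ioi)

lemma abs_psi_le {u : ℝ} (hu : 0 ≤ u) : |psi u| ≤ 4 ∧ |psi u| ≤ 4 * u ^ 2 := by
  have h1 := Real.cos_le_one u
  have h2 := Real.neg_one_le_cos u
  have h3 := Real.one_sub_sq_div_two_le_cos (x := u)
  have hpi := Real.pi_pos
  have hpi4 := Real.pi_le_four
  unfold psi
  by_cases h : 1 < u
  · rw [indicator_of_mem (show u ∈ Ioi (1:ℝ) from h)]
    have : |1 - Real.cos u - Real.pi / 2| ≤ 4 := abs_le.2 ⟨by linarith, by linarith⟩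
    exact ⟨this, this.trans (by nlinarith)⟩
  · rw [indicator_of_notMem (show u ∉ Ioi (1:ℝ) from h), sub_zero, abs_of_nonneg (by linarith)]
    exact ⟨by linarith, by nlinarith [sq_nonneg u]⟩

lemma integrableOn_psi_weight :
    IntegrableOn (fun u => |psi u| / u ^ 2 * (√u + √(1 / u))) (Ioi 0) := by
  have hm : Measurable (fun u => |psi u| / u ^ 2 * (√u + √(1 / u))) := by
    have := measurable_psi; fun_prop
  rw [← Ioc_union_Ioi_eq_Ioi (zero_le_one (α := ℝ))]
  refine IntegrableOn.union ?_ ?_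
  · have h : IntegrableOn (fun u : ℝ => 8 * u ^ (-(1 / 2) : ℝ)) (Ioc 0 1) :=
      ((intervalIntegrable_iff_integrableOn_Ioc_of_le zero_le_one).1
        (intervalIntegral.intervalIntegrable_rpow' (by norm_num))).const_mul 8
    refine h.mono' hm.aestronglyMeasurable ((ae_restrict_mem measurableSet_Ioc).mono fun u hu => ?_)
    have hu0 : 0 < u := hu.1
    have e1 : √(1 / u) = u ^ (-(1 / 2) : ℝ) := by
      rw [Real.sqrt_eq_rpow, one_div, Real.inv_rpow hu0.le, Real.rpow_neg hu0.le]
    have e2 : √u ≤ √(1 / u) := Real.sqrt_le_sqrt (hu.2.trans (by rw [one_le_div hu0]; exact hu.2))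
    rw [Real.norm_eq_abs, abs_of_nonneg (by positivity), ← e1]
    have e3 : |psi u| / u ^ 2 ≤ 4 := by
      rw [div_le_iff₀ (by positivity)]; exact (abs_psi_le hu0.le).2
    calc _ ≤ 4 * (√(1 / u) + √(1 / u)) := by gcongr
      _ = _ := by ring
  · have h : IntegrableOn (fun u : ℝ => 8 * u ^ (-(3 / 2) : ℝ)) (Ioi 1) :=
      (integrableOn_Ioi_rpow_of_lt (by norm_num) one_pos).const_mul 8
    refine h.mono' hm.aestronglyMeasurable ((ae_restrict_mem measurableSet_Ioi).mono fun u hu => ?_)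
    have hu1 : 1 < u := hu
    have hu0 : 0 < u := by linarith
    have e2 : √(1 / u) ≤ √u := by
      refine Real.sqrt_le_sqrt (le_trans ?_ hu1.le); rw [div_le_one hu0]; exact hu1.le
    have e1 : √u / u ^ 2 = u ^ (-(3 / 2) : ℝ) := by
      rw [Real.sqrt_eq_rpow, ← Real.rpow_natCast, ← Real.rpow_sub hu0]; norm_num
    rw [Real.norm_eq_abs, abs_of_nonneg (by positivity), ← e1]
    calc _ ≤ 4 / u ^ 2 * (√u + √u) := by gcongr; exact (abs_psi_le hu0.le).1
      _ = _ := by ring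

lemma integrableOn_psi_div_sq : IntegrableOn (fun u => psi u / u ^ 2) (Ioi 0) := by
  have hm : Measurable (fun u => psi u / u ^ 2) := by
    have := measurable_psi; fun_prop
  refine integrableOn_psi_weight.mono' hm.aestronglyMeasurable
    ((ae_restrict_mem measurableSet_Ioi).mono fun u hu => ?_)
  have hu0 : 0 < u := hu
  rw [Real.norm_eq_abs, abs_div, abs_of_pos (by positivity : 0 < u ^ 2)]
  refine le_mul_of_one_le_right (by positivity) ?_
  rcases le_total 1 u with h | h
  · have : 1 ≤ √u := by rwa [Real.one_le_sqrt]
    linarith [Real.sqrt_nonneg (1 / u)]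
  · have : 1 ≤ √(1 / u) := by rw [Real.one_le_sqrt, one_le_div hu0]; exact h
    linarith [Real.sqrt_nonneg u]

lemma integral_psi_div_sq : ∫ u in Ioi (0:ℝ), psi u / u ^ 2 = 0 := by
  have h1 := integral_one_sub_cos_div_sq zero_le_one
  have hi := integrableOn_one_sub_cos_div_sq 1
  simp only [mul_one] at h1 hi
  have h2 : ∫ u in Ioi (0:ℝ), (Ioi (1:ℝ)).indicator (fun u => Real.pi / 2 * u ^ (-2 : ℝ)) u
      = Real.pi / 2 := by
    rw [setIntegral_indicator measurableSet_Ioi, inter_eq_self_of_subset_right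
      (Ioi_subset_Ioi zero_le_one), integral_const_mul, integral_Ioi_rpow_of_lt (by norm_num) one_pos]
    norm_num
  have hi2 : IntegrableOn ((Ioi (1:ℝ)).indicator (fun u => Real.pi / 2 * u ^ (-2 : ℝ))) (Ioi 0) := by
    refine Integrable.integrableOn ?_
    rw [integrable_indicator_iff measurableSet_Ioi]
    exact (integrableOn_Ioi_rpow_of_lt (by norm_num) one_pos).const_mul _
  have : ∀ u ∈ Ioi (0:ℝ), psi u / u ^ 2 = (1 - Real.cos u) / u ^ 2
      - (Ioi (1:ℝ)).indicator (fun u => Real.pi / 2 * u ^ (-2 : ℝ)) u := by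
    intro u hu
    have hu0 : 0 < u := hu
    unfold psi
    by_cases h : 1 < u
    · rw [indicator_of_mem (show u ∈ Ioi (1:ℝ) from h), indicator_of_mem (show u ∈ Ioi (1:ℝ) from h),
        Real.rpow_neg hu0.le]
      norm_cast
      ring
    · rw [indicator_of_notMem (show u ∉ Ioi (1:ℝ) from h),
        indicator_of_notMem (show u ∉ Ioi (1:ℝ) from h)]; ring
  rw [setIntegral_congr_fun measurableSet_Ioi this, integral_sub hi hi2, h1, h2]; ring

/-- `1 / (θ A(1/θ))²`. -/
noncomputable def rho (F : Measure ℝ) (θ : ℝ) : ℝ := ((θ * A F (1 / θ)) ^ 2)⁻¹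

variable {F : Measure ℝ} [IsProbabilityMeasure F]

lemma measurable_rho : Measurable (rho F) := by
  have := (continuous_A F).measurable
  unfold rho; fun_prop

lemma rho_nonneg (θ : ℝ) : 0 ≤ rho F θ := inv_nonneg.2 (sq_nonneg _)

/-- Quantities that vanish quadratically at `0` are integrable against `rho`. -/
lemma exists_integral_mul_rho_le (ha : Ha F) :
    ∃ x₀ : ℝ, 0 < x₀ ∧ (∀ s, x₀ ≤ s → 0 < A F s) ∧ ∀ f : ℝ → ℝ, Measurable f →
      (∀ u, 0 ≤ u → |f u| ≤ 4 * u ^ 2) → ∀ x, x₀ ≤ x → ∀ y, 0 ≤ y →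
        IntegrableOn (fun θ => f (θ * y) * rho F θ) (Ioo 0 (1 / x)) ∧
        ∫ θ in Ioo 0 (1 / x), |f (θ * y) * rho F θ| ≤ 24 * (x / A F x ^ 2) * (y / x) ^ 2 := by
  obtain ⟨x₁, h10, hp, hR⟩ := ha.slowVar.sq.ratio one_pos
  have hpA := hp
  obtain ⟨x₂, hx₂⟩ := eventually_atTop.1 (ha.eventually_bound one_pos)
  refine ⟨max x₁ x₂, by positivity, fun s hs => (hx₂ s ((le_max_right _ _).trans hs)).1,
    fun f hf hfb x hx y hy => ?_⟩
  have hx1 : x₁ ≤ x := (le_max_left _ _).trans hx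
  have hx0 : 0 < x := h10.trans_le hx1
  have hA : 0 < A F x := (hx₂ x ((le_max_right _ _).trans hx)).1
  set c := 12 * y ^ 2 / (√x * A F x ^ 2) with hc
  have hb : ∀ θ ∈ Ioo 0 (1 / x), |f (θ * y) * rho F θ| ≤ c * θ ^ (-(1 / 2) : ℝ) := by
    intro θ hθ
    have hθ0 : 0 < θ := hθ.1
    have hxθ : x < 1 / θ := by rw [lt_one_div hx0 hθ0]; exact hθ.2
    have hr := (abs_le.1 (hR x (1 / θ) hx1 (hx1.trans hxθ.le))).2
    have e1 : x / (1 / θ) = x * θ := by field_simp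
    have e2 : 1 / θ / x = 1 / (x * θ) := by field_simp
    rw [e1, e2, one_mul] at hr
    have hu : x * θ < 1 := by rw [lt_div_iff₀ hθ0] at hxθ; exact hxθ
    have hu0 : 0 < x * θ := mul_pos hx0 hθ0
    have h1 : 1 ≤ √(1 / (x * θ)) := by rw [Real.one_le_sqrt, one_le_div hu0]; exact hu.le
    have h2 : √(x * θ) ≤ 1 := Real.sqrt_le_one.2 hu.le
    have h3 : A F x ^ 2 / A F (1 / θ) ^ 2 ≤ 3 * √(1 / (x * θ)) := by linarith
    have hAθ : 0 < A F (1 / θ) := (hx₂ _ (((le_max_right _ _).trans hx).trans hxθ.le)).1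
    have e3 : √(1 / (x * θ)) = θ ^ (-(1 / 2) : ℝ) / √x := by
      rw [one_div, Real.sqrt_inv, Real.sqrt_mul hx0.le, mul_inv, Real.rpow_neg hθ0.le,
        ← Real.sqrt_eq_rpow]; ring
    rw [e3] at h3
    rw [abs_mul, abs_of_nonneg (rho_nonneg (F := F) θ)]
    have e4 : rho F θ = A F x ^ 2 / A F (1 / θ) ^ 2 / (θ ^ 2 * A F x ^ 2) := by
      unfold rho; field_simp
    rw [e4]
    calc |f (θ * y)| * (A F x ^ 2 / A F (1 / θ) ^ 2 / (θ ^ 2 * A F x ^ 2))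
        ≤ 4 * (θ * y) ^ 2 * (3 * (θ ^ (-(1 / 2) : ℝ) / √x) / (θ ^ 2 * A F x ^ 2)) := by
          gcongr; exact hfb _ (by positivity)
      _ = c * θ ^ (-(1 / 2) : ℝ) := by rw [hc]; field_simp; ring
  have hg : IntervalIntegrable (fun θ : ℝ => c * θ ^ (-(1 / 2) : ℝ)) volume 0 (1 / x) :=
    (intervalIntegral.intervalIntegrable_rpow' (by norm_num)).const_mul c
  have hx' : (0:ℝ) ≤ 1 / x := by positivity
  have hg' : IntegrableOn (fun θ : ℝ => c * θ ^ (-(1 / 2) : ℝ)) (Ioo 0 (1 / x)) :=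
    ((intervalIntegrable_iff_integrableOn_Ioc_of_le hx').1 hg).mono_set Ioo_subset_Ioc_self
  have hfi : IntegrableOn (fun θ => f (θ * y) * rho F θ) (Ioo 0 (1 / x)) := by
    refine hg'.mono' (Measurable.aestronglyMeasurable ?_)
      ((ae_restrict_mem measurableSet_Ioo).mono hb)
    have := measurable_rho (F := F)
    fun_prop
  refine ⟨hfi, ?_⟩
  calc ∫ θ in Ioo 0 (1 / x), |f (θ * y) * rho F θ|
      ≤ ∫ θ in Ioo 0 (1 / x), c * θ ^ (-(1 / 2) : ℝ) :=
        setIntegral_mono_on hfi.abs hg' measurableSet_Ioo hb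
    _ = ∫ θ in (0:ℝ)..(1 / x), c * θ ^ (-(1 / 2) : ℝ) := by
        rw [intervalIntegral.integral_of_le hx', integral_Ioc_eq_integral_Ioo]
    _ = 24 * (x / A F x ^ 2) * (y / x) ^ 2 := by
        rw [intervalIntegral.integral_const_mul, integral_rpow (Or.inl (by norm_num)),
          Real.zero_rpow (by norm_num)]
        have : (-(1 / 2) + 1 : ℝ) = 1 / 2 := by norm_num
        rw [this, ← Real.sqrt_eq_rpow, Real.sqrt_div zero_le_one, Real.sqrt_one, hc]
        have h := Real.mul_self_sqrt hx0.le
        have h2 : 0 < √x := Real.sqrt_pos.2 hx0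
        have h3 : √x ^ 2 = x := Real.sq_sqrt hx0.le
        field_simp
        rw [h3]; ring

lemma abs_integral_psi_le (ha : Ha F) :
    ∃ c : ℝ, 0 ≤ c ∧ ∀ ε : ℝ, 0 < ε → ∃ x₀ : ℝ, 0 < x₀ ∧ ∀ x, x₀ ≤ x → ∀ y, x ≤ y →
      |∫ θ in Ioo 0 (1 / x), psi (θ * y) * rho F θ| ≤ (ε * c * y + 4 * x) / A F y ^ 2 := by
  set g : ℝ → ℝ := fun u => |psi u| / u ^ 2 * (√u + √(1 / u)) with hg
  refine ⟨∫ u in Ioi (0:ℝ), g u, setIntegral_nonneg measurableSet_Ioi fun u _ => by positivity,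
    fun ε hε => ?_⟩
  obtain ⟨x₁, h10, hp, hR⟩ := ha.slowVar.sq.ratio hε
  obtain ⟨x₂, h20, hpA, hI⟩ := exists_integral_mul_rho_le ha
  refine ⟨max x₁ x₂, by positivity, fun x hx y hxy => ?_⟩
  have hx1 : x₁ ≤ x := (le_max_left _ _).trans hx
  have hx2 : x₂ ≤ x := (le_max_right _ _).trans hx
  have hx0 : 0 < x := h10.trans_le hx1
  have hy0 : 0 < y := hx0.trans_le hxy
  have hAy := hpA y (hx2.trans hxy)
  have hi1 := (hI psi measurable_psi (fun u hu => (abs_psi_le hu).2) x hx2 y hy0.le).1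
  -- rescaled integrals
  have hsc : ∀ θ : ℝ, psi (θ * y) / θ ^ 2 = y ^ 2 * (psi (θ * y) / (θ * y) ^ 2) := fun θ => by
    rcases eq_or_ne θ 0 with rfl | h
    · simp
    · field_simp
  have hi2 : IntegrableOn (fun θ => psi (θ * y) / θ ^ 2) (Ioi 0) := by
    simp_rw [hsc]
    have := (integrableOn_Ioi_comp_mul_right_iff (fun u => psi u / u ^ 2) 0 hy0).2
      (by rw [zero_mul]; exact integrableOn_psi_div_sq)
    exact this.const_mul _
  have hv2 : ∫ θ in Ioi (0:ℝ), psi (θ * y) / θ ^ 2 = 0 := by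
    simp_rw [hsc]
    rw [integral_const_mul, integral_comp_mul_right_Ioi (fun u => psi u / u ^ 2) 0 hy0, zero_mul,
      integral_psi_div_sq]; simp
  have hi3 : IntegrableOn (fun θ => y ^ 2 * g (θ * y)) (Ioi 0) := by
    have := (integrableOn_Ioi_comp_mul_right_iff g 0 hy0).2
      (by rw [zero_mul]; exact integrableOn_psi_weight)
    exact this.const_mul _
  have hv3 : ∫ θ in Ioi (0:ℝ), y ^ 2 * g (θ * y) = (∫ u in Ioi (0:ℝ), g u) * y := by
    rw [integral_const_mul, integral_comp_mul_right_Ioi g 0 hy0, zero_mul, smul_eq_mul]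
    field_simp
  have hg0 : ∀ u, 0 ≤ g u := fun u => by positivity
  -- comparison of `rho` with its value frozen at `y`
  have hcomp : |∫ θ in Ioo 0 (1 / x), (psi (θ * y) * rho F θ - psi (θ * y) / θ ^ 2 / A F y ^ 2)|
      ≤ ε * ((∫ u in Ioi (0:ℝ), g u) * y) / A F y ^ 2 := by
    rw [← hv3]
    refine abs_integral_le_integral_abs.trans ?_
    calc _ ≤ ∫ θ in Ioo 0 (1 / x), ε * (y ^ 2 * g (θ * y)) / A F y ^ 2 := by
          refine setIntegral_mono_on ?_ ?_ measurableSet_Ioo fun θ hθ => ?_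
          · exact (hi1.sub ((hi2.mono_set Ioo_subset_Ioi_self).div_const _)).abs
          · exact ((hi3.mono_set Ioo_subset_Ioi_self).const_mul ε).div_const _
          · have hθ0 : 0 < θ := hθ.1
            have hxθ : x < 1 / θ := by rw [lt_one_div hx0 hθ0]; exact hθ.2
            have hr := hR y (1 / θ) (hx1.trans hxy) (hx1.trans hxθ.le)
            have e1 : y / (1 / θ) = θ * y := by field_simp
            have e2 : 1 / θ / y = 1 / (θ * y) := by field_simp
            rw [e1, e2] at hr
            have hAθ := hpA (1 / θ) (hx2.trans hxθ.le)
            have e3 : psi (θ * y) * rho F θ - psi (θ * y) / θ ^ 2 / A F y ^ 2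
                = psi (θ * y) / θ ^ 2 / A F y ^ 2 * (A F y ^ 2 / A F (1 / θ) ^ 2 - 1) := by
              unfold rho; field_simp
            have e4 : y ^ 2 * g (θ * y) = |psi (θ * y)| / θ ^ 2 * (√(θ * y) + √(1 / (θ * y))) := by
              simp only [hg]; field_simp
            rw [e3, abs_mul, abs_div, abs_div, abs_of_pos (by positivity : 0 < θ ^ 2),
              abs_of_pos (by positivity : 0 < A F y ^ 2), e4]
            calc _ ≤ |psi (θ * y)| / θ ^ 2 / A F y ^ 2 * (ε * (√(θ * y) + √(1 / (θ * y)))) := by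
                  gcongr
              _ = _ := by ring
      _ ≤ ∫ θ in Ioi 0, ε * (y ^ 2 * g (θ * y)) / A F y ^ 2 := by
          refine setIntegral_mono_set ((hi3.const_mul ε).div_const _) (ae_of_all _ fun θ => ?_)
            Ioo_subset_Ioi_self.eventuallyLE
          have := hg0 (θ * y)
          change 0 ≤ _
          positivity
      _ = _ := by rw [integral_div, integral_const_mul]
  have htail : |∫ θ in Ioo 0 (1 / x), psi (θ * y) / θ ^ 2| ≤ 4 * x := by
    have hxi : (0:ℝ) < 1 / x := by positivity
    have hs : ∫ θ in Ioo 0 (1 / x), psi (θ * y) / θ ^ 2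
        = - ∫ θ in Ioi (1 / x), psi (θ * y) / θ ^ 2 := by
      rw [← integral_Ioc_eq_integral_Ioo]
      have := setIntegral_union (Ioc_disjoint_Ioi le_rfl) measurableSet_Ioi
        (hi2.mono_set (show Ioc 0 (1 / x) ⊆ Ioi 0 from Ioc_subset_Ioi_self)) (hi2.mono_set (Ioi_subset_Ioi hxi.le))
      rw [Ioc_union_Ioi_eq_Ioi hxi.le, hv2] at this
      linarith
    rw [hs, abs_neg]
    refine abs_integral_le_integral_abs.trans ?_
    have hi4 : IntegrableOn (fun θ : ℝ => 4 * θ ^ (-2 : ℝ)) (Ioi (1 / x)) :=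
      (integrableOn_Ioi_rpow_of_lt (by norm_num) hxi).const_mul 4
    calc _ ≤ ∫ θ in Ioi (1 / x), 4 * θ ^ (-2 : ℝ) := by
          refine setIntegral_mono_on (hi2.mono_set (Ioi_subset_Ioi hxi.le)).abs hi4
            measurableSet_Ioi fun θ hθ => ?_
          have hθ0 : 0 < θ := hxi.trans hθ
          have : θ ^ (-2 : ℝ) = (θ ^ 2)⁻¹ := by
            rw [Real.rpow_neg hθ0.le]; norm_cast
          rw [this, abs_div, abs_of_pos (by positivity : 0 < θ ^ 2), ← div_eq_mul_inv]
          gcongr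
          exact (abs_psi_le (by positivity)).1
      _ = 4 * x := by
          rw [integral_const_mul, integral_Ioi_rpow_of_lt (by norm_num) hxi]
          have : (-2 + 1 : ℝ) = -1 := by norm_num
          rw [this, Real.rpow_neg_one, one_div, inv_inv]; ring
  have hfin : ∫ θ in Ioo 0 (1 / x), psi (θ * y) * rho F θ
      = (∫ θ in Ioo 0 (1 / x), (psi (θ * y) * rho F θ - psi (θ * y) / θ ^ 2 / A F y ^ 2))
        + (∫ θ in Ioo 0 (1 / x), psi (θ * y) / θ ^ 2) / A F y ^ 2 := by
    rw [integral_sub hi1 ((hi2.mono_set Ioo_subset_Ioi_self).div_const _), integral_div]; ring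
  rw [hfin]
  refine (abs_add_le _ _).trans ?_
  rw [abs_div (∫ θ in Ioo 0 (1 / x), psi (θ * y) / θ ^ 2), abs_of_pos (by positivity : 0 < A F y ^ 2),
    add_div]
  refine add_le_add (hcomp.trans (le_of_eq (by ring))) ?_
  gcongr

/-- The mass that `rho` gives to `(1/y, 1/x)`. -/
noncomputable def tailMass (F : Measure ℝ) (x y : ℝ) : ℝ :=
  ∫ θ in Ioo 0 (1 / x), (Ioi (1:ℝ)).indicator (fun _ => 1) (θ * y) * rho F θ

lemma tailMass_nonneg (x y : ℝ) : 0 ≤ tailMass F x y :=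
  integral_nonneg fun θ => mul_nonneg (indicator_nonneg (fun _ _ => zero_le_one) _) (rho_nonneg θ)

lemma abs_indicator_Ioi_le {u : ℝ} (hu : 0 ≤ u) :
    |(Ioi (1:ℝ)).indicator (fun _ => (1:ℝ)) u| ≤ 4 * u ^ 2 := by
  by_cases h : 1 < u
  · rw [indicator_of_mem (show u ∈ Ioi (1:ℝ) from h), abs_one]; nlinarith
  · rw [indicator_of_notMem (show u ∉ Ioi (1:ℝ) from h), abs_zero]; positivity

lemma le_tailMass (ha : Ha F) :
    ∃ x₀ : ℝ, 0 < x₀ ∧ ∀ x, x₀ ≤ x → ∀ y, 2 * x ≤ y → y / A F y ^ 2 ≤ 8 * tailMass F x y := by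
  obtain ⟨x₁, h10, hp, hR⟩ := ha.slowVar.sq.ratio (show (0:ℝ) < 1 / 6 by norm_num)
  obtain ⟨x₂, h20, hpA, hI⟩ := exists_integral_mul_rho_le ha
  refine ⟨max x₁ x₂, by positivity, fun x hx y hxy => ?_⟩
  have hx1 : x₁ ≤ x := (le_max_left _ _).trans hx
  have hx2 : x₂ ≤ x := (le_max_right _ _).trans hx
  have hx0 : 0 < x := h10.trans_le hx1
  have hy0 : 0 < y := by linarith
  have hAy := hpA y (by linarith)
  have hi := (hI _ (measurable_const.indicator measurableSet_Ioi)
    (fun u hu => abs_indicator_Ioi_le hu) x hx2 y hy0.le).1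
  have hyx : 2 / y ≤ 1 / x := by rw [div_le_div_iff₀ hy0 hx0]; linarith
  have hsub : Ioo (1 / y) (2 / y) ⊆ Ioo 0 (1 / x) :=
    Ioo_subset_Ioo (by positivity) hyx
  have h1 : ∫ θ in Ioo (1 / y) (2 / y), y ^ 2 / (8 * A F y ^ 2) ≤ tailMass F x y := by
    calc _ ≤ ∫ θ in Ioo (1 / y) (2 / y), (Ioi (1:ℝ)).indicator (fun _ => 1) (θ * y) * rho F θ := by
          refine setIntegral_mono_on (by simp) (hi.mono_set hsub) measurableSet_Ioo fun θ hθ => ?_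
          have hθ0 : 0 < θ := (by positivity : 0 < 1 / y).trans hθ.1
          have hxθ : x < 1 / θ := by rw [lt_one_div hx0 hθ0]; exact (hsub hθ).2
          have hθy1 : 1 < θ * y := by rw [← div_lt_iff₀ hy0]; exact hθ.1
          have hθy2 : θ * y < 2 := by rw [← lt_div_iff₀ hy0]; exact hθ.2
          have hr := (abs_le.1 (hR y (1 / θ) (by linarith) (hx1.trans hxθ.le))).1
          have e1 : y / (1 / θ) = θ * y := by field_simp
          have e2 : 1 / θ / y = 1 / (θ * y) := by field_simp
          rw [e1, e2] at hr
          have h3 : √(θ * y) ≤ 2 := by rw [Real.sqrt_le_left (by norm_num)]; linarith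
          have h4 : √(1 / (θ * y)) ≤ 1 := by
            refine Real.sqrt_le_one.2 ?_; rw [div_le_one (by positivity)]; exact hθy1.le
          have hAθ := hpA (1 / θ) (hx2.trans hxθ.le)
          rw [indicator_of_mem (show θ * y ∈ Ioi (1:ℝ) from hθy1), one_mul]
          have e4 : rho F θ = A F y ^ 2 / A F (1 / θ) ^ 2 / (θ ^ 2 * A F y ^ 2) := by
            unfold rho; field_simp
          rw [e4]
          have h5 : 1 / 2 ≤ A F y ^ 2 / A F (1 / θ) ^ 2 := by linarith
          calc y ^ 2 / (8 * A F y ^ 2) ≤ 1 / 2 / (θ ^ 2 * A F y ^ 2) := by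
                rw [div_div, div_le_div_iff₀ (by positivity) (by positivity)]
                have : (θ * y) ^ 2 ≤ 4 := by nlinarith
                have h6 : 0 < A F y ^ 2 := by positivity
                nlinarith
            _ ≤ _ := by gcongr
      _ ≤ _ := setIntegral_mono_set hi (ae_of_all _ fun θ =>
          mul_nonneg (indicator_nonneg (fun _ _ => zero_le_one) _) (rho_nonneg θ)) hsub.eventuallyLE
  rw [setIntegral_const, measureReal_def, Real.volume_Ioo, ENNReal.toReal_ofReal
    (by rw [← sub_div]; norm_num; exact hy0.le), smul_eq_mul] at h1
  have e : (2 / y - 1 / y) * (y ^ 2 / (8 * A F y ^ 2)) = y / A F y ^ 2 / 8 := by field_simp; ring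
  rw [e] at h1
  linarith

lemma exists_kernel_bound (ha : Ha F) {ε : ℝ} (hε : 0 < ε) :
    ∃ C x₀ : ℝ, 0 < x₀ ∧ 0 ≤ C ∧ ∀ x, x₀ ≤ x → ∀ y, 0 ≤ y →
      |∫ θ in Ioo 0 (1 / x), psi (θ * y) * rho F θ| ≤
        ε * tailMass F x y + C * (x / A F x ^ 2) * (min 1 (1 / x * y)) ^ (3 / 2 : ℝ) := by
  obtain ⟨c, hc0, hc⟩ := abs_integral_psi_le ha
  obtain ⟨x₁, h10, h1⟩ := hc (ε / (16 * (c + 1))) (by positivity)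
  obtain ⟨x₂, h20, h2⟩ := le_tailMass ha
  obtain ⟨x₃, h30, hpA, h3⟩ := exists_integral_mul_rho_le ha
  set M := 2 + 64 / ε with hM
  have hM2 : 2 ≤ M := by rw [hM]; have : 0 < 64 / ε := by positivity
                         linarith
  refine ⟨24 * M ^ 2, max x₁ (max x₂ x₃), by positivity, by positivity, fun x hx y hy => ?_⟩
  have hx1 : x₁ ≤ x := (le_max_left _ _).trans hx
  have hx2 : x₂ ≤ x := ((le_max_left _ _).trans (le_max_right _ _)).trans hx
  have hx3 : x₃ ≤ x := ((le_max_right _ _).trans (le_max_right _ _)).trans hx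
  have hx0 : 0 < x := h10.trans_le hx1
  have hAx := hpA x hx3
  have hmin0 : 0 ≤ min 1 (1 / x * y) := le_min zero_le_one (by positivity)
  have hW := tailMass_nonneg (F := F) x y
  rcases le_total (M * x) y with h | h
  · have hxy : x ≤ y := by nlinarith
    have hAy := hpA y (hx3.trans hxy)
    have e1 := h1 x hx1 y hxy
    have e2 := h2 x hx2 y (by nlinarith)
    have e3 : (ε / (16 * (c + 1)) * c * y + 4 * x) ≤ ε / 8 * y := by
      have a1 : ε / (16 * (c + 1)) * c * y ≤ ε / 16 * y := by
        have : ε / (16 * (c + 1)) * c ≤ ε / 16 := by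
          rw [div_mul_eq_mul_div, div_le_div_iff₀ (by positivity) (by norm_num)]; nlinarith
        gcongr
      have a2 : 4 * x ≤ ε / 16 * y := by
        have : 64 / ε * x ≤ y := by nlinarith
        rw [div_mul_eq_mul_div, div_le_iff₀ hε] at this
        linarith
      linarith
    have e4 : |∫ θ in Ioo 0 (1 / x), psi (θ * y) * rho F θ| ≤ ε * tailMass F x y := by
      refine e1.trans ?_
      calc _ ≤ ε / 8 * y / A F y ^ 2 := by gcongr
        _ = ε / 8 * (y / A F y ^ 2) := by ring
        _ ≤ ε / 8 * (8 * tailMass F x y) := by gcongr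
        _ = _ := by ring
    refine e4.trans (le_add_of_nonneg_right ?_)
    have := Real.rpow_nonneg hmin0 (3 / 2)
    positivity
  · have e1 := (h3 psi measurable_psi (fun u hu => (abs_psi_le hu).2) x hx3 y hy).2
    refine (abs_integral_le_integral_abs.trans e1).trans ?_
    refine le_trans ?_ (le_add_of_nonneg_left (by positivity))
    have e2 : (y / x) ^ 2 ≤ M ^ 2 * (min 1 (1 / x * y)) ^ (3 / 2 : ℝ) := by
      have hyx : 1 / x * y = y / x := by ring
      rw [hyx]
      rcases le_total (y / x) 1 with h' | h'
      · have := sq_le_min_rpow (by positivity : 0 ≤ y / x) h'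
        refine this.trans (le_mul_of_one_le_left (Real.rpow_nonneg (by rw [← hyx]; exact hmin0) _) ?_)
        nlinarith
      · rw [min_eq_left h', Real.one_rpow, mul_one]
        have : y / x ≤ M := by rwa [div_le_iff₀ hx0]
        gcongr
    calc _ ≤ 24 * (x / A F x ^ 2) * (M ^ 2 * (min 1 (1 / x * y)) ^ (3 / 2 : ℝ)) := by gcongr
      _ = _ := by ring

end Renewal

namespace Renewal

variable {F : Measure ℝ} [IsProbabilityMeasure F]

lemma image_one_div_Ioo {x : ℝ} (hx : 0 < x) : (fun θ : ℝ => 1 / θ) '' Ioo 0 (1 / x) = Ioi x := by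
  ext t
  constructor
  · rintro ⟨θ, hθ, rfl⟩
    exact (lt_one_div hx hθ.1).2 hθ.2
  · intro ht
    have ht0 : 0 < t := hx.trans ht
    exact ⟨1 / t, ⟨by positivity, one_div_lt_one_div_of_lt hx ht⟩, by simp⟩

lemma integral_H_mul_rho (ha : Ha F) (hb : Hb F) :
    ∃ x₀ : ℝ, 0 < x₀ ∧ ∀ x, x₀ ≤ x →
      IntegrableOn (fun θ => H F (1 / θ) * rho F θ) (Ioo 0 (1 / x)) ∧
      ∫ θ in Ioo 0 (1 / x), H F (1 / θ) * rho F θ = (m F x)⁻¹ := by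
  obtain ⟨x₁, h0, hp, hi⟩ := hb.integrableOn ha
  refine ⟨x₁, h0, fun x hx => ?_⟩
  have hx0 : 0 < x := h0.trans_le hx
  have hd : ∀ θ ∈ Ioo 0 (1 / x), HasDerivWithinAt (fun θ : ℝ => 1 / θ) (-(θ ^ 2)⁻¹) (Ioo 0 (1 / x)) θ := by
    intro θ hθ
    simp_rw [one_div]
    exact (hasDerivAt_inv hθ.1.ne').hasDerivWithinAt
  have hinj : InjOn (fun θ : ℝ => 1 / θ) (Ioo 0 (1 / x)) := fun a _ b _ h => by simpa using h
  have he : ∀ θ : ℝ, |-(θ ^ 2)⁻¹| • (H F (1 / θ) / A F (1 / θ) ^ 2) = H F (1 / θ) * rho F θ := by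
    intro θ
    rw [abs_neg, abs_of_nonneg (by positivity), smul_eq_mul, rho, mul_pow, mul_inv]; ring
  have h1 := integrableOn_image_iff_integrableOn_abs_deriv_smul measurableSet_Ioo hd hinj
    (fun t => H F t / A F t ^ 2)
  have h2 := integral_image_eq_integral_abs_deriv_smul measurableSet_Ioo hd hinj
    (fun t => H F t / A F t ^ 2)
  simp only [he, image_one_div_Ioo hx0] at h1 h2
  exact ⟨h1.1 (hi.mono_set (Ioi_subset_Ioi hx)), by rw [← h2, m, inv_inv]⟩

lemma integral_indicator_eq_H {θ : ℝ} (hθ : 0 < θ) :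
    ∫ y, (Ioi (1:ℝ)).indicator (fun _ => (1:ℝ)) (θ * |y|) ∂F = H F (1 / θ) := by
  rw [H_eq_measureReal F (by positivity)]
  have : ∀ y : ℝ, (Ioi (1:ℝ)).indicator (fun _ => (1:ℝ)) (θ * |y|)
      = {y : ℝ | 1 / θ < |y|}.indicator (fun _ => (1:ℝ)) y := by
    intro y
    have : θ * |y| ∈ Ioi (1:ℝ) ↔ y ∈ {y : ℝ | 1 / θ < |y|} := by
      simp only [mem_Ioi, mem_ofPred_eq, div_lt_iff₀' hθ]
    by_cases h : y ∈ {y : ℝ | 1 / θ < |y|}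
    · rw [indicator_of_mem h, indicator_of_mem (this.2 h)]
    · rw [indicator_of_notMem h, indicator_of_notMem (mt this.1 h)]
  simp_rw [this]
  rw [integral_indicator_const _ (measurableSet_lt measurable_const (by fun_prop)), smul_eq_mul, mul_one]

lemma integral_one_sub_re_mul_rho (ha : Ha F) (hb : Hb F) {ε : ℝ} (hε : 0 < ε) :
    ∃ C x₀ : ℝ, 0 < x₀ ∧ 0 ≤ C ∧ ∀ x, x₀ ≤ x →
      IntegrableOn (fun θ => (1 - charFun F θ).re * rho F θ) (Ioo 0 (1 / x)) ∧
      |(∫ θ in Ioo 0 (1 / x), (1 - charFun F θ).re * rho F θ) - Real.pi / 2 * (m F x)⁻¹| ≤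
        ε * (m F x)⁻¹ + C * (x / A F x ^ 2) * trm F (1 / x) := by
  obtain ⟨C, x₁, h10, hC, h1⟩ := exists_kernel_bound ha hε
  obtain ⟨x₂, h20, h2⟩ := integral_H_mul_rho ha hb
  obtain ⟨x₃, h30, hpA, h3⟩ := exists_integral_mul_rho_le ha
  refine ⟨C, max x₁ (max x₂ x₃), by positivity, hC, fun x hx => ?_⟩
  have hx1 : x₁ ≤ x := (le_max_left _ _).trans hx
  have hx2 : x₂ ≤ x := ((le_max_left _ _).trans (le_max_right _ _)).trans hx
  have hx3 : x₃ ≤ x := ((le_max_right _ _).trans (le_max_right _ _)).trans hx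
  have hx0 : 0 < x := h10.trans_le hx1
  set ν := volume.restrict (Ioo 0 (1 / x)) with hν
  have hmr := measurable_rho (F := F)
  have hmp := measurable_psi
  have hmI : Measurable ((Ioi (1:ℝ)).indicator (fun _ => (1:ℝ))) :=
    measurable_const.indicator measurableSet_Ioi
  -- the step kernel
  have hΦm : Measurable (fun p : ℝ × ℝ => (Ioi (1:ℝ)).indicator (fun _ => 1) (p.2 * |p.1|) * rho F p.2) :=
    (hmI.comp (by fun_prop)).mul (hmr.comp measurable_snd)
  have hΦnn : ∀ y θ : ℝ, 0 ≤ (Ioi (1:ℝ)).indicator (fun _ => (1:ℝ)) (θ * |y|) * rho F θ :=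
    fun y θ => mul_nonneg (indicator_nonneg (fun _ _ => zero_le_one) _) (rho_nonneg θ)
  have hΦ : Integrable (fun p : ℝ × ℝ => (Ioi (1:ℝ)).indicator (fun _ => 1) (p.2 * |p.1|) * rho F p.2)
      (F.prod ν) := by
    rw [integrable_prod_iff' hΦm.aestronglyMeasurable]
    constructor
    · refine ae_of_all _ fun θ => ?_
      refine (integrable_const (rho F θ)).mono' (Measurable.aestronglyMeasurable ?_)
        (ae_of_all _ fun y => ?_)
      · exact hΦm.comp (by fun_prop : Measurable fun y : ℝ => (y, θ))
      · rw [Real.norm_eq_abs, abs_of_nonneg (hΦnn y θ)]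
        exact mul_le_of_le_one_left (rho_nonneg θ) (indicator_le_self' (fun _ _ => zero_le_one) _)
    · refine (h2 x hx2).1.congr ((ae_restrict_mem measurableSet_Ioo).mono fun θ hθ => ?_)
      simp only [Real.norm_eq_abs, abs_of_nonneg (hΦnn _ _)]
      rw [integral_mul_const, integral_indicator_eq_H hθ.1]
  have hW : ∫ y, tailMass F x |y| ∂F = (m F x)⁻¹ := by
    rw [← (h2 x hx2).2]
    have := integral_integral_swap (f := fun y θ => (Ioi (1:ℝ)).indicator (fun _ => (1:ℝ)) (θ * |y|)
      * rho F θ) hΦ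
    unfold tailMass
    rw [this]
    refine setIntegral_congr_fun measurableSet_Ioo fun θ hθ => ?_
    rw [integral_mul_const, integral_indicator_eq_H hθ.1]
  have hWi : Integrable (fun y => tailMass F x |y|) F := hΦ.integral_prod_left
  -- the cosine kernel
  have hpsi : ∀ u, psi u + Real.pi / 2 * (Ioi (1:ℝ)).indicator (fun _ => 1) u = 1 - Real.cos u := by
    intro u
    unfold psi
    by_cases h : u ∈ Ioi (1:ℝ)
    · rw [indicator_of_mem h, indicator_of_mem h]; ring
    · rw [indicator_of_notMem h, indicator_of_notMem h]; ring
  have hcos : ∀ θ y : ℝ, (1 - Real.cos (θ * y)) * rho F θ = psi (θ * |y|) * rho F θ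
      + Real.pi / 2 * ((Ioi (1:ℝ)).indicator (fun _ => 1) (θ * |y|) * rho F θ) := by
    intro θ y
    have e : Real.cos (θ * y) = Real.cos (θ * |y|) := by
      rcases abs_choice y with h | h
      · rw [h]
      · rw [h, mul_neg, Real.cos_neg]
    rw [e, ← hpsi]; ring
  have hi1 : ∀ y : ℝ, Integrable (fun θ => psi (θ * |y|) * rho F θ) ν := fun y =>
    (h3 psi measurable_psi (fun u hu => (abs_psi_le hu).2) x hx3 _ (abs_nonneg y)).1
  have hi2 : ∀ y : ℝ, Integrable (fun θ => (Ioi (1:ℝ)).indicator (fun _ => 1) (θ * |y|) * rho F θ) ν :=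
    fun y => (h3 _ hmI (fun u hu => abs_indicator_Ioi_le hu) x hx3 _ (abs_nonneg y)).1
  have hV : ∀ y : ℝ, ∫ θ, (1 - Real.cos (θ * y)) * rho F θ ∂ν
      = (∫ θ, psi (θ * |y|) * rho F θ ∂ν) + Real.pi / 2 * tailMass F x |y| := by
    intro y
    simp_rw [hcos]
    rw [integral_add (hi1 y) ((hi2 y).const_mul _), integral_const_mul]; rfl
  have hPm : StronglyMeasurable (fun y => ∫ θ, psi (θ * |y|) * rho F θ ∂ν) := by
    refine StronglyMeasurable.integral_prod_right (f := fun y θ => psi (θ * |y|) * rho F θ) ?_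
    refine Measurable.stronglyMeasurable ?_
    exact (hmp.comp (by fun_prop)).mul (hmr.comp measurable_snd)
  have hbd : ∀ y : ℝ, |∫ θ, psi (θ * |y|) * rho F θ ∂ν| ≤ ε * tailMass F x |y|
      + C * (x / A F x ^ 2) * (min 1 (1 / x * |y|)) ^ (3 / 2 : ℝ) :=
    fun y => h1 x hx1 _ (abs_nonneg y)
  have hbdi : Integrable (fun y => ε * tailMass F x |y|
      + C * (x / A F x ^ 2) * (min 1 (1 / x * |y|)) ^ (3 / 2 : ℝ)) F :=
    (hWi.const_mul ε).add ((integrable_min_one_rpow F (by positivity)).const_mul _)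
  have hPi : Integrable (fun y => ∫ θ, psi (θ * |y|) * rho F θ ∂ν) F :=
    hbdi.mono' hPm.aestronglyMeasurable (ae_of_all _ hbd)
  have hΨ : Integrable (fun p : ℝ × ℝ => (1 - Real.cos (p.2 * p.1)) * rho F p.2) (F.prod ν) := by
    rw [integrable_prod_iff (Measurable.aestronglyMeasurable (by fun_prop))]
    constructor
    · refine ae_of_all _ fun y => ?_
      simp_rw [hcos]
      exact (hi1 y).add ((hi2 y).const_mul _)
    · have : ∀ y θ : ℝ, ‖(1 - Real.cos (θ * y)) * rho F θ‖ = (1 - Real.cos (θ * y)) * rho F θ :=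
        fun y θ => by
          rw [Real.norm_eq_abs, abs_of_nonneg]
          exact mul_nonneg (sub_nonneg.2 (Real.cos_le_one _)) (rho_nonneg θ)
      simp_rw [this, hV]
      exact hPi.add (hWi.const_mul _)
  have hre : ∀ θ : ℝ, (1 - charFun F θ).re * rho F θ = ∫ y, (1 - Real.cos (θ * y)) * rho F θ ∂F :=
    fun θ => by rw [integral_mul_const, one_sub_charFun_re]
  refine ⟨?_, ?_⟩
  · simp_rw [hre]
    exact hΨ.integral_prod_right
  · simp_rw [hre]
    rw [← integral_integral_swap (f := fun y θ => (1 - Real.cos (θ * y)) * rho F θ) hΨ]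
    simp_rw [hV]
    rw [integral_add hPi (hWi.const_mul _), integral_const_mul, hW, add_sub_cancel_right]
    refine abs_integral_le_integral_abs.trans ((integral_mono hPi.abs hbdi hbd).trans (le_of_eq ?_))
    rw [integral_add (hWi.const_mul ε) ((integrable_min_one_rpow F (by positivity)).const_mul _),
      integral_const_mul, integral_const_mul, hW]
    rfl

lemma eventually_m_pos (hinf : ¬ Integrable (fun x : ℝ => x) F) (ha : Ha F) (hb : Hb F) :
    ∀ᶠ x in atTop, 0 < m F x := by
  filter_upwards [eventually_inv_A_le hinf ha hb,
    (tendsto_A hinf ha hb).eventually_gt_atTop 0] with x h1 h2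
  exact inv_pos.1 ((inv_pos.2 h2).trans_le h1)

lemma tendsto_m_mul_integral_re_rho (hinf : ¬ Integrable (fun x : ℝ => x) F) (ha : Ha F) (hb : Hb F) :
    Tendsto (fun x => m F x * ∫ θ in Ioo 0 (1 / x), (1 - charFun F θ).re * rho F θ) atTop
      (𝓝 (Real.pi / 2)) := by
  have hA := tendsto_A hinf ha hb
  rw [Metric.tendsto_nhds]
  intro ε hε
  obtain ⟨C, x₀, h0, hC, h⟩ := integral_one_sub_re_mul_rho ha hb (show 0 < ε / 4 by positivity)
  filter_upwards [eventually_ge_atTop x₀, eventually_m_pos hinf ha hb, eventually_inv_A_le hinf ha hb,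
    hA.eventually_gt_atTop 0, eventually_trm_le ha hA (show 0 < ε / (4 * (C + 1)) by positivity)]
    with x hx hm hmA hAx ht
  have hx0 : 0 < x := h0.trans_le hx
  have h1 := (h x hx).2
  set I := ∫ θ in Ioo 0 (1 / x), (1 - charFun F θ).re * rho F θ
  have h2 : C * (x / A F x ^ 2) * trm F (1 / x) ≤ ε / 4 * (m F x)⁻¹ := by
    calc C * (x / A F x ^ 2) * trm F (1 / x) = C / A F x ^ 2 * (x * trm F (1 / x)) := by ring
      _ ≤ C / A F x ^ 2 * (ε / (4 * (C + 1)) * A F x) := by gcongr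
      _ = (C / (C + 1)) * (ε / 4) * (A F x)⁻¹ := by field_simp
      _ ≤ 1 * (ε / 4) * (m F x)⁻¹ := by
          gcongr
          rw [div_le_one (by positivity)]; linarith
      _ = _ := by ring
  rw [Real.dist_eq]
  have e : m F x * I - Real.pi / 2 = m F x * (I - Real.pi / 2 * (m F x)⁻¹) := by
    field_simp
  rw [e, abs_mul, abs_of_pos hm]
  calc m F x * |I - Real.pi / 2 * (m F x)⁻¹| ≤ m F x * (ε / 4 * (m F x)⁻¹ + ε / 4 * (m F x)⁻¹) := by
        gcongr; linarith
    _ = ε / 2 := by field_simp; ring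
    _ < ε := by linarith

/-- The Fourier transform of the Green measure. -/
noncomputable def grn (F : Measure ℝ) (θ : ℝ) : ℂ := (1 - charFun F θ)⁻¹

lemma measurable_grn : Measurable (grn F) :=
  (measurable_const.sub measurable_charFun).inv

lemma grn_re_nonneg (θ : ℝ) : 0 ≤ (grn F θ).re := by
  rw [grn, Complex.inv_re]
  exact div_nonneg (one_sub_charFun_re_nonneg F θ) (Complex.normSq_nonneg _)

lemma eventually_grn_re (ha : Ha F) (hA : Tendsto (A F) atTop atTop) {ε : ℝ} (hε : 0 < ε) :
    ∀ᶠ θ in 𝓝[>] (0:ℝ), |(grn F θ).re - (1 - charFun F θ).re * rho F θ| ≤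
      ε * ((1 - charFun F θ).re * rho F θ) := by
  have h := tendsto_mul_inv_one_sub_charFun ha hA
  have h2 : Tendsto (fun θ : ℝ => Complex.normSq (((θ * A F (1 / θ) : ℝ) : ℂ) * (1 - charFun F θ)⁻¹))
      (𝓝[>] 0) (𝓝 1) := by
    have := (Complex.continuous_normSq.tendsto Complex.I).comp h
    simpa [Function.comp_def] using this
  filter_upwards [(Metric.tendsto_nhds.1 h2) ε hε, eventually_pos_scaled hA] with θ h1 h3
  rw [Real.dist_eq, Complex.normSq_mul, Complex.normSq_ofReal, Complex.normSq_inv] at h1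
  set r := θ * A F (1 / θ)
  have e : (grn F θ).re - (1 - charFun F θ).re * rho F θ
      = (r * r * (Complex.normSq (1 - charFun F θ))⁻¹ - 1) * ((1 - charFun F θ).re * rho F θ) := by
    rw [grn, Complex.inv_re, show rho F θ = (r ^ 2)⁻¹ from rfl]
    field_simp
  have h0 : 0 ≤ (1 - charFun F θ).re * rho F θ :=
    mul_nonneg (one_sub_charFun_re_nonneg F θ) (rho_nonneg θ)
  rw [e, abs_mul, abs_of_nonneg h0]
  gcongr

lemma exists_integrableOn_grn_re (hinf : ¬ Integrable (fun x : ℝ => x) F) (ha : Ha F) (hb : Hb F) :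
    ∃ x₀ : ℝ, 0 < x₀ ∧ ∀ x, x₀ ≤ x → IntegrableOn (fun θ => (grn F θ).re) (Ioo 0 (1 / x)) := by
  have hA := tendsto_A hinf ha hb
  obtain ⟨C, x₁, h10, -, h⟩ := integral_one_sub_re_mul_rho ha hb one_pos
  obtain ⟨u, hu, hu2⟩ := mem_nhdsGT_iff_exists_Ioo_subset.1 (eventually_grn_re ha hA one_pos)
  have hu : 0 < u := hu
  refine ⟨max x₁ (1 / u), by positivity, fun x hx => ?_⟩
  have hx0 : 0 < x := h10.trans_le ((le_max_left _ _).trans hx)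
  have hxu : 1 / x ≤ u := by
    rw [one_div_le hx0 hu]; exact (le_max_right _ _).trans hx
  refine (((h x ((le_max_left _ _).trans hx)).1).const_mul 2).mono'
    (Complex.measurable_re.comp measurable_grn).aestronglyMeasurable
    ((ae_restrict_mem measurableSet_Ioo).mono fun θ hθ => ?_)
  have h1 := hu2 ⟨hθ.1, hθ.2.trans_le hxu⟩
  simp only [mem_ofPred_eq] at h1
  rw [Real.norm_eq_abs, abs_of_nonneg (grn_re_nonneg θ)]
  have := (abs_le.1 h1).2
  linarith

lemma tendsto_m_mul_integral_grn_re (hinf : ¬ Integrable (fun x : ℝ => x) F) (ha : Ha F) (hb : Hb F) :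
    Tendsto (fun x => m F x * ∫ θ in Ioo 0 (1 / x), (grn F θ).re) atTop (𝓝 (Real.pi / 2)) := by
  have hA := tendsto_A hinf ha hb
  have hlim := tendsto_m_mul_integral_re_rho hinf ha hb
  have hdiff : Tendsto (fun x => m F x * (∫ θ in Ioo 0 (1 / x), (grn F θ).re)
      - m F x * ∫ θ in Ioo 0 (1 / x), (1 - charFun F θ).re * rho F θ) atTop (𝓝 0) := by
    rw [Metric.tendsto_nhds]
    intro ε hε
    obtain ⟨x₁, h10, h1⟩ := exists_integrableOn_grn_re hinf ha hb
    obtain ⟨C, x₂, h20, -, h2⟩ := integral_one_sub_re_mul_rho ha hb one_pos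
    have hpi := Real.pi_pos
    obtain ⟨u, hu, hu2⟩ := mem_nhdsGT_iff_exists_Ioo_subset.1
      (eventually_grn_re ha hA (show 0 < ε / (2 * Real.pi) by positivity))
    have hu : 0 < u := hu
    filter_upwards [eventually_ge_atTop x₁, eventually_ge_atTop x₂, eventually_ge_atTop (1 / u),
      eventually_m_pos hinf ha hb, hlim.eventually_lt_const (show Real.pi / 2 < Real.pi by linarith)]
      with x hx1 hx2 hxu hm hlt
    have hx0 : 0 < x := h10.trans_le hx1
    have hxu : 1 / x ≤ u := by rw [one_div_le hx0 hu]; exact hxu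
    have hi1 := h1 x hx1
    have hi2 := (h2 x hx2).1
    rw [dist_zero_right, Real.norm_eq_abs, ← mul_sub, abs_mul, abs_of_pos hm, ← integral_sub hi1 hi2]
    have hb : |∫ θ in Ioo 0 (1 / x), ((grn F θ).re - (1 - charFun F θ).re * rho F θ)|
        ≤ ε / (2 * Real.pi) * ∫ θ in Ioo 0 (1 / x), (1 - charFun F θ).re * rho F θ := by
      refine abs_integral_le_integral_abs.trans ?_
      rw [← integral_const_mul]
      exact setIntegral_mono_on (hi1.sub hi2).abs (hi2.const_mul _) measurableSet_Ioo fun θ hθ =>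
        hu2 ⟨hθ.1, hθ.2.trans_le hxu⟩
    calc _ ≤ m F x * (ε / (2 * Real.pi) * ∫ θ in Ioo 0 (1 / x), (1 - charFun F θ).re * rho F θ) := by
          gcongr
      _ = ε / (2 * Real.pi) * (m F x * ∫ θ in Ioo 0 (1 / x), (1 - charFun F θ).re * rho F θ) := by ring
      _ ≤ ε / (2 * Real.pi) * Real.pi := by gcongr
      _ = ε / 2 := by field_simp
      _ < ε := by linarith
  have := hdiff.add hlim
  simpa using this

end Renewal

namespace Renewal

variable {F : Measure ℝ} [IsProbabilityMeasure F]

lemma exists_norm_grn_le_near_zero (ha : Ha F) (hA : Tendsto (A F) atTop atTop) :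
    ∃ θ₀ : ℝ, 0 < θ₀ ∧ ∀ θ ∈ Ioo 0 θ₀, 0 < A F (1 / θ) ∧ ‖grn F θ‖ ≤ 2 / (θ * A F (1 / θ)) := by
  have h1 := (tendsto_mul_inv_one_sub_charFun ha hA).norm
  rw [Complex.norm_I] at h1
  obtain ⟨u, hu, hu2⟩ := mem_nhdsGT_iff_exists_Ioo_subset.1
    ((h1.eventually_lt_const (show (1:ℝ) < 2 by norm_num)).and (eventually_pos_scaled hA))
  refine ⟨u, hu, fun θ hθ => ?_⟩
  obtain ⟨h2, h3⟩ := hu2 hθ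
  refine ⟨pos_of_mul_pos_right h3 hθ.1.le, ?_⟩
  rw [norm_mul, Complex.norm_real, Real.norm_eq_abs, abs_of_pos h3] at h2
  rw [le_div_iff₀ h3, mul_comm]
  exact h2.le

lemma continuousOn_grn {s : Set ℝ} (hs : ∀ θ ∈ s, charFun F θ ≠ 1) : ContinuousOn (grn F) s :=
  ContinuousOn.inv₀ (by have := continuous_charFun (μ := F); fun_prop)
    fun θ hθ h => hs θ hθ (sub_eq_zero.1 h).symm

lemma exists_norm_grn_le (ha : Ha F) (hA : Tendsto (A F) atTop atTop) {N : ℝ} (hN0 : 0 < N)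
    (hN : ∀ θ ∈ Ioc 0 N, charFun F θ ≠ 1) :
    ∃ C X : ℝ, 0 < C ∧ 0 < X ∧ ∀ x, X ≤ x → 0 < A F x ∧ ∀ θ, 1 / x ≤ θ → θ ≤ N →
      ‖grn F θ‖ ≤ C * (x * θ) ^ (1 / 8 : ℝ) / (θ * A F x) := by
  obtain ⟨θ₀, hθ0, h1⟩ := exists_norm_grn_le_near_zero ha hA
  obtain ⟨x₁, h10, hp, hP⟩ := ha.slowVar (1 / 8) (by norm_num)
  set d := min (θ₀ / 2) (1 / x₁) with hd
  have hd0 : 0 < d := by positivity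
  obtain ⟨C₁, hC₁⟩ := (isCompact_Icc (a := d) (b := N)).exists_bound_of_continuousOn
    (continuousOn_grn (F := F) (s := Icc d N) fun θ hθ => hN θ ⟨hd0.trans_le hθ.1, hθ.2⟩)
  set c := d ^ (1 / 8 : ℝ) * x₁ ^ (1 / 8 : ℝ) / (N * A F x₁) with hc
  have hA1 := hp x₁ le_rfl
  have hc0 : 0 < c := by positivity
  refine ⟨2 + |C₁| / c, x₁, by positivity, h10, fun x hx => ⟨hp x hx, fun θ hθ1 hθ2 => ?_⟩⟩
  have hx0 : 0 < x := h10.trans_le hx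
  have hθ : 0 < θ := (by positivity : 0 < 1 / x).trans_le hθ1
  have hAx := hp x hx
  have hnn : 0 ≤ (x * θ) ^ (1 / 8 : ℝ) / (θ * A F x) := by positivity
  rw [mul_div_assoc]
  by_cases h : θ < d
  · have hθ2 : θ < θ₀ := by
      have := min_le_left (θ₀ / 2) (1 / x₁); linarith
    have hx1 : x₁ ≤ 1 / θ := by
      rw [le_one_div h10 hθ]; exact h.le.trans (min_le_right _ _)
    have hxθ : 1 / θ ≤ x := by rw [one_div_le hθ hx0]; exact hθ1
    obtain ⟨h2, h3⟩ := h1 θ ⟨hθ, hθ2⟩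
    have h4 := (hP (1 / θ) x hx1 hxθ).1
    have e : x / (1 / θ) = x * θ := by field_simp
    rw [e] at h4
    refine h3.trans ?_
    calc 2 / (θ * A F (1 / θ)) ≤ 2 * ((x * θ) ^ (1 / 8 : ℝ) / (θ * A F x)) := by
          rw [mul_div_assoc', div_le_div_iff₀ (by positivity) (by positivity)]
          have := mul_le_mul_of_nonneg_left h4 (by positivity : 0 ≤ 2 * θ)
          linarith
      _ ≤ _ := by
          gcongr
          exact le_add_of_nonneg_right (by positivity)
  · push Not at h
    have h2 := hC₁ θ ⟨h, hθ2⟩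
    have h4 := (hP x₁ x le_rfl hx).1
    have h5 : c ≤ (x * θ) ^ (1 / 8 : ℝ) / (θ * A F x) := by
      rw [hc, div_le_div_iff₀ (by positivity) (by positivity), Real.mul_rpow hx0.le hθ.le]
      rw [Real.div_rpow hx0.le h10.le, mul_div_assoc', le_div_iff₀ (by positivity)] at h4
      have h6 : d ^ (1 / 8 : ℝ) ≤ θ ^ (1 / 8 : ℝ) := Real.rpow_le_rpow hd0.le h (by norm_num)
      calc d ^ (1 / 8 : ℝ) * x₁ ^ (1 / 8 : ℝ) * (θ * A F x)
          = d ^ (1 / 8 : ℝ) * θ * (A F x * x₁ ^ (1 / 8 : ℝ)) := by ring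
        _ ≤ θ ^ (1 / 8 : ℝ) * N * (A F x₁ * x ^ (1 / 8 : ℝ)) := by gcongr
        _ = _ := by ring
    calc ‖grn F θ‖ ≤ |C₁| := h2.trans (le_abs_self _)
      _ = |C₁| / c * c := by field_simp
      _ ≤ |C₁| / c * ((x * θ) ^ (1 / 8 : ℝ) / (θ * A F x)) := by gcongr
      _ ≤ _ := by
          gcongr
          linarith

lemma exists_norm_charFun_shift_le (ha : Ha F) (hA : Tendsto (A F) atTop atTop) :
    ∃ X : ℝ, 0 < X ∧ ∀ x, X ≤ x → ∀ θ, Real.pi / x ≤ θ →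
      ‖charFun F (θ + Real.pi / x) - charFun F θ‖ ≤ 48 * A F x * √(x * θ) / x := by
  have hpi := Real.pi_pos
  obtain ⟨x₁, h10, hp, hP⟩ := ha.slowVar (1 / 8) (by norm_num)
  have h1 := (tendsto_one_sub_charFun_div ha hA).norm
  rw [norm_neg, Complex.norm_I] at h1
  obtain ⟨u, hu, hu2⟩ := mem_nhdsGT_iff_exists_Ioo_subset.1
    ((h1.eventually_lt_const (show (1:ℝ) < 2 by norm_num)).and ((eventually_pos_scaled hA).and
      (eventually_trm_le' ha hA one_pos)))
  have hu : 0 < u := hu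
  refine ⟨max (2 * Real.pi / u) (Real.pi * x₁), by positivity, fun x hx θ hθ => ?_⟩
  have hx0 : 0 < x := lt_of_lt_of_le (by positivity) hx
  set h := Real.pi / x with hh
  have hh0 : 0 < h := by positivity
  have hhu : h < u := by
    have := (le_max_left _ _).trans hx
    rw [div_le_iff₀ hu] at this
    rw [hh, div_lt_iff₀ hx0]; linarith
  obtain ⟨h2, h3, h4⟩ := hu2 ⟨hh0, hhu⟩
  rw [norm_div, Complex.norm_real, Real.norm_eq_abs, abs_of_pos h3, div_lt_iff₀ h3] at h2
  have h5 := norm_charFun_sub_le (F := F) hh0 hθ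
  have hθ0 : 0 < θ := hh0.trans_le hθ
  have hq : 1 ≤ √(θ / h) := by rw [Real.one_le_sqrt, one_le_div hh0]; exact hθ
  have h6 : ‖charFun F (θ + h) - charFun F θ‖ ≤ 6 * √(θ / h) * (h * A F (1 / h)) := by
    refine h5.trans ?_
    have a1 : 4 * √(θ / h) * trm F h ≤ 4 * √(θ / h) * (1 * (h * A F (1 / h))) := by gcongr
    have a2 : h * A F (1 / h) ≤ √(θ / h) * (h * A F (1 / h)) := le_mul_of_one_le_left h3.le hq
    linarith
  have hxx : x₁ ≤ x / Real.pi := by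
    rw [le_div_iff₀ hpi, mul_comm]; exact (le_max_right _ _).trans hx
  have h1x : x / Real.pi ≤ x := div_le_self hx0.le (by linarith [Real.pi_gt_three])
  have h7 := (hP (x / Real.pi) x hxx h1x).2
  have e1 : 1 / h = x / Real.pi := by rw [hh]; field_simp
  have e2 : x / (x / Real.pi) = Real.pi := by field_simp
  have hAx := hp x (hxx.trans h1x)
  have hAp := hp _ hxx
  have h8 : Real.pi ^ (1 / 8 : ℝ) ≤ 2 := by
    have : (2:ℝ) = (2 ^ (8:ℝ)) ^ (1 / 8 : ℝ) := by
      rw [← Real.rpow_mul (by norm_num)]; norm_num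
    rw [this]
    refine Real.rpow_le_rpow hpi.le ?_ (by norm_num)
    have := Real.pi_le_four
    norm_num; linarith
  rw [e2] at h7
  rw [e1] at h6
  have e3 : √(θ / h) ≤ √(x * θ) := by
    refine Real.sqrt_le_sqrt ?_
    rw [hh, div_div_eq_mul_div, mul_comm]
    exact div_le_self (by positivity) (by linarith [Real.pi_gt_three])
  refine h6.trans ?_
  calc 6 * √(θ / h) * (h * A F (x / Real.pi)) ≤ 6 * √(x * θ) * (h * (A F x * 2)) := by
        have : A F (x / Real.pi) ≤ A F x * 2 := h7.trans (by gcongr)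
        gcongr
    _ = 12 * Real.pi * A F x * √(x * θ) / x := by rw [hh]; ring
    _ ≤ 48 * A F x * √(x * θ) / x := by
        gcongr
        linarith [Real.pi_le_four]

section highFrequency

variable {a l : ℝ}

lemma intervalIntegrable_wt_mul_grn (ha0 : 0 < a) (hN : ∀ θ ∈ Ioc 0 (a + |l|), charFun F θ ≠ 1)
    {b c : ℝ} (hb : 0 < b) (hc : 0 < c) :
    IntervalIntegrable (fun θ => (wt a l θ : ℂ) * grn F θ) volume b c := by
  have hN0 : 0 < a + |l| := by positivity
  have hcw : Continuous fun θ => (wt a l θ : ℂ) := Complex.continuous_ofReal.comp (continuous_wt a l)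
  have key : ∀ b, 0 < b →
      IntervalIntegrable (fun θ => (wt a l θ : ℂ) * grn F θ) volume b (a + |l|) := by
    intro b hb
    rcases le_total b (a + |l|) with h | h
    · refine ContinuousOn.intervalIntegrable ?_
      rw [uIcc_of_le h]
      exact hcw.continuousOn.mul (continuousOn_grn fun θ hθ => hN θ ⟨hb.trans_le hθ.1, hθ.2⟩)
    · refine IntervalIntegrable.symm ?_
      refine (intervalIntegrable_const (c := (0:ℂ))).congr ?_
      intro θ hθ
      rw [uIoc_of_le h] at hθ
      simp [wt_eq_zero ha0 hθ.1.le]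
  exact (key b hb).trans (key c hc).symm

lemma exists_norm_wt_mul_grn_sub_le (ha : Ha F) (hA : Tendsto (A F) atTop atTop) (ha0 : 0 < a)
    (hN : ∀ θ ∈ Ioc 0 (a + |l|), charFun F θ ≠ 1) :
    ∃ C X : ℝ, 0 < C ∧ 1 ≤ X ∧ ∀ x, X ≤ x → 0 < A F x ∧ ∀ θ, Real.pi / x ≤ θ → θ ≤ a + |l| →
      ‖(wt a l θ : ℂ) * grn F θ - wt a l (θ + Real.pi / x) * grn F (θ + Real.pi / x)‖ ≤
          C / A F x * (x * (x * θ) ^ (-(5 / 4) : ℝ)) ∧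
      ‖(wt a l θ : ℂ) * grn F θ‖ ≤ C / A F x * (x * (x * θ) ^ (-(1 / 4) : ℝ)) := by
  have hpi := Real.pi_pos
  have hpi3 := Real.pi_gt_three
  have hN0 : 0 < a + |l| := by positivity
  obtain ⟨C, X₁, hC, hX1, h1⟩ := exists_norm_grn_le ha hA hN0 hN
  obtain ⟨X₂, hX2, h2⟩ := exists_norm_charFun_shift_le ha hA
  set N := a + |l| with hNdef
  set C₁ := 2 / a * Real.pi * C * N ^ (3 / 8 : ℝ) with hC1
  refine ⟨C₁ + 192 * C ^ 2 + 2 * C, max 1 (max X₁ X₂), by positivity, le_max_left _ _, fun x hx => ?_⟩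
  have hx1 : 1 ≤ x := (le_max_left _ _).trans hx
  have hx2 : X₁ ≤ x := ((le_max_left _ _).trans (le_max_right _ _)).trans hx
  have hx3 : X₂ ≤ x := ((le_max_right _ _).trans (le_max_right _ _)).trans hx
  have hx0 : 0 < x := by linarith
  obtain ⟨hAx, hg⟩ := h1 x hx2
  refine ⟨hAx, fun θ hθ hθN => ?_⟩
  set h := Real.pi / x with hh
  have hh0 : 0 < h := by positivity
  have hθ0 : 0 < θ := hh0.trans_le hθ
  have hθx : 1 / x ≤ θ := le_trans (by rw [hh]; gcongr; linarith) hθ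
  set u := x * θ with hu
  have hu0 : 0 < u := by positivity
  have hu1 : 1 ≤ u := by rw [div_le_iff₀ hx0] at hθx; rw [hu]; linarith
  have hθu : θ = u / x := by rw [hu]; field_simp
  have hgθ := hg θ hθx hθN
  have hgθ' : ‖grn F θ‖ ≤ C / A F x * (x * u ^ (-(7 / 8) : ℝ)) := by
    refine hgθ.trans (le_of_eq ?_)
    have : u ^ (-(7 / 8) : ℝ) = u ^ (1 / 8 : ℝ) / u := by
      rw [← Real.rpow_sub_one hu0.ne']; norm_num
    rw [this, hu]; field_simp
  constructor
  · have hsplit : (wt a l θ : ℂ) * grn F θ - wt a l (θ + h) * grn F (θ + h)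
        = ((wt a l θ - wt a l (θ + h) : ℝ) : ℂ) * grn F θ
          + wt a l (θ + h) * (grn F θ - grn F (θ + h)) := by push_cast; ring
    rw [hsplit]
    refine (norm_add_le _ _).trans ?_
    have b1 : ‖((wt a l θ - wt a l (θ + h) : ℝ) : ℂ) * grn F θ‖
        ≤ C₁ / A F x * (x * u ^ (-(5 / 4) : ℝ)) := by
      rw [norm_mul, Complex.norm_real, Real.norm_eq_abs]
      have hl := wt_lipschitz ha0 l θ (θ + h)
      have e0 : |θ - (θ + h)| = h := by
        rw [sub_add_cancel_left, abs_neg, abs_of_pos hh0]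
      rw [e0] at hl
      have e1 : u ^ (-(7 / 8) : ℝ) = u ^ (3 / 8 : ℝ) * u ^ (-(5 / 4) : ℝ) := by
        rw [← Real.rpow_add hu0]; norm_num
      have e2 : u ^ (3 / 8 : ℝ) ≤ N ^ (3 / 8 : ℝ) * x := by
        have a1 : u ^ (3 / 8 : ℝ) ≤ (N * x) ^ (3 / 8 : ℝ) := by
          refine Real.rpow_le_rpow hu0.le ?_ (by norm_num)
          rw [hu]; nlinarith
        rw [Real.mul_rpow hN0.le hx0.le] at a1
        have a2 : x ^ (3 / 8 : ℝ) ≤ x := by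
          conv_rhs => rw [← Real.rpow_one x]
          exact Real.rpow_le_rpow_of_exponent_le hx1 (by norm_num)
        exact a1.trans (by gcongr)
      calc |wt a l θ - wt a l (θ + h)| * ‖grn F θ‖
          ≤ (2 / a * h) * (C / A F x * (x * (N ^ (3 / 8 : ℝ) * x * u ^ (-(5 / 4) : ℝ)))) := by
            have hp := Real.rpow_pos_of_pos hu0 (-(5 / 4))
            refine mul_le_mul hl (hgθ'.trans ?_) (norm_nonneg _) (by positivity)
            rw [e1]; gcongr
        _ = C₁ / A F x * (x * u ^ (-(5 / 4) : ℝ)) := by rw [hC1, hh]; field_simp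
    have b2 : ‖(wt a l (θ + h) : ℂ) * (grn F θ - grn F (θ + h))‖
        ≤ 192 * C ^ 2 / A F x * (x * u ^ (-(5 / 4) : ℝ)) := by
      have hup := Real.rpow_pos_of_pos hu0 (-(5 / 4))
      rcases le_or_gt N (θ + h) with hc | hc
      · rw [wt_eq_zero ha0 hc]; simp; positivity
      · have hgh := hg (θ + h) (hθx.trans (by linarith)) hc.le
        have n1 : (1 - charFun F θ) ≠ 0 := sub_ne_zero.2 (hN θ ⟨hθ0, hθN⟩).symm
        have n2 : (1 - charFun F (θ + h)) ≠ 0 :=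
          sub_ne_zero.2 (hN (θ + h) ⟨by linarith, hc.le⟩).symm
        have e1 : grn F θ - grn F (θ + h)
            = grn F θ * grn F (θ + h) * (charFun F θ - charFun F (θ + h)) := by
          unfold grn; field_simp; ring
        have hsh := h2 x hx3 θ hθ
        have hw : ‖(wt a l (θ + h) : ℂ)‖ ≤ 2 := by
          rw [Complex.norm_real, Real.norm_eq_abs, abs_of_nonneg (wt_nonneg _ _ _)]
          exact wt_le_two ha0 _ _
        have e2 : (x * (θ + h)) ^ (1 / 8 : ℝ) ≤ 2 * u ^ (1 / 8 : ℝ) := by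
          have a1 : (x * (θ + h)) ^ (1 / 8 : ℝ) ≤ (2 * u) ^ (1 / 8 : ℝ) := by
            refine Real.rpow_le_rpow (by positivity) ?_ (by norm_num)
            rw [hu]; nlinarith
          rw [Real.mul_rpow (by norm_num) hu0.le] at a1
          have a2 : (2:ℝ) ^ (1 / 8 : ℝ) ≤ 2 := by
            conv_rhs => rw [← Real.rpow_one 2]
            exact Real.rpow_le_rpow_of_exponent_le (by norm_num) (by norm_num)
          exact a1.trans (by gcongr)
        have hgh' : ‖grn F (θ + h)‖ ≤ C * (2 * u ^ (1 / 8 : ℝ)) / (θ * A F x) := by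
          refine hgh.trans ?_
          gcongr
          linarith
        rw [norm_mul, e1, norm_mul, norm_mul, norm_sub_rev (charFun F θ)]
        have e3 : u ^ (-(5 / 4) : ℝ) = u ^ (1 / 8 : ℝ) * u ^ (1 / 8 : ℝ) * √u / u ^ 2 := by
          rw [Real.sqrt_eq_rpow, ← Real.rpow_natCast, ← Real.rpow_add hu0, ← Real.rpow_add hu0,
            ← Real.rpow_sub hu0]; norm_num
        calc _ ≤ 2 * (C * u ^ (1 / 8 : ℝ) / (θ * A F x) * (C * (2 * u ^ (1 / 8 : ℝ)) / (θ * A F x))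
              * (48 * A F x * √u / x)) := by gcongr
          _ = 192 * C ^ 2 / A F x * (x * u ^ (-(5 / 4) : ℝ)) := by
              rw [e3, hθu]; field_simp; ring
    have hup := Real.rpow_pos_of_pos hu0 (-(5 / 4))
    calc _ ≤ C₁ / A F x * (x * u ^ (-(5 / 4) : ℝ)) + 192 * C ^ 2 / A F x * (x * u ^ (-(5 / 4) : ℝ)) :=
          add_le_add b1 b2
      _ = (C₁ + 192 * C ^ 2) / A F x * (x * u ^ (-(5 / 4) : ℝ)) := by ring
      _ ≤ _ := mul_le_mul_of_nonneg_right
          (div_le_div_of_nonneg_right (by linarith) hAx.le) (by positivity)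
  · have hw : ‖(wt a l θ : ℂ)‖ ≤ 2 := by
      rw [Complex.norm_real, Real.norm_eq_abs, abs_of_nonneg (wt_nonneg _ _ _)]
      exact wt_le_two ha0 _ _
    rw [norm_mul]
    have hup := Real.rpow_pos_of_pos hu0 (-(1 / 4))
    have e1 : u ^ (-(7 / 8) : ℝ) ≤ u ^ (-(1 / 4) : ℝ) :=
      Real.rpow_le_rpow_of_exponent_le hu1 (by norm_num)
    calc _ ≤ 2 * (C / A F x * (x * u ^ (-(1 / 4) : ℝ))) := by
          refine mul_le_mul hw (hgθ'.trans ?_) (norm_nonneg _) (by norm_num)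
          gcongr
      _ = (2 * C) / A F x * (x * u ^ (-(1 / 4) : ℝ)) := by ring
      _ ≤ _ := by
          gcongr
          have : 0 < C₁ := by positivity
          nlinarith [sq_nonneg C]

/-- The contribution of the frequencies above `b ≫ 1 / x`. -/
lemma exists_norm_integral_high_le (ha : Ha F) (hA : Tendsto (A F) atTop atTop) (ha0 : 0 < a)
    (hN : ∀ θ ∈ Ioc 0 (a + |l|), charFun F θ ≠ 1) {s : ℝ} (hs : s = 1 ∨ s = -1) :
    ∃ C X : ℝ, 0 < C ∧ 0 < X ∧ ∀ x, X ≤ x → ∀ b, Real.pi / x ≤ b → b ≤ a + |l| →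
      ‖∫ θ in b..(a + |l|), (wt a l θ : ℂ) * grn F θ * Complex.exp ((-s * x * θ : ℝ) * Complex.I)‖ ≤
        C * (x * b) ^ (-(1 / 4) : ℝ) / A F x := by
  have hpi := Real.pi_pos
  obtain ⟨C, X, hC, hX, h1⟩ := exists_norm_wt_mul_grn_sub_le ha hA ha0 hN
  set N := a + |l| with hNdef
  have hN0 : 0 < N := by positivity
  refine ⟨C * (Real.pi + 4), X, by positivity, by linarith, fun x hx b hb hbN => ?_⟩
  have hx0 : 0 < x := by linarith
  obtain ⟨hAx, h2⟩ := h1 x hx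
  set h := Real.pi / x with hh
  have hh0 : 0 < h := by positivity
  have hb0 : 0 < b := hh0.trans_le hb
  set f : ℝ → ℂ := fun θ => (wt a l θ : ℂ) * grn F θ with hf
  set E : ℝ → ℂ := fun θ => Complex.exp ((-s * x * θ : ℝ) * Complex.I) with hE
  have hEn : ∀ θ, ‖E θ‖ = 1 := fun θ => Complex.norm_exp_ofReal_mul_I _
  have hEc : Continuous E := by rw [hE]; fun_prop
  have hEh : ∀ θ, E (θ + h) = -E θ := by
    intro θ
    have e : -s * x * (θ + h) = -s * x * θ - s * Real.pi := by rw [hh]; field_simp; ring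
    have hE1 : Complex.exp ((s * Real.pi : ℝ) * Complex.I) = -1 := by
      rcases hs with rfl | rfl
      · rw [one_mul, Complex.exp_pi_mul_I]
      · rw [neg_one_mul, Complex.ofReal_neg, neg_mul, Complex.exp_neg, Complex.exp_pi_mul_I]
        norm_num
    simp only [hE]
    rw [e, Complex.ofReal_sub, sub_mul, Complex.exp_sub, hE1, div_neg, div_one]
  have hfi : ∀ b c, 0 < b → 0 < c → IntervalIntegrable f volume b c := fun b c hb hc =>
    intervalIntegrable_wt_mul_grn ha0 hN hb hc
  have hfEi : ∀ b c, 0 < b → 0 < c → IntervalIntegrable (fun θ => f θ * E θ) volume b c :=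
    fun b c hb hc => (hfi b c hb hc).mul_continuousOn hEc.continuousOn
  have hf0 : ∀ θ, N ≤ θ → f θ = 0 := fun θ hθ => by simp [hf, wt_eq_zero ha0 hθ]
  have hshi : IntervalIntegrable (fun θ => f (θ + h)) volume b N := by
    have := (hfi (b + h) (N + h) (by linarith) (by linarith)).comp_add_right h
    simpa using this
  have hshift : ∫ θ in b..N, f (θ + h) * E θ = -∫ θ in (b + h)..N, f θ * E θ := by
    have e1 : ∀ θ, f (θ + h) * E θ = -(f (θ + h) * E (θ + h)) := fun θ => by rw [hEh]; ring
    simp_rw [e1]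
    rw [intervalIntegral.integral_neg, intervalIntegral.integral_comp_add_right (fun θ => f θ * E θ)]
    congr 1
    rw [← intervalIntegral.integral_add_adjacent_intervals (hfEi (b + h) N (by linarith) hN0)
      (hfEi N (N + h) hN0 (by linarith))]
    have : ∫ θ in N..(N + h), f θ * E θ = 0 := by
      refine (intervalIntegral.integral_congr (g := fun _ => 0) fun θ hθ => ?_).trans (by simp)
      rw [uIcc_of_le (by linarith)] at hθ
      simp [hf0 θ hθ.1]
    rw [this, add_zero]
  have hid : 2 * ∫ θ in b..N, f θ * E θ
      = (∫ θ in b..(b + h), f θ * E θ) + ∫ θ in b..N, (f θ - f (θ + h)) * E θ := by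
    have e1 : ∀ θ, (f θ - f (θ + h)) * E θ = f θ * E θ - f (θ + h) * E θ := fun θ => sub_mul _ _ _
    simp_rw [e1]
    rw [intervalIntegral.integral_sub (hfEi b N hb0 hN0) (hshi.mul_continuousOn hEc.continuousOn), hshift,
      ← intervalIntegral.integral_add_adjacent_intervals (hfEi b (b + h) hb0 (by linarith))
        (hfEi (b + h) N (by linarith) hN0)]
    ring
  have hxb : 0 < x * b := by positivity
  have hP := Real.rpow_pos_of_pos hxb (-(1 / 4))
  have hB1 : ‖∫ θ in b..(b + h), f θ * E θ‖ ≤ C * Real.pi * (x * b) ^ (-(1 / 4) : ℝ) / A F x := by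
    have := intervalIntegral.norm_integral_le_of_norm_le_const (a := b) (b := b + h)
      (C := C / A F x * (x * (x * b) ^ (-(1 / 4) : ℝ))) (f := fun θ => f θ * E θ) fun θ hθ => ?_
    · refine this.trans (le_of_eq ?_)
      rw [add_sub_cancel_left, abs_of_pos hh0, hh]; field_simp
    · rw [uIoc_of_le (by linarith)] at hθ
      rw [norm_mul, hEn, mul_one]
      rcases le_total N θ with hc | hc
      · rw [hf0 θ hc, norm_zero]; positivity
      · refine (h2 θ (hb.trans hθ.1.le) hc).2.trans ?_
        have : (x * θ) ^ (-(1 / 4) : ℝ) ≤ (x * b) ^ (-(1 / 4) : ℝ) :=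
          Real.rpow_le_rpow_of_nonpos hxb (by gcongr; exact hθ.1.le) (by norm_num)
        gcongr
  have hB2 : ‖∫ θ in b..N, (f θ - f (θ + h)) * E θ‖ ≤ C * 4 * (x * b) ^ (-(1 / 4) : ℝ) / A F x := by
    have hnot : (0:ℝ) ∉ uIcc b N := by rw [uIcc_of_le hbN]; exact fun h => absurd h.1 (by linarith)
    have hgi : IntervalIntegrable (fun θ => C / A F x * x ^ (-(1 / 4) : ℝ) * θ ^ (-(5 / 4) : ℝ)) volume b N :=
      (intervalIntegral.intervalIntegrable_rpow (Or.inr hnot)).const_mul _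
    calc _ ≤ ∫ θ in b..N, C / A F x * x ^ (-(1 / 4) : ℝ) * θ ^ (-(5 / 4) : ℝ) := by
          refine intervalIntegral.norm_integral_le_of_norm_le hbN (ae_of_all _ fun θ hθ => ?_) hgi
          have hθ0 : 0 < θ := hb0.trans hθ.1
          rw [norm_mul, hEn, mul_one]
          refine (h2 θ (hb.trans hθ.1.le) hθ.2).1.trans (le_of_eq ?_)
          rw [Real.mul_rpow hx0.le hθ0.le]
          have : x ^ (-(1 / 4) : ℝ) = x * x ^ (-(5 / 4) : ℝ) := by
            rw [← Real.rpow_one_add' hx0.le (by norm_num)]; norm_num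
          rw [this]; ring
      _ = C / A F x * x ^ (-(1 / 4) : ℝ) * (4 * (b ^ (-(1 / 4) : ℝ) - N ^ (-(1 / 4) : ℝ))) := by
          rw [intervalIntegral.integral_const_mul, integral_rpow (Or.inr ⟨by norm_num, hnot⟩)]
          have : (-(5 / 4) + 1 : ℝ) = -(1 / 4) := by norm_num
          rw [this]; ring
      _ ≤ C / A F x * x ^ (-(1 / 4) : ℝ) * (4 * b ^ (-(1 / 4) : ℝ)) := by
          gcongr
          have := Real.rpow_nonneg hN0.le (-(1 / 4))
          linarith
      _ = _ := by rw [Real.mul_rpow hx0.le hb0.le]; ring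
  have h3 : 2 * ‖∫ θ in b..N, f θ * E θ‖ ≤ C * (Real.pi + 4) * (x * b) ^ (-(1 / 4) : ℝ) / A F x := by
    have e : ‖2 * ∫ θ in b..N, f θ * E θ‖ = 2 * ‖∫ θ in b..N, f θ * E θ‖ := by
      rw [norm_mul]; simp
    rw [← e, hid]
    refine (norm_add_le _ _).trans ((add_le_add hB1 hB2).trans (le_of_eq ?_))
    ring
  linarith [norm_nonneg (∫ θ in b..N, f θ * E θ)]

end highFrequency

end Renewal

namespace Renewal

variable {F : Measure ℝ} [IsProbabilityMeasure F]

/-- The contribution of the frequencies of order `1 / x`. -/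
lemma tendsto_A_mul_integral_low (ha : Ha F) (hA : Tendsto (A F) atTop atTop) {B C γ : ℝ}
    (hB : 0 < B) (hC : 0 ≤ C) {p : ℝ → ℝ → ℝ} {p₀ g : ℝ → ℝ} (hpm : ∀ x, Measurable (p x))
    (hp : ∀ᶠ x in atTop, ∀ u ∈ Ioc 0 B, |p x u| ≤ C * u)
    (hlim : ∀ u ∈ Ioc 0 B, Tendsto (fun x => p x u) atTop (𝓝 (p₀ u)))
    (hgm : Measurable g) (hg : ∀ θ, |g θ| ≤ ‖grn F θ‖)
    (hgl : Tendsto (fun θ => θ * A F (1 / θ) * g θ) (𝓝[>] 0) (𝓝 γ)) :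
    Tendsto (fun x => A F x * ∫ θ in (0:ℝ)..(B / x), p x (x * θ) * g θ) atTop
      (𝓝 (γ * ∫ u in (0:ℝ)..B, p₀ u / u)) ∧
    ∀ᶠ x in atTop, IntervalIntegrable (fun θ => p x (x * θ) * g θ) volume 0 (B / x) := by
  obtain ⟨θ₀, hθ0, hθ⟩ := exists_norm_grn_le_near_zero ha hA
  obtain ⟨x₁, h10, hpos, hR⟩ := ha.slowVar.ratio one_pos
  constructor
  · have hev : ∀ᶠ x in atTop, A F x * ∫ θ in (0:ℝ)..(B / x), p x (x * θ) * g θ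
        = ∫ u in (0:ℝ)..B, A F x / x * (p x u * g (u / x)) := by
      filter_upwards [eventually_gt_atTop 0] with x hx
      have h := intervalIntegral.integral_comp_div (a := 0) (b := B)
        (fun θ => p x (x * θ) * g θ) hx.ne'
      rw [zero_div, smul_eq_mul] at h
      have e : ∀ u, x * (u / x) = u := fun u => by field_simp
      simp_rw [e] at h
      rw [intervalIntegral.integral_const_mul, h]
      field_simp
    rw [tendsto_congr' hev, ← intervalIntegral.integral_const_mul]
    refine intervalIntegral.tendsto_integral_filter_of_dominated_convergence
      (fun u => 2 * C * (1 + (√u + √(1 / u)))) ?_ ?_ ?_ ?_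
    · refine Eventually.of_forall fun x => Measurable.aestronglyMeasurable ?_
      have := hpm x
      fun_prop
    · filter_upwards [hp, eventually_gt_atTop 0, eventually_gt_atTop (B / θ₀), eventually_ge_atTop x₁,
        eventually_ge_atTop (x₁ * B)] with x h1 hx0 hxB hx1 hxB1
      refine ae_of_all _ fun u hu => ?_
      rw [uIoc_of_le hB.le] at hu
      have hu0 : 0 < u := hu.1
      have hux : u / x < θ₀ := by
        rw [div_lt_iff₀ hθ0] at hxB
        rw [div_lt_iff₀ hx0]; linarith [hu.2]
      obtain ⟨h2, h3⟩ := hθ (u / x) ⟨by positivity, hux⟩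
      rw [one_div_div] at h2 h3
      have hx1u : x₁ ≤ x / u := by
        rw [le_div_iff₀ hu0]
        exact le_trans (by gcongr; exact hu.2) hxB1
      have h4 := (abs_le.1 (hR x (x / u) hx1 hx1u)).2
      have e1 : x / (x / u) = u := by field_simp
      have e2 : x / u / x = 1 / u := by field_simp
      rw [e1, e2, one_mul] at h4
      have hAx := hpos x hx1
      rw [Real.norm_eq_abs, abs_mul, abs_mul, abs_of_pos (div_pos hAx hx0)]
      calc _ ≤ A F x / x * (C * u * (2 / (u / x * A F (x / u)))) := by
            gcongr
            · exact h1 u hu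
            · exact (hg _).trans h3
        _ = 2 * C * (A F x / A F (x / u)) := by field_simp
        _ ≤ _ := by gcongr; linarith
    · refine IntervalIntegrable.const_mul ?_ _
      refine intervalIntegrable_const.add (IntervalIntegrable.add
        (Real.continuous_sqrt.intervalIntegrable _ _) ?_)
      refine (intervalIntegral.intervalIntegrable_rpow' (r := -(1 / 2)) (by norm_num)).congr ?_
      intro u hu
      rw [uIoc_of_le hB.le] at hu
      change u ^ (-(1 / 2) : ℝ) = √(1 / u)
      rw [Real.sqrt_eq_rpow, one_div u, Real.inv_rpow hu.1.le, Real.rpow_neg hu.1.le]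
    · refine ae_of_all _ fun u hu => ?_
      rw [uIoc_of_le hB.le] at hu
      have hu0 : 0 < u := hu.1
      have t1 := ha.slowVar.tendsto_div hu0
      have t2 : Tendsto (fun x : ℝ => u / x) atTop (𝓝[>] 0) := by
        refine tendsto_nhdsWithin_iff.2 ⟨tendsto_const_nhds.div_atTop tendsto_id, ?_⟩
        filter_upwards [eventually_gt_atTop 0] with x hx using div_pos hu0 hx
      have t3 := hgl.comp t2
      have t4 := ((t1.mul t3).mul (hlim u hu)).div_const u
      rw [one_mul] at t4
      rw [mul_div_assoc] at t4
      refine t4.congr' ?_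
      filter_upwards [eventually_gt_atTop 0, eventually_ge_atTop (x₁ * u)] with x hx hx1
      have h2 := hpos (x / u) (by rwa [le_div_iff₀ hu0])
      simp only [Function.comp, one_div_div]
      field_simp
  · have hA1 : ∀ᶠ θ in 𝓝[>] (0:ℝ), 1 ≤ A F (1 / θ) := by
      simp_rw [one_div]
      exact tendsto_inv_nhdsGT_zero.eventually (hA.eventually_ge_atTop 1)
    obtain ⟨v, hv, hv2⟩ := mem_nhdsGT_iff_exists_Ioo_subset.1 hA1
    have hv : 0 < v := hv
    filter_upwards [hp, eventually_gt_atTop 0, eventually_gt_atTop (B / θ₀),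
      eventually_gt_atTop (B / v)] with x h1 hx0 hxB hxv
    have hle : 0 ≤ B / x := by positivity
    rw [intervalIntegrable_iff_integrableOn_Ioc_of_le hle]
    refine Measure.integrableOn_of_bounded (M := 2 * C * x) measure_Ioc_lt_top.ne
      (Measurable.aestronglyMeasurable ?_) ((ae_restrict_mem measurableSet_Ioc).mono fun θ hθ' => ?_)
    · have := hpm x
      fun_prop
    · have ht0 : 0 < θ := hθ'.1
      have hxθ : x * θ ≤ B := by have := (le_div_iff₀ hx0).1 hθ'.2; linarith
      have hθθ : θ < θ₀ := hθ'.2.trans_lt (by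
        rw [div_lt_iff₀ hθ0] at hxB; rw [div_lt_iff₀ hx0]; linarith)
      have hθv : θ < v := hθ'.2.trans_lt (by
        rw [div_lt_iff₀ hv] at hxv; rw [div_lt_iff₀ hx0]; linarith)
      obtain ⟨h2, h3⟩ := hθ θ ⟨ht0, hθθ⟩
      have h4 : 1 ≤ A F (1 / θ) := hv2 ⟨ht0, hθv⟩
      rw [Real.norm_eq_abs, abs_mul]
      calc |p x (x * θ)| * |g θ| ≤ C * (x * θ) * (2 / (θ * A F (1 / θ))) := by
            gcongr
            · exact h1 _ ⟨by positivity, hxθ⟩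
            · exact (hg _).trans h3
        _ = 2 * C * x * (1 / A F (1 / θ)) := by field_simp
        _ ≤ 2 * C * x * 1 := by
            gcongr
            rw [div_le_one h2]; exact h4
        _ = _ := mul_one _

lemma tendsto_scaled_grn_re (ha : Ha F) (hA : Tendsto (A F) atTop atTop) :
    Tendsto (fun θ => θ * A F (1 / θ) * (grn F θ).re) (𝓝[>] 0) (𝓝 0) := by
  have := (Complex.continuous_re.tendsto _).comp (tendsto_mul_inv_one_sub_charFun ha hA)
  rw [Complex.I_re] at this
  refine this.congr fun θ => ?_
  simp only [Function.comp, Complex.re_ofReal_mul, grn]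

lemma tendsto_scaled_grn_im (ha : Ha F) (hA : Tendsto (A F) atTop atTop) :
    Tendsto (fun θ => θ * A F (1 / θ) * (grn F θ).im) (𝓝[>] 0) (𝓝 1) := by
  have := (Complex.continuous_im.tendsto _).comp (tendsto_mul_inv_one_sub_charFun ha hA)
  rw [Complex.I_im] at this
  refine this.congr fun θ => ?_
  simp only [Function.comp, Complex.im_ofReal_mul, grn]

/-- The real part of `e^{-i s x θ} / (1 - φ(θ))`, for `s = ± 1`. -/
noncomputable def osc (F : Measure ℝ) (s x θ : ℝ) : ℝ :=
  Real.cos (x * θ) * (grn F θ).re + s * Real.sin (x * θ) * (grn F θ).im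

lemma osc_eq_re {s : ℝ} (hs : s = 1 ∨ s = -1) (x θ : ℝ) :
    osc F s x θ = (grn F θ * Complex.exp ((-s * x * θ : ℝ) * Complex.I)).re := by
  rw [Complex.mul_re, Complex.exp_ofReal_mul_I_re, Complex.exp_ofReal_mul_I_im, osc]
  rcases hs with rfl | rfl
  · have : -1 * x * θ = -(x * θ) := by ring
    rw [this, Real.cos_neg, Real.sin_neg]; ring
  · have : - -1 * x * θ = x * θ := by ring
    rw [this]; ring

section

variable {a l : ℝ}

lemma tendsto_low (hinf : ¬ Integrable (fun x : ℝ => x) F) (ha : Ha F) (hb : Hb F) {κ : ℝ}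
    (hκ : Tendsto (fun x : ℝ => m F x / A F x) atTop (𝓝 κ)) (ha0 : 0 < a) (s : ℝ) {B : ℝ}
    (hB : 1 ≤ B) :
    Tendsto (fun x => m F x * ∫ θ in (0:ℝ)..(B / x), wt a l θ * osc F s x θ) atTop
      (𝓝 (wt a l 0 * (Real.pi / 2) + κ * (s * (wt a l 0 * ∫ u in (0:ℝ)..B, Real.sin u / u)))) ∧
    ∀ᶠ x in atTop, IntervalIntegrable (fun θ => wt a l θ * osc F s x θ) volume 0 (B / x) := by
  have hA := tendsto_A hinf ha hb
  have hB0 : 0 < B := by linarith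
  have hcw := continuous_wt a l
  have hmw := hcw.measurable
  set w0 := wt a l 0 with hw0
  have hw02 : |w0| ≤ 2 := by rw [abs_of_nonneg (wt_nonneg _ _ _)]; exact wt_le_two ha0 _ _
  set p₁ : ℝ → ℝ → ℝ := fun x u => wt a l (u / x) * Real.cos u - (Iic (1:ℝ)).indicator (fun _ => w0) u
  set p₂ : ℝ → ℝ → ℝ := fun x u => wt a l (u / x) * Real.sin u
  have hwlim : ∀ u : ℝ, Tendsto (fun x : ℝ => wt a l (u / x)) atTop (𝓝 w0) := fun u => by
    have : Tendsto (fun x : ℝ => u / x) atTop (𝓝 0) := tendsto_const_nhds.div_atTop tendsto_id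
    exact (hcw.tendsto 0).comp this
  have hp1m : ∀ x, Measurable (p₁ x) := fun x =>
    Measurable.sub (by fun_prop) (measurable_const.indicator measurableSet_Iic)
  have hp2m : ∀ x, Measurable (p₂ x) := fun x => by fun_prop
  have hp1 : ∀ᶠ x in atTop, ∀ u ∈ Ioc 0 B, |p₁ x u| ≤ (2 / a + 2) * u := by
    filter_upwards [eventually_ge_atTop 1] with x hx u hu
    have hu0 : 0 < u := hu.1
    have hx0 : 0 < x := by linarith
    simp only [p₁]
    by_cases h : u ≤ 1
    · rw [indicator_of_mem (show u ∈ Iic (1:ℝ) from h)]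
      have e : wt a l (u / x) * Real.cos u - w0
          = (wt a l (u / x) - w0) * Real.cos u + w0 * (Real.cos u - 1) := by ring
      rw [e]
      have h1 := wt_lipschitz ha0 l (u / x) 0
      rw [sub_zero, abs_of_pos (by positivity : 0 < u / x)] at h1
      have h2 : u / x ≤ u := div_le_self hu0.le hx
      have h3 := Real.abs_cos_le_one u
      have h4 : |Real.cos u - 1| ≤ u := by
        rw [abs_sub_comm, abs_of_nonneg (by linarith [Real.cos_le_one u])]
        have := Real.one_sub_sq_div_two_le_cos (x := u)
        nlinarith
      calc _ ≤ |(wt a l (u / x) - w0) * Real.cos u| + |w0 * (Real.cos u - 1)| := abs_add_le _ _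
        _ = |wt a l (u / x) - w0| * |Real.cos u| + |w0| * |Real.cos u - 1| := by
            rw [abs_mul, abs_mul]
        _ ≤ 2 / a * u * 1 + 2 * u := by
            gcongr
            exact h1.trans (by gcongr)
        _ = _ := by ring
    · rw [indicator_of_notMem (show u ∉ Iic (1:ℝ) from h), sub_zero, abs_mul,
        abs_of_nonneg (wt_nonneg _ _ _)]
      have h1 := wt_le_two ha0 l (u / x)
      have h2 := Real.abs_cos_le_one u
      have h3 : 0 ≤ 2 / a * u := by positivity
      have h4 := wt_nonneg a l (u / x)
      have h5 : wt a l (u / x) * |Real.cos u| ≤ 2 * 1 :=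
        mul_le_mul h1 h2 (abs_nonneg _) (by norm_num)
      push Not at h
      linarith
  have hp2 : ∀ᶠ x in atTop, ∀ u ∈ Ioc 0 B, |p₂ x u| ≤ 2 * u := by
    refine Eventually.of_forall fun x u hu => ?_
    simp only [p₂]
    rw [abs_mul, abs_of_nonneg (wt_nonneg _ _ _)]
    have h1 := wt_le_two ha0 l (u / x)
    have h2 := Real.abs_sin_le_abs (x := u)
    rw [abs_of_pos hu.1] at h2
    exact mul_le_mul h1 h2 (abs_nonneg _) (by norm_num)
  obtain ⟨t1, i1⟩ := tendsto_A_mul_integral_low ha hA hB0 (by positivity) hp1m hp1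
    (p₀ := fun u => w0 * Real.cos u - (Iic (1:ℝ)).indicator (fun _ => w0) u)
    (fun u _ => ((hwlim u).mul_const _).sub_const _)
    (g := fun θ => (grn F θ).re) (Complex.measurable_re.comp measurable_grn)
    (fun θ => Complex.abs_re_le_norm _) (tendsto_scaled_grn_re ha hA)
  obtain ⟨t2, i2⟩ := tendsto_A_mul_integral_low ha hA hB0 (by norm_num) hp2m hp2
    (p₀ := fun u => w0 * Real.sin u) (fun u _ => (hwlim u).mul_const _)
    (g := fun θ => (grn F θ).im) (Complex.measurable_im.comp measurable_grn)
    (fun θ => Complex.abs_im_le_norm _) (tendsto_scaled_grn_im ha hA)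
  have t3 := tendsto_m_mul_integral_grn_re hinf ha hb
  have hD : ∫ u in (0:ℝ)..B, w0 * Real.sin u / u = w0 * ∫ u in (0:ℝ)..B, Real.sin u / u := by
    rw [← intervalIntegral.integral_const_mul]
    congr 1; ext u; ring
  rw [zero_mul] at t1
  rw [one_mul, hD] at t2
  obtain ⟨x₀, hx00, hx0i⟩ := exists_integrableOn_grn_re hinf ha hb
  have key : ∀ᶠ x in atTop,
      IntervalIntegrable (fun θ => wt a l θ * osc F s x θ) volume 0 (B / x) ∧
      ∫ θ in (0:ℝ)..(B / x), wt a l θ * osc F s x θ = w0 * (∫ θ in Ioo 0 (1 / x), (grn F θ).re)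
        + (∫ θ in (0:ℝ)..(B / x), p₁ x (x * θ) * (grn F θ).re)
        + s * ∫ θ in (0:ℝ)..(B / x), p₂ x (x * θ) * (grn F θ).im := by
    filter_upwards [i1, i2, eventually_ge_atTop x₀] with x h1 h2 hx
    have hx0 : 0 < x := hx00.trans_le hx
    have h1x : 1 / x ≤ B / x := by gcongr
    have hBx : 0 ≤ B / x := by positivity
    have hi3 : IntegrableOn (fun θ => (Ioc 0 (1 / x)).indicator (fun θ => w0 * (grn F θ).re) θ)
        (Ioc 0 (B / x)) := by
      rw [integrableOn_indicator_iff measurableSet_Ioc,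
        inter_eq_self_of_subset_left (Ioc_subset_Ioc_right h1x), integrableOn_Ioc_iff_integrableOn_Ioo]
      exact (hx0i x hx).const_mul _
    have hi3' := (intervalIntegrable_iff_integrableOn_Ioc_of_le hBx).2 hi3
    have hv3 : ∫ θ in (0:ℝ)..(B / x), (Ioc 0 (1 / x)).indicator (fun θ => w0 * (grn F θ).re) θ
        = w0 * ∫ θ in Ioo 0 (1 / x), (grn F θ).re := by
      rw [intervalIntegral.integral_of_le hBx, setIntegral_indicator measurableSet_Ioc,
        inter_eq_self_of_subset_right (Ioc_subset_Ioc_right h1x), integral_Ioc_eq_integral_Ioo,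
        integral_const_mul]
    have he : EqOn (fun θ => (Ioc 0 (1 / x)).indicator (fun θ => w0 * (grn F θ).re) θ
        + p₁ x (x * θ) * (grn F θ).re + s * (p₂ x (x * θ) * (grn F θ).im))
        (fun θ => wt a l θ * osc F s x θ) (uIoc 0 (B / x)) := by
      intro θ hθ
      rw [uIoc_of_le hBx] at hθ
      have e1 : x * θ / x = θ := by field_simp
      simp only [p₁, p₂, osc, e1]
      by_cases h : θ ≤ 1 / x
      · have h' : x * θ ≤ 1 := by rw [le_div_iff₀ hx0] at h; linarith
        rw [indicator_of_mem (show θ ∈ Ioc 0 (1 / x) from ⟨hθ.1, h⟩),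
          indicator_of_mem (show x * θ ∈ Iic (1:ℝ) from h')]
        ring
      · have h' : ¬ x * θ ≤ 1 := by rw [le_div_iff₀ hx0] at h; rwa [mul_comm]
        rw [indicator_of_notMem (show θ ∉ Ioc 0 (1 / x) from fun h'' => h h''.2),
          indicator_of_notMem (show x * θ ∉ Iic (1:ℝ) from h')]
        ring
    refine ⟨((hi3'.add h1).add (h2.const_mul s)).congr he, ?_⟩
    rw [← hv3, ← intervalIntegral.integral_const_mul, ← intervalIntegral.integral_add hi3' h1,
      ← intervalIntegral.integral_add (hi3'.add h1) (h2.const_mul s)]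
    rw [intervalIntegral.integral_of_le hBx, intervalIntegral.integral_of_le hBx]
    rw [uIoc_of_le hBx] at he
    exact (setIntegral_congr_fun measurableSet_Ioc he).symm
  refine ⟨?_, key.mono fun x h => h.1⟩
  have t4 := (t3.const_mul w0).add (hκ.mul (t1.add (t2.const_mul s)))
  rw [zero_add] at t4
  refine t4.congr' ?_
  filter_upwards [key, hA.eventually_gt_atTop 0] with x h hAx
  rw [h.2]
  field_simp
  ring

/-- The asymptotic behaviour of the Fourier integral of the Green measure. -/
theorem tendsto_m_mul_integral_osc (hinf : ¬ Integrable (fun x : ℝ => x) F) (ha : Ha F) (hb : Hb F)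
    {κ : ℝ} (hκ : Tendsto (fun x : ℝ => m F x / A F x) atTop (𝓝 κ)) (ha0 : 0 < a)
    (hN : ∀ θ ∈ Ioc 0 (a + |l|), charFun F θ ≠ 1) {s : ℝ} (hs : s = 1 ∨ s = -1) :
    Tendsto (fun x => m F x * ∫ θ in (0:ℝ)..(a + |l|), wt a l θ * osc F s x θ) atTop
      (𝓝 (wt a l 0 * (Real.pi / 2) * (1 + s * κ))) := by
  have hA := tendsto_A hinf ha hb
  have hpi := Real.pi_pos
  set N := a + |l| with hNdef
  have hN0 : 0 < N := by positivity
  obtain ⟨C, X, hC, hX, hhigh⟩ := exists_norm_integral_high_le ha hA ha0 hN hs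
  rw [Metric.tendsto_nhds]
  intro ε hε
  have c1 : Tendsto (fun B : ℝ => C * B ^ (-(1 / 4) : ℝ)) atTop (𝓝 0) := by
    have := (tendsto_rpow_neg_atTop (show (0:ℝ) < 1 / 4 by norm_num)).const_mul C
    rwa [mul_zero] at this
  have c2 : Tendsto (fun B : ℝ => κ * (s * (wt a l 0 * ∫ u in (0:ℝ)..B, Real.sin u / u))) atTop
      (𝓝 (κ * (s * (wt a l 0 * (Real.pi / 2))))) :=
    ((tendsto_integral_sin_div.const_mul _).const_mul _).const_mul _
  obtain ⟨B, hB1, hB2, hBpi⟩ := ((c1.eventually_lt_const (show 0 < ε / 3 by positivity)).and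
    (((Metric.tendsto_nhds.1 c2) (ε / 3) (by positivity)).and (eventually_ge_atTop Real.pi))).exists
  have hB0 : 0 < B := by linarith
  obtain ⟨t, hi⟩ := tendsto_low (l := l) hinf ha hb hκ ha0 s
    (show 1 ≤ B by linarith [Real.pi_gt_three])
  filter_upwards [(Metric.tendsto_nhds.1 t) (ε / 3) (by positivity), hi, eventually_ge_atTop X,
    eventually_ge_atTop (B / N), eventually_m_pos hinf ha hb, eventually_inv_A_le hinf ha hb,
    hA.eventually_gt_atTop 0] with x h1 h2 hxX hxB hm hmA hAx
  have hx0 : 0 < x := hX.trans_le hxX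
  have hBN : B / x ≤ N := by
    rw [div_le_iff₀ hN0] at hxB; rw [div_le_iff₀ hx0]; linarith
  have hBx : 0 < B / x := by positivity
  have h3 := hhigh x hxX (B / x) (by gcongr) hBN
  have e1 : x * (B / x) = B := by field_simp
  rw [e1] at h3
  set E : ℝ → ℂ := fun θ => Complex.exp ((-s * x * θ : ℝ) * Complex.I) with hE
  have hEc : Continuous E := by rw [hE]; fun_prop
  have hci : IntervalIntegrable (fun θ => (wt a l θ : ℂ) * grn F θ * E θ) volume (B / x) N :=
    (intervalIntegrable_wt_mul_grn ha0 hN hBx hN0).mul_continuousOn hEc.continuousOn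
  have hre : ∀ θ, ((wt a l θ : ℂ) * grn F θ * E θ).re = wt a l θ * osc F s x θ := fun θ => by
    rw [mul_assoc, Complex.re_ofReal_mul, osc_eq_re hs]
  have hri : IntervalIntegrable (fun θ => wt a l θ * osc F s x θ) volume (B / x) N := by
    rw [intervalIntegrable_iff_integrableOn_Ioc_of_le hBN] at hci ⊢
    have := hci.re
    refine this.congr (ae_of_all _ fun θ => hre θ)
  have h4 : |∫ θ in (B / x)..N, wt a l θ * osc F s x θ|
      ≤ C * B ^ (-(1 / 4) : ℝ) / A F x := by
    have e2 : ∫ θ in (B / x)..N, wt a l θ * osc F s x θ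
        = (∫ θ in (B / x)..N, (wt a l θ : ℂ) * grn F θ * E θ).re := by
      have := Complex.reCLM.intervalIntegral_comp_comm hci
      simp only [Complex.reCLM_apply, hre] at this
      exact this
    rw [e2]
    exact (Complex.abs_re_le_norm _).trans h3
  have h5 : |m F x * ∫ θ in (B / x)..N, wt a l θ * osc F s x θ| < ε / 3 := by
    rw [abs_mul, abs_of_pos hm]
    have hmA' : m F x ≤ A F x := (inv_le_inv₀ hAx hm).1 hmA
    calc _ ≤ m F x * (C * B ^ (-(1 / 4) : ℝ) / A F x) := by gcongr
      _ = C * B ^ (-(1 / 4) : ℝ) * (m F x / A F x) := by ring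
      _ ≤ C * B ^ (-(1 / 4) : ℝ) * 1 := by
          have := Real.rpow_pos_of_pos hB0 (-(1 / 4))
          gcongr
          rw [div_le_one hAx]; exact hmA'
      _ < ε / 3 := by rw [mul_one]; exact hB1
  rw [← intervalIntegral.integral_add_adjacent_intervals h2 hri, mul_add]
  rw [Real.dist_eq] at h1 hB2 ⊢
  rw [abs_lt] at h1 hB2 h5 ⊢
  have e3 : wt a l 0 * (Real.pi / 2) * (1 + s * κ)
      = wt a l 0 * (Real.pi / 2) + κ * (s * (wt a l 0 * (Real.pi / 2))) := by ring
  rw [e3]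
  constructor <;> linarith

end

end Renewal

namespace Renewal

variable {F : Measure ℝ} [IsProbabilityMeasure F]

instance isProbabilityMeasure_convPow (F : Measure ℝ) [IsProbabilityMeasure F] (n : ℕ) :
    IsProbabilityMeasure (convPow F n) := by
  induction n with
  | zero => unfold convPow; infer_instance
  | succ n ih => unfold convPow; infer_instance

lemma charFun_convPow (n : ℕ) (θ : ℝ) : charFun (convPow F n) θ = charFun F θ ^ n := by
  induction n with
  | zero => simp [convPow]
  | succ n ih => rw [convPow, charFun_conv, ih, pow_succ]

lemma integrableOn_grn_re_Ioc (hinf : ¬ Integrable (fun x : ℝ => x) F) (ha : Ha F) (hb : Hb F)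
    {N : ℝ} (hN : ∀ θ ∈ Ioc 0 N, charFun F θ ≠ 1) :
    IntegrableOn (fun θ => (grn F θ).re) (Ioc 0 N) := by
  obtain ⟨x₀, h0, h⟩ := exists_integrableOn_grn_re hinf ha hb
  have h1 := h x₀ le_rfl
  have h2 : IntegrableOn (fun θ => (grn F θ).re) (Icc (1 / x₀) N) := by
    refine ContinuousOn.integrableOn_compact isCompact_Icc (Complex.continuous_re.comp_continuousOn
      (continuousOn_grn fun θ hθ => hN θ ⟨?_, hθ.2⟩))
    exact (by positivity : 0 < 1 / x₀).trans_le hθ.1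
  refine (h1.union h2).mono_set fun θ hθ => ?_
  rcases lt_or_ge θ (1 / x₀) with h | h
  · exact Or.inl ⟨hθ.1, h⟩
  · exact Or.inr ⟨h, hθ.2⟩

lemma exists_le_norm_one_sub_charFun (ha : Ha F) (hA : Tendsto (A F) atTop atTop) (M : ℝ) :
    ∃ δ : ℝ, 0 < δ ∧ ∀ θ ∈ Ioo 0 δ, M * θ ≤ ‖1 - charFun F θ‖ := by
  obtain ⟨θ₀, hθ0, hθ⟩ := exists_norm_grn_le_near_zero ha hA
  have hA1 : ∀ᶠ θ in 𝓝[>] (0:ℝ), 2 * M ≤ A F (1 / θ) := by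
    simp_rw [one_div]
    exact tendsto_inv_nhdsGT_zero.eventually (hA.eventually_ge_atTop (2 * M))
  have hne : ∀ᶠ θ in 𝓝[>] (0:ℝ), 1 - charFun F θ ≠ 0 := by
    have := (tendsto_mul_inv_one_sub_charFun ha hA).eventually_ne Complex.I_ne_zero
    refine this.mono fun θ h h0 => ?_
    rw [h0, inv_zero, mul_zero] at h; exact h rfl
  obtain ⟨v, hv, hv2⟩ := mem_nhdsGT_iff_exists_Ioo_subset.1 (hA1.and hne)
  have hv : 0 < v := hv
  refine ⟨min θ₀ v, by positivity, fun θ hθ' => ?_⟩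
  obtain ⟨h1, h2⟩ := hθ θ ⟨hθ'.1, hθ'.2.trans_le (min_le_left _ _)⟩
  obtain ⟨h3, h4⟩ := hv2 ⟨hθ'.1, hθ'.2.trans_le (min_le_right _ _)⟩
  have ht := hθ'.1
  have hn : 0 < ‖1 - charFun F θ‖ := norm_pos_iff.2 h4
  rw [grn, norm_inv, inv_eq_one_div, div_le_div_iff₀ hn (by positivity)] at h2
  nlinarith

lemma exists_mul_norm_grn_le (ha : Ha F) (hA : Tendsto (A F) atTop atTop)
    {N : ℝ} (hN : ∀ θ ∈ Ioc 0 N, charFun F θ ≠ 1) :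
    ∃ D : ℝ, ∀ θ ∈ Ioc 0 N, θ * ‖grn F θ‖ ≤ D := by
  obtain ⟨δ, hδ, h⟩ := exists_le_norm_one_sub_charFun ha hA 1
  obtain ⟨C, hC⟩ := (isCompact_Icc (a := δ) (b := N)).exists_bound_of_continuousOn
    (continuousOn_grn (F := F) (s := Icc δ N) fun θ hθ => hN θ ⟨hδ.trans_le hθ.1, hθ.2⟩)
  refine ⟨max 1 (N * C), fun θ hθ => ?_⟩
  have h0 := hθ.1
  rcases lt_or_ge θ δ with h' | h'
  · refine le_trans ?_ (le_max_left _ _)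
    have h1 := h θ ⟨h0, h'⟩
    rw [one_mul] at h1
    rw [grn, norm_inv, ← div_eq_mul_inv]
    exact div_le_one_of_le₀ h1 (norm_nonneg _)
  · refine le_trans ?_ (le_max_right _ _)
    have h1 := hC θ ⟨h', hθ.2⟩
    exact mul_le_mul hθ.2 h1 (norm_nonneg _) (h0.le.trans hθ.2)

lemma one_sub_le_norm {z : ℂ} (hz : ‖z‖ ≤ 1) {r : ℝ} (hr0 : 0 ≤ r) : 1 - r ≤ ‖1 - r * z‖ := by
  have h1 := norm_sub_norm_le (1:ℂ) (r * z)
  rw [norm_one, norm_mul, Complex.norm_real, Real.norm_eq_abs, abs_of_nonneg hr0] at h1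
  nlinarith

lemma norm_one_sub_le_two_mul {z : ℂ} (hz : ‖z‖ ≤ 1) {r : ℝ} (hr0 : 0 ≤ r) (hr1 : r ≤ 1) :
    ‖1 - z‖ ≤ 2 * ‖1 - r * z‖ := by
  have h1 := one_sub_le_norm hz hr0
  have h2 : 1 - z = (1 - r * z) - ((1 - r : ℝ) : ℂ) * z := by push_cast; ring
  have h3 : ‖((1 - r : ℝ) : ℂ) * z‖ ≤ 1 - r := by
    rw [norm_mul, Complex.norm_real, Real.norm_eq_abs, abs_of_nonneg (by linarith)]
    exact mul_le_of_le_one_right (by linarith) hz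
  rw [h2]
  refine (norm_sub_le _ _).trans ?_
  linarith

lemma integral_div_sq_add_sq_le {c s δ : ℝ} (hc : 0 < c) (hs : 0 < s) :
    ∫ θ in (0:ℝ)..δ, s / (s ^ 2 + (c * θ) ^ 2) ≤ Real.pi / (2 * c) := by
  have h : ∀ θ ∈ uIcc 0 δ, HasDerivAt (fun θ => Real.arctan (c * θ / s) / c)
      (s / (s ^ 2 + (c * θ) ^ 2)) θ := by
    intro θ _
    have h1 : HasDerivAt (fun θ : ℝ => c * θ / s) (c / s) θ := by
      simpa using ((hasDerivAt_id θ).const_mul c).div_const s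
    refine (h1.arctan.div_const c).congr_deriv ?_
    field_simp
  rw [intervalIntegral.integral_eq_sub_of_hasDerivAt h]
  · simp only [mul_zero, zero_div, Real.arctan_zero, sub_zero]
    have := Real.arctan_lt_pi_div_two (c * δ / s)
    rw [div_le_div_iff₀ hc (by positivity)]
    nlinarith
  · refine Continuous.intervalIntegrable ?_ _ _
    exact continuous_const.div (by fun_prop) fun θ => by positivity

lemma continuous_one_sub_mul_charFun (r : ℝ) : Continuous fun θ => 1 - r * charFun F θ := by
  have := continuous_charFun (μ := F); fun_prop

/-- The part of the Abel means that comes from the atom at frequency `0` vanishes. -/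
lemma tendsto_integral_abel_error (ha : Ha F) (hA : Tendsto (A F) atTop atTop)
    {N : ℝ} (hN0 : 0 < N) (hN : ∀ θ ∈ Ioc 0 N, charFun F θ ≠ 1) :
    Tendsto (fun r : ℝ => ∫ θ in (0:ℝ)..N, (1 - r) / ‖1 - r * charFun F θ‖ ^ 2) (𝓝[<] 1) (𝓝 0) := by
  have hpi := Real.pi_pos
  rw [Metric.tendsto_nhds]
  intro ε hε
  set M := 8 * Real.pi / ε with hM
  have hM0 : 0 < M := by positivity
  obtain ⟨δ', hδ', h1'⟩ := exists_le_norm_one_sub_charFun ha hA M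
  set δ := min (δ' / 2) N with hδdef
  have hδ : 0 < δ := by positivity
  have hδN : δ ≤ N := min_le_right _ _
  have h1 : ∀ θ ∈ Ioc 0 δ, M * θ ≤ ‖1 - charFun F θ‖ := fun θ hθ =>
    h1' θ ⟨hθ.1, by have := hθ.2.trans (min_le_left _ _); linarith⟩
  obtain ⟨C, hC⟩ := (isCompact_Icc (a := δ) (b := N)).exists_bound_of_continuousOn
    (continuousOn_grn (F := F) (s := Icc δ N) fun θ hθ => hN θ ⟨hδ.trans_le hθ.1, hθ.2⟩)
  have hr : ∀ᶠ r : ℝ in 𝓝[<] 1, 4 * (1 - r) * C ^ 2 * N < ε / 4 := by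
    have : Tendsto (fun r : ℝ => 4 * (1 - r) * C ^ 2 * N) (𝓝[<] 1) (𝓝 (4 * (1 - 1) * C ^ 2 * N)) :=
      (Continuous.tendsto (by fun_prop) 1).mono_left nhdsWithin_le_nhds
    rw [sub_self, mul_zero, zero_mul, zero_mul] at this
    exact this.eventually_lt_const (by positivity)
  have hr0 : ∀ᶠ r : ℝ in 𝓝[<] 1, 0 < r := by
    exact (eventually_gt_nhds zero_lt_one).filter_mono nhdsWithin_le_nhds
  filter_upwards [hr, hr0, self_mem_nhdsWithin] with r hr hr0 hr1
  have hr1 : r < 1 := hr1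
  have hs : 0 < 1 - r := by linarith
  have hφ : ∀ θ, ‖charFun F θ‖ ≤ 1 := fun θ => norm_charFun_le_one θ
  have hlow : ∀ θ, 1 - r ≤ ‖1 - r * charFun F θ‖ := fun θ => one_sub_le_norm (hφ θ) hr0.le
  have hpos : ∀ θ, 0 < ‖1 - r * charFun F θ‖ := fun θ => hs.trans_le (hlow θ)
  have hcont : Continuous fun θ => (1 - r) / ‖1 - r * charFun F θ‖ ^ 2 :=
    continuous_const.div ((continuous_one_sub_mul_charFun r).norm.pow 2)
      fun θ => (pow_pos (hpos θ) 2).ne'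
  rw [dist_zero_right, Real.norm_eq_abs, abs_of_nonneg (intervalIntegral.integral_nonneg hN0.le
    fun θ _ => by positivity), ← intervalIntegral.integral_add_adjacent_intervals
    (hcont.intervalIntegrable 0 δ) (hcont.intervalIntegrable δ N)]
  have e1 : ∫ θ in (0:ℝ)..δ, (1 - r) / ‖1 - r * charFun F θ‖ ^ 2 ≤ 2 * (Real.pi / (2 * (M / 2))) := by
    refine le_trans ?_ (mul_le_mul_of_nonneg_left (integral_div_sq_add_sq_le (δ := δ) (half_pos hM0) hs) two_pos.le)
    rw [← intervalIntegral.integral_const_mul]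
    have hc2 : Continuous fun θ : ℝ => 2 * ((1 - r) / ((1 - r) ^ 2 + (M / 2 * θ) ^ 2)) :=
      continuous_const.mul (continuous_const.div (by fun_prop) fun θ => by positivity)
    rw [intervalIntegral.integral_of_le hδ.le, intervalIntegral.integral_of_le hδ.le]
    refine setIntegral_mono_on
      ((intervalIntegrable_iff_integrableOn_Ioc_of_le hδ.le).1 (hcont.intervalIntegrable 0 δ))
      ((intervalIntegrable_iff_integrableOn_Ioc_of_le hδ.le).1 (hc2.intervalIntegrable 0 δ))
      measurableSet_Ioc fun θ hθ => ?_
    have h2 := norm_one_sub_le_two_mul (hφ θ) hr0.le hr1.le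
    have h3 := h1 θ hθ
    have h4 : M / 2 * θ ≤ ‖1 - r * charFun F θ‖ := by linarith
    have h5 : 0 ≤ M / 2 * θ := mul_nonneg (by positivity) hθ.1.le
    have h6 := hlow θ
    have h7 := hpos θ
    rw [mul_div_assoc', div_le_div_iff₀ (by positivity) (by positivity)]
    nlinarith [mul_self_le_mul_self h5 h4, mul_self_le_mul_self hs.le h6]
  have e2 : ∫ θ in δ..N, (1 - r) / ‖1 - r * charFun F θ‖ ^ 2 ≤ 4 * (1 - r) * C ^ 2 * N := by
    calc _ ≤ ∫ θ in δ..N, 4 * (1 - r) * C ^ 2 := by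
          refine intervalIntegral.integral_mono_on hδN (hcont.intervalIntegrable δ N) (by simp)
            fun θ hθ => ?_
          have h2 := norm_one_sub_le_two_mul (hφ θ) hr0.le hr1.le
          have h3 := hC θ hθ
          have hne : 1 - charFun F θ ≠ 0 :=
            sub_ne_zero.2 (hN θ ⟨hδ.trans_le hθ.1, hθ.2⟩).symm
          have hn := norm_pos_iff.2 hne
          rw [grn, norm_inv, inv_eq_one_div, div_le_iff₀ hn] at h3
          have h7 := hpos θ
          have hC0 : 0 < C := by
            by_contra! h
            nlinarith
          have h8 : 1 ≤ 2 * C * ‖1 - r * charFun F θ‖ := by nlinarith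
          rw [div_le_iff₀ (by positivity)]
          have h9 : 1 ≤ (2 * C * ‖1 - r * charFun F θ‖) ^ 2 := one_le_pow₀ h8
          calc 1 - r ≤ (1 - r) * (2 * C * ‖1 - r * charFun F θ‖) ^ 2 := by nlinarith
            _ = _ := by ring
      _ = (N - δ) * (4 * (1 - r) * C ^ 2) := by simp; ring
      _ ≤ N * (4 * (1 - r) * C ^ 2) := by
          gcongr
          linarith
      _ = _ := by ring
  have e3 : 2 * (Real.pi / (2 * (M / 2))) = ε / 4 := by rw [hM]; field_simp; norm_num
  linarith

/-- The integrand of the Abel means. -/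
noncomputable def oscAbel (F : Measure ℝ) (r x θ : ℝ) : ℝ :=
  (Complex.exp ((-(x * θ) : ℝ) * Complex.I) * (1 - r * charFun F θ)⁻¹).re

lemma oscAbel_eq (r x θ : ℝ) : oscAbel F r x θ =
    Real.cos (x * θ) * ((1 - r) / ‖1 - r * charFun F θ‖ ^ 2)
      + (Real.cos (x * θ) * (r * (1 - charFun F θ).re) + Real.sin (x * θ) * (r * (charFun F θ).im))
        / ‖1 - r * charFun F θ‖ ^ 2 := by
  rw [oscAbel, Complex.mul_re, Complex.exp_ofReal_mul_I_re, Complex.exp_ofReal_mul_I_im,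
    Complex.inv_re, Complex.inv_im, Complex.normSq_eq_norm_sq, Real.cos_neg, Real.sin_neg]
  simp only [Complex.sub_re, Complex.one_re, Complex.re_ofReal_mul, Complex.sub_im, Complex.one_im,
    Complex.im_ofReal_mul]
  ring

lemma tendsto_integral_oscAbel (hinf : ¬ Integrable (fun x : ℝ => x) F) (ha : Ha F) (hb : Hb F)
    {N : ℝ} (hN0 : 0 < N) (hN : ∀ θ ∈ Ioc 0 N, charFun F θ ≠ 1) {w : ℝ → ℝ} (hw : Continuous w)
    (hw2 : ∀ θ, |w θ| ≤ 2) (x : ℝ) :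
    Tendsto (fun r => ∫ θ in (0:ℝ)..N, w θ * oscAbel F r x θ) (𝓝[<] 1)
      (𝓝 (∫ θ in (0:ℝ)..N, w θ * osc F 1 x θ)) := by
  have hA := tendsto_A hinf ha hb
  obtain ⟨D, hD⟩ := exists_mul_norm_grn_le ha hA hN
  have hcφ := continuous_charFun (μ := F)
  set q : ℝ → ℝ → ℝ := fun r θ => (Real.cos (x * θ) * (r * (1 - charFun F θ).re)
    + Real.sin (x * θ) * (r * (charFun F θ).im)) / ‖1 - r * charFun F θ‖ ^ 2
  have hr0 : ∀ᶠ r : ℝ in 𝓝[<] 1, 0 < r :=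
    (eventually_gt_nhds zero_lt_one).filter_mono nhdsWithin_le_nhds
  have hr1 : ∀ᶠ r : ℝ in 𝓝[<] 1, r < 1 := self_mem_nhdsWithin
  have hφ : ∀ θ, ‖charFun F θ‖ ≤ 1 := fun θ => norm_charFun_le_one θ
  have hre := integrableOn_grn_re_Ioc hinf ha hb hN
  have t1 : Tendsto (fun r => ∫ θ in (0:ℝ)..N, w θ * q r θ) (𝓝[<] 1)
      (𝓝 (∫ θ in (0:ℝ)..N, w θ * osc F 1 x θ)) := by
    refine intervalIntegral.tendsto_integral_filter_of_dominated_convergence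
      (fun θ => 2 * (4 * (grn F θ).re + 4 * |x| * D)) ?_ ?_ ?_ ?_
    · refine Eventually.of_forall fun r => Measurable.aestronglyMeasurable ?_
      have h1 : Measurable (charFun F) := hcφ.measurable
      have h2 : Measurable fun θ => (charFun F θ).im := Complex.measurable_im.comp h1
      have h3 : Measurable fun θ => (1 - charFun F θ).re :=
        Complex.measurable_re.comp (measurable_const.sub h1)
      have h4 := hw.measurable
      have h5 : Measurable fun θ => ‖1 - r * charFun F θ‖ := (continuous_one_sub_mul_charFun r).norm.measurable
      fun_prop
    · filter_upwards [hr0, hr1] with r hr0 hr1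
      refine ae_of_all _ fun θ hθ => ?_
      rw [uIoc_of_le hN0.le] at hθ
      rw [Real.norm_eq_abs, abs_mul]
      refine mul_le_mul (hw2 θ) ?_ (abs_nonneg _) two_pos.le
      have h2 := norm_one_sub_le_two_mul (hφ θ) hr0.le hr1.le
      have hn : 0 < ‖1 - charFun F θ‖ := norm_pos_iff.2 (sub_ne_zero.2 (hN θ hθ).symm)
      have h3 : 0 < ‖1 - r * charFun F θ‖ := by linarith
      have hg := hD θ hθ
      have him : |(charFun F θ).im| ≤ ‖1 - charFun F θ‖ := by
        have := Complex.abs_im_le_norm (1 - charFun F θ)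
        rwa [Complex.sub_im, Complex.one_im, zero_sub, abs_neg] at this
      have hsin : |Real.sin (x * θ)| ≤ |x| * θ := by
        have := Real.abs_sin_le_abs (x := x * θ)
        rwa [abs_mul, abs_of_pos hθ.1] at this
      have hre0 := one_sub_charFun_re_nonneg F θ
      have hgre : (grn F θ).re = (1 - charFun F θ).re / ‖1 - charFun F θ‖ ^ 2 := by
        rw [grn, Complex.inv_re, Complex.normSq_eq_norm_sq]
      have hgn : ‖grn F θ‖ = ‖1 - charFun F θ‖⁻¹ := by rw [grn, norm_inv]
      rw [hgn, ← div_eq_mul_inv] at hg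
      simp only [q]
      rw [abs_div, abs_of_pos (by positivity : 0 < ‖1 - r * charFun F θ‖ ^ 2), div_le_iff₀ (by positivity)]
      have hnum : |Real.cos (x * θ) * (r * (1 - charFun F θ).re) + Real.sin (x * θ) * (r * (charFun F θ).im)|
          ≤ (1 - charFun F θ).re + |x| * θ * ‖1 - charFun F θ‖ := by
        refine (abs_add_le _ _).trans ?_
        rw [abs_mul, abs_mul, abs_mul, abs_mul, abs_of_pos hr0, abs_of_nonneg hre0]
        have hcs := Real.abs_cos_le_one (x * θ)
        have a1 : |Real.cos (x * θ)| * (r * (1 - charFun F θ).re) ≤ 1 * (1 * (1 - charFun F θ).re) := by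
          gcongr
        have a2 : |Real.sin (x * θ)| * (r * |(charFun F θ).im|)
            ≤ |x| * θ * (1 * ‖1 - charFun F θ‖) := by
          have := hθ.1
          gcongr
        linarith
      refine hnum.trans ?_
      have h4 : ‖1 - charFun F θ‖ ^ 2 ≤ 4 * ‖1 - r * charFun F θ‖ ^ 2 := by nlinarith
      have a1 : (1 - charFun F θ).re ≤ 4 * (grn F θ).re * ‖1 - r * charFun F θ‖ ^ 2 := by
        rw [hgre]
        calc (1 - charFun F θ).re = (1 - charFun F θ).re / ‖1 - charFun F θ‖ ^ 2 * ‖1 - charFun F θ‖ ^ 2 := by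
              field_simp
          _ ≤ (1 - charFun F θ).re / ‖1 - charFun F θ‖ ^ 2 * (4 * ‖1 - r * charFun F θ‖ ^ 2) := by gcongr
          _ = _ := by ring
      have a2 : |x| * θ * ‖1 - charFun F θ‖ ≤ 4 * |x| * D * ‖1 - r * charFun F θ‖ ^ 2 := by
        have := hθ.1
        calc |x| * θ * ‖1 - charFun F θ‖ = |x| * (θ / ‖1 - charFun F θ‖) * ‖1 - charFun F θ‖ ^ 2 := by
              field_simp
          _ ≤ |x| * (θ / ‖1 - charFun F θ‖) * (4 * ‖1 - r * charFun F θ‖ ^ 2) := by gcongr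
          _ ≤ |x| * D * (4 * ‖1 - r * charFun F θ‖ ^ 2) := by gcongr
          _ = _ := by ring
      linarith
    · refine IntervalIntegrable.const_mul (IntervalIntegrable.add (IntervalIntegrable.const_mul ?_ 4)
        intervalIntegrable_const) 2
      exact (intervalIntegrable_iff_integrableOn_Ioc_of_le hN0.le).2 hre
    · refine ae_of_all _ fun θ hθ => ?_
      rw [uIoc_of_le hN0.le] at hθ
      have hn : 1 - charFun F θ ≠ 0 := sub_ne_zero.2 (hN θ hθ).symm
      have hosc : osc F 1 x θ = q 1 θ := by
        simp only [q, osc, grn, Complex.inv_re, Complex.inv_im, Complex.normSq_eq_norm_sq,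
          Complex.ofReal_one, one_mul, Complex.sub_im, Complex.one_im]
        ring
      rw [hosc]
      refine Tendsto.const_mul _ (Tendsto.mono_left ?_ nhdsWithin_le_nhds)
      have : ContinuousAt (fun r => q r θ) 1 := by
        refine ContinuousAt.div (by fun_prop) (by fun_prop) ?_
        simpa using hn
      exact this
  have t2 : Tendsto (fun r : ℝ => ∫ θ in (0:ℝ)..N, w θ * (Real.cos (x * θ) *
      ((1 - r) / ‖1 - r * charFun F θ‖ ^ 2))) (𝓝[<] 1) (𝓝 0) := by
    have t3 := (tendsto_integral_abel_error ha hA hN0 hN).const_mul 2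
    rw [mul_zero] at t3
    refine squeeze_zero_norm' ?_ t3
    filter_upwards [hr0, hr1] with r hr0 hr1
    have hcont : Continuous fun θ => (1 - r) / ‖1 - r * charFun F θ‖ ^ 2 :=
      continuous_const.div ((continuous_one_sub_mul_charFun r).norm.pow 2) fun θ => by
        have := one_sub_le_norm (hφ θ) hr0.le
        have : 0 < ‖1 - r * charFun F θ‖ := by linarith
        positivity
    rw [← intervalIntegral.integral_const_mul]
    refine intervalIntegral.norm_integral_le_of_norm_le hN0.le (ae_of_all _ fun θ _ => ?_)
      ((hcont.const_mul 2).intervalIntegrable _ _)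
    have h0 : 0 ≤ (1 - r) / ‖1 - r * charFun F θ‖ ^ 2 := div_nonneg (by linarith) (by positivity)
    rw [Real.norm_eq_abs, abs_mul, abs_mul, abs_of_nonneg h0]
    have h1 := hw2 θ
    have h2 := Real.abs_cos_le_one (x * θ)
    refine mul_le_mul h1 (mul_le_of_le_one_left h0 h2) (by positivity) two_pos.le
  have t4 := t2.add t1
  rw [zero_add] at t4
  refine t4.congr' ?_
  filter_upwards [hr0, hr1] with r hr0 hr1
  have hden : ∀ θ, ‖1 - r * charFun F θ‖ ^ 2 ≠ 0 := fun θ => by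
    have := one_sub_le_norm (hφ θ) hr0.le
    have : 0 < ‖1 - r * charFun F θ‖ := by linarith
    positivity
  have hcont : Continuous fun θ => (1 - r) / ‖1 - r * charFun F θ‖ ^ 2 :=
    continuous_const.div ((continuous_one_sub_mul_charFun r).norm.pow 2) hden
  have hcq : Continuous (q r) := by
    refine Continuous.div ?_ ((continuous_one_sub_mul_charFun r).norm.pow 2) hden
    have h1 : Continuous fun θ => (charFun F θ).im := Complex.continuous_im.comp hcφ
    have h2 : Continuous fun θ => (1 - charFun F θ).re :=
      Complex.continuous_re.comp (continuous_const.sub hcφ)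
    fun_prop
  rw [← intervalIntegral.integral_add]
  · refine intervalIntegral.integral_congr fun θ _ => ?_
    simp only [oscAbel_eq, q]; ring
  · exact Continuous.intervalIntegrable (hw.mul (by fun_prop)) _ _
  · exact (hw.mul hcq).intervalIntegrable _ _

section

variable {a l : ℝ}

/-- The terms of the smoothed renewal series. -/
noncomputable def smoothTerm (F : Measure ℝ) (a l x : ℝ) (n : ℕ) : ℝ :=
  ∫ y, kern a (y - x) * Real.cos (l * (y - x)) ∂(convPow F n)

lemma integrable_kern_sub_mul_cos (ha0 : 0 < a) (G : Measure ℝ) [IsFiniteMeasure G] (x : ℝ) :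
    Integrable (fun y => kern a (y - x) * Real.cos (l * (y - x))) G := by
  have hk := continuous_kern a
  refine (integrable_const (2 * a + 4 / a)).mono' (Continuous.aestronglyMeasurable (by fun_prop))
    (ae_of_all _ fun y => ?_)
  rw [Real.norm_eq_abs, abs_mul, abs_of_nonneg (kern_nonneg ha0 _)]
  have h1 := kern_le ha0 (y - x)
  have h2 := Real.abs_cos_le_one (l * (y - x))
  have h3 : (1 + (y - x) ^ 2)⁻¹ ≤ 1 := inv_le_one_of_one_le₀ (by nlinarith [sq_nonneg (y - x)])
  calc _ ≤ kern a (y - x) * 1 := by gcongr; exact kern_nonneg ha0 _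
    _ ≤ (2 * a + 4 / a) * (1 + (y - x) ^ 2)⁻¹ := by linarith
    _ ≤ (2 * a + 4 / a) * 1 := by gcongr
    _ = _ := mul_one _

lemma smoothTerm_eq (ha0 : 0 < a) (x : ℝ) (n : ℕ) :
    smoothTerm F a l x n = ∫ θ in (0:ℝ)..(a + |l|), wt a l θ *
      (Complex.exp ((-(x * θ) : ℝ) * Complex.I) * charFun F θ ^ n).re := by
  have hN0 : 0 ≤ a + |l| := by positivity
  have hcw := continuous_wt a l
  set N := a + |l|
  rw [smoothTerm]
  simp_rw [← integral_wt_cos (l := l) ha0 (le_refl N), intervalIntegral.integral_of_le hN0]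
  rw [integral_integral_swap]
  · refine setIntegral_congr_fun measurableSet_Ioc fun θ _ => ?_
    change ∫ y, wt a l θ * Real.cos (θ * (y - x)) ∂(convPow F n) = _
    have hcs : ∫ y, Real.cos (θ * (y - x)) ∂(convPow F n)
        = ∫ y, (Real.cos (-(x * θ)) * Real.cos (θ * y) - Real.sin (-(x * θ)) * Real.sin (θ * y))
          ∂(convPow F n) := by
      congr 1
      ext y
      rw [← Real.cos_add]
      congr 1
      ring
    rw [integral_const_mul, ← charFun_convPow, Complex.mul_re, charFun_re, charFun_im,
      Complex.exp_ofReal_mul_I_re, Complex.exp_ofReal_mul_I_im, hcs,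
      integral_sub ((integrable_cos _ θ).const_mul _) ((integrable_sin _ θ).const_mul _),
      integral_const_mul, integral_const_mul]
  · refine (integrable_const (2:ℝ)).mono' (Continuous.aestronglyMeasurable ?_) (ae_of_all _ fun p => ?_)
    · simp only [Function.uncurry_def]; fun_prop
    · simp only [Function.uncurry_def]
      rw [Real.norm_eq_abs, abs_mul, abs_of_nonneg (wt_nonneg _ _ _)]
      have h1 := wt_le_two ha0 l p.2
      have h2 := Real.abs_cos_le_one (p.2 * (p.1 - x))
      have := mul_le_mul h1 h2 (abs_nonneg _) two_pos.le
      linarith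

lemma hasSum_smoothTerm_mul_pow (ha0 : 0 < a) (x : ℝ) {r : ℝ} (hr0 : 0 ≤ r) (hr1 : r < 1) :
    HasSum (fun n => smoothTerm F a l x n * r ^ n)
      (∫ θ in (0:ℝ)..(a + |l|), wt a l θ * oscAbel F r x θ) := by
  have hN0 : 0 ≤ a + |l| := by positivity
  have hcw := continuous_wt a l
  have hcφ := continuous_charFun (μ := F)
  set N := a + |l|
  set f : ℕ → ℝ → ℝ := fun n θ => wt a l θ *
    (Complex.exp ((-(x * θ) : ℝ) * Complex.I) * (r * charFun F θ) ^ n).re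
  have hfb : ∀ n θ, ‖f n θ‖ ≤ 2 * r ^ n := by
    intro n θ
    simp only [f]
    rw [Real.norm_eq_abs, abs_mul, abs_of_nonneg (wt_nonneg _ _ _)]
    refine mul_le_mul (wt_le_two ha0 _ _) ((Complex.abs_re_le_norm _).trans ?_) (abs_nonneg _) two_pos.le
    rw [norm_mul, Complex.norm_exp_ofReal_mul_I, one_mul, norm_pow, norm_mul, Complex.norm_real,
      Real.norm_eq_abs, abs_of_nonneg hr0]
    refine pow_le_pow_left₀ (by positivity) ?_ n
    exact mul_le_of_le_one_right hr0 (norm_charFun_le_one θ)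
  have hfc : ∀ n, Continuous (f n) := fun n =>
    hcw.mul (Complex.continuous_re.comp (by fun_prop))
  have hfs : ∀ n, ∫ θ in (0:ℝ)..N, f n θ = smoothTerm F a l x n * r ^ n := by
    intro n
    rw [smoothTerm_eq ha0, ← intervalIntegral.integral_mul_const]
    refine intervalIntegral.integral_congr fun θ _ => ?_
    simp only [f]
    have : Complex.exp ((-(x * θ) : ℝ) * Complex.I) * (r * charFun F θ) ^ n
        = ((r ^ n : ℝ) : ℂ) * (Complex.exp ((-(x * θ) : ℝ) * Complex.I) * charFun F θ ^ n) := by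
      push_cast; ring
    rw [this, Complex.re_ofReal_mul]; ring
  simp_rw [← hfs]
  refine intervalIntegral.hasSum_integral_of_dominated_convergence (fun n _ => 2 * r ^ n)
    (fun n => (hfc n).aestronglyMeasurable) (fun n => ae_of_all _ fun θ _ => hfb n θ)
    (ae_of_all _ fun θ _ => (summable_geometric_of_lt_one hr0 hr1).mul_left 2) (by simp)
    (ae_of_all _ fun θ _ => ?_)
  have hnorm : ‖r * charFun F θ‖ < 1 := by
    rw [norm_mul, Complex.norm_real, Real.norm_eq_abs, abs_of_nonneg hr0]
    have := norm_charFun_le_one (μ := F) θ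
    nlinarith [norm_nonneg (charFun F θ)]
  have h1 := (hasSum_geometric_of_norm_lt_one hnorm).mul_left (Complex.exp ((-(x * θ) : ℝ) * Complex.I))
  exact (Complex.hasSum_re h1).mul_left (wt a l θ)

lemma tendsto_tsum_smoothTerm (hinf : ¬ Integrable (fun x : ℝ => x) F) (ha : Ha F) (hb : Hb F)
    (ha0 : 0 < a) (hN : ∀ θ ∈ Ioc 0 (a + |l|), charFun F θ ≠ 1) (x : ℝ) :
    Tendsto (fun r => ∑' n, smoothTerm F a l x n * r ^ n) (𝓝[<] 1)
      (𝓝 (∫ θ in (0:ℝ)..(a + |l|), wt a l θ * osc F 1 x θ)) := by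
  refine (tendsto_integral_oscAbel hinf ha hb (by positivity) hN (continuous_wt a l) (fun θ => ?_)
    x).congr' ?_
  · rw [abs_of_nonneg (wt_nonneg _ _ _)]; exact wt_le_two ha0 _ _
  · filter_upwards [(eventually_gt_nhds (zero_lt_one (α := ℝ))).filter_mono nhdsWithin_le_nhds,
      self_mem_nhdsWithin] with r hr0 hr1
    exact (hasSum_smoothTerm_mul_pow ha0 x hr0.le hr1).tsum_eq.symm

lemma smoothTerm_zero_nonneg (ha0 : 0 < a) (x : ℝ) (n : ℕ) : 0 ≤ smoothTerm F a 0 x n :=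
  integral_nonneg fun y => by simpa using kern_nonneg ha0 (y - x)

lemma summable_smoothTerm_zero (hinf : ¬ Integrable (fun x : ℝ => x) F) (ha : Ha F) (hb : Hb F)
    (ha0 : 0 < a) (hN : ∀ θ ∈ Ioc 0 a, charFun F θ ≠ 1) (x : ℝ) :
    Summable (smoothTerm F a 0 x) := by
  have t := tendsto_tsum_smoothTerm (l := 0) hinf ha hb ha0 (by simpa using hN) x
  refine summable_of_sum_range_le (smoothTerm_zero_nonneg ha0 x) (fun k => ?_)
    (c := ∫ θ in (0:ℝ)..(a + |(0:ℝ)|), wt a 0 θ * osc F 1 x θ)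
  have t2 : Tendsto (fun r : ℝ => ∑ n ∈ Finset.range k, smoothTerm F a 0 x n * r ^ n) (𝓝[<] 1)
      (𝓝 (∑ n ∈ Finset.range k, smoothTerm F a 0 x n * 1 ^ n)) :=
    (Continuous.tendsto (by fun_prop) 1).mono_left nhdsWithin_le_nhds
  simp only [one_pow, mul_one] at t2
  refine le_of_tendsto_of_tendsto t2 t ?_
  filter_upwards [(eventually_gt_nhds (zero_lt_one (α := ℝ))).filter_mono nhdsWithin_le_nhds,
    self_mem_nhdsWithin] with r hr0 hr1
  exact (hasSum_smoothTerm_mul_pow ha0 x hr0.le hr1).summable.sum_le_tsum _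
    fun n _ => mul_nonneg (smoothTerm_zero_nonneg ha0 x n) (pow_nonneg hr0.le n)

lemma abs_smoothTerm_le (ha0 : 0 < a) (x : ℝ) (n : ℕ) :
    |smoothTerm F a l x n| ≤ smoothTerm F a 0 x n := by
  refine abs_integral_le_integral_abs.trans (integral_mono (integrable_kern_sub_mul_cos ha0 _ x).abs
    (integrable_kern_sub_mul_cos ha0 _ x) fun y => ?_)
  simp only [zero_mul, Real.cos_zero, mul_one]
  rw [abs_mul, abs_of_nonneg (kern_nonneg ha0 _)]
  exact mul_le_of_le_one_right (kern_nonneg ha0 _) (Real.abs_cos_le_one _)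

/-- The smoothed renewal series as a Fourier integral. -/
theorem hasSum_smoothTerm (hinf : ¬ Integrable (fun x : ℝ => x) F) (ha : Ha F) (hb : Hb F)
    (ha0 : 0 < a) (hN : ∀ θ ∈ Ioc 0 (a + |l|), charFun F θ ≠ 1) (x : ℝ) :
    HasSum (smoothTerm F a l x) (∫ θ in (0:ℝ)..(a + |l|), wt a l θ * osc F 1 x θ) := by
  have hN' : ∀ θ ∈ Ioc 0 a, charFun F θ ≠ 1 := fun θ hθ =>
    hN θ ⟨hθ.1, hθ.2.trans (le_add_of_nonneg_right (abs_nonneg l))⟩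
  have hs : Summable (smoothTerm F a l x) :=
    Summable.of_norm_bounded (summable_smoothTerm_zero hinf ha hb ha0 hN' x)
      (abs_smoothTerm_le ha0 x)
  have t1 := Real.tendsto_tsum_powerSeries_nhdsWithin_lt hs.hasSum.tendsto_sum_nat
  have t2 := tendsto_tsum_smoothTerm hinf ha hb ha0 hN x
  rw [← tendsto_nhds_unique t1 t2]
  exact hs.hasSum

end

end Renewal

namespace Renewal

section

variable {a c : ℝ}

lemma charFun_half_add_map_neg (P : Measure ℝ) [IsProbabilityMeasure P] (l : ℝ) :
    charFun ((2 : ENNReal)⁻¹ • (P + P.map Neg.neg)) l = ((∫ y, Real.cos (l * y) ∂P : ℝ) : ℂ) := by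
  have hc : ∀ s : ℝ, Continuous fun y : ℝ => Complex.exp (s * y * Complex.I) := fun s => by fun_prop
  have hi : ∀ s : ℝ, Integrable (fun y : ℝ => Complex.exp (s * y * Complex.I)) P := fun s => by
    refine (integrable_const (1:ℝ)).mono' (hc s).aestronglyMeasurable (ae_of_all _ fun y => ?_)
    rw [← Complex.ofReal_mul, Complex.norm_exp_ofReal_mul_I]
  have hmap : ∫ y, Complex.exp (l * y * Complex.I) ∂(P.map Neg.neg)
      = ∫ y, Complex.exp ((-l : ℝ) * y * Complex.I) ∂P := by
    rw [integral_map measurable_neg.aemeasurable (hc l).aestronglyMeasurable]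
    simp
  have him : Integrable (fun y : ℝ => Complex.exp (l * y * Complex.I)) (P.map Neg.neg) := by
    rw [integrable_map_measure (hc l).aestronglyMeasurable measurable_neg.aemeasurable]
    refine (hi (-l)).congr (ae_of_all _ fun y => ?_)
    simp
  rw [charFun_apply_real, integral_smul_measure, integral_add_measure (hi l) him, hmap,
    ← integral_add (hi l) (hi (-l)), ← integral_smul, ← integral_complex_ofReal]
  congr 1
  ext y
  have h1 : (l : ℂ) * y * Complex.I = ((l * y : ℝ) : ℂ) * Complex.I := by push_cast; ring
  have h2 : ((-l : ℝ) : ℂ) * y * Complex.I = ((-(l * y) : ℝ) : ℂ) * Complex.I := by push_cast; ring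
  rw [h1, h2]
  apply Complex.ext
  · rw [Complex.smul_re, Complex.add_re, Complex.exp_ofReal_mul_I_re, Complex.exp_ofReal_mul_I_re,
      Real.cos_neg, Complex.ofReal_re]
    simp
    ring
  · rw [Complex.smul_im, Complex.add_im, Complex.exp_ofReal_mul_I_im, Complex.exp_ofReal_mul_I_im,
      Real.sin_neg, Complex.ofReal_im]
    simp

lemma isProbabilityMeasure_half_add_map_neg (P : Measure ℝ) [IsProbabilityMeasure P] :
    IsProbabilityMeasure ((2 : ENNReal)⁻¹ • (P + P.map Neg.neg)) := by
  have := Measure.isProbabilityMeasure_map (μ := P) (measurable_neg (G := ℝ)).aemeasurable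
  refine ⟨?_⟩
  rw [Measure.smul_apply, Measure.add_apply, measure_univ, measure_univ, smul_eq_mul, one_add_one_eq_two]
  exact ENNReal.inv_mul_cancel (by simp) (by simp)

/-- The probability measure with density `kern a / (2 π)`. -/
noncomputable def kernMeasure (a : ℝ) : Measure ℝ :=
  volume.withDensity fun y => ENNReal.ofReal ((2 * Real.pi)⁻¹ * kern a y)

lemma integral_kernMeasure {E : Type*} [NormedAddCommGroup E] [NormedSpace ℝ E] (ha0 : 0 < a)
    (g : ℝ → E) : ∫ y, g y ∂(kernMeasure a) = ∫ y, ((2 * Real.pi)⁻¹ * kern a y) • g y := by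
  have hk := continuous_kern a
  rw [kernMeasure, integral_withDensity_eq_integral_toReal_smul (by fun_prop) (by simp)]
  refine integral_congr_ae (ae_of_all _ fun y => ?_)
  simp only
  rw [ENNReal.toReal_ofReal (mul_nonneg (by positivity) (kern_nonneg ha0 y))]

lemma isProbabilityMeasure_kernMeasure (ha0 : 0 < a) : IsProbabilityMeasure (kernMeasure a) := by
  refine ⟨?_⟩
  rw [kernMeasure, withDensity_apply _ MeasurableSet.univ, setLIntegral_univ,
    ← ofReal_integral_eq_lintegral_ofReal ((integrable_kern ha0).const_mul _)
      (ae_of_all _ fun y => mul_nonneg (by positivity) (kern_nonneg ha0 y)),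
    integral_const_mul, integral_kern ha0, inv_mul_cancel₀ (by positivity), ENNReal.ofReal_one]

lemma charFun_kernMeasure (ha0 : 0 < a) (l : ℝ) : charFun (kernMeasure a) l = tri a l := by
  rw [charFun_apply_real, integral_kernMeasure ha0]
  have h := integral_kern_exp ha0 l
  have : ∀ y : ℝ, ((2 * Real.pi)⁻¹ * kern a y) • Complex.exp (l * y * Complex.I)
      = ((2 * Real.pi : ℝ) : ℂ)⁻¹ * (Complex.exp (l * y * Complex.I) * (kern a y : ℂ)) := by
    intro y
    rw [Complex.real_smul]
    push_cast
    ring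
  simp_rw [this]
  rw [integral_const_mul, h]
  have hpi : (Real.pi : ℂ) ≠ 0 := by exact_mod_cast Real.pi_ne_zero
  push_cast
  field_simp

lemma tendsto_integral_of_tendsto_integral_cos (ha0 : 0 < a) {P : ℕ → Measure ℝ}
    [∀ n, IsProbabilityMeasure (P n)]
    (hP : ∀ l, Tendsto (fun n => ∫ y, Real.cos (l * y) ∂(P n)) atTop (𝓝 (tri a l)))
    {g : ℝ → ℝ} (hg : Continuous g) {C : ℝ} (hC : ∀ y, |g y| ≤ C) (heven : ∀ y, g (-y) = g y) :
    Tendsto (fun n => ∫ y, g y ∂(P n)) atTop (𝓝 (∫ y, g y ∂(kernMeasure a))) := by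
  have hQp : ∀ n, IsProbabilityMeasure ((2 : ENNReal)⁻¹ • (P n + (P n).map Neg.neg)) :=
    fun n => isProbabilityMeasure_half_add_map_neg (P n)
  have hkp := isProbabilityMeasure_kernMeasure ha0
  set Q : ℕ → ProbabilityMeasure ℝ := fun n => ⟨_, hQp n⟩
  set K : ProbabilityMeasure ℝ := ⟨kernMeasure a, hkp⟩
  have hlim : Tendsto Q atTop (𝓝 K) := by
    refine ProbabilityMeasure.tendsto_iff_tendsto_charFun.2 fun l => ?_
    change Tendsto (fun n => charFun ((2 : ENNReal)⁻¹ • (P n + (P n).map Neg.neg)) l) atTop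
      (𝓝 (charFun (kernMeasure a) l))
    rw [charFun_kernMeasure ha0]
    simp_rw [charFun_half_add_map_neg]
    exact (Complex.continuous_ofReal.tendsto _).comp (hP l)
  have h1 := (ProbabilityMeasure.tendsto_iff_forall_integral_tendsto.1 hlim)
    (BoundedContinuousFunction.ofNormedAddCommGroup g hg C hC)
  refine h1.congr fun n => ?_
  change ∫ y, g y ∂((2 : ENNReal)⁻¹ • (P n + (P n).map Neg.neg)) = _
  have hi : Integrable g (P n) :=
    (integrable_const C).mono' hg.aestronglyMeasurable (ae_of_all _ hC)
  have him : Integrable g ((P n).map Neg.neg) := by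
    rw [integrable_map_measure hg.aestronglyMeasurable measurable_neg.aemeasurable]
    refine hi.congr (ae_of_all _ fun y => (heven y).symm)
  rw [integral_smul_measure, integral_add_measure hi him,
    integral_map measurable_neg.aemeasurable hg.aestronglyMeasurable]
  simp_rw [heven]
  simp
  ring

lemma tendsto_mul_integral_of_tendsto_mul_integral_cos (ha0 : 0 < a) {G : ℕ → Measure ℝ}
    [∀ n, IsFiniteMeasure (G n)] {w : ℕ → ℝ}
    (hG : ∀ l, Tendsto (fun n => w n * ∫ y, Real.cos (l * y) ∂(G n)) atTop (𝓝 (c * tri a l)))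
    {g : ℝ → ℝ} (hg : Continuous g) {C : ℝ} (hC : ∀ y, |g y| ≤ C) (heven : ∀ y, g (-y) = g y) :
    Tendsto (fun n => w n * ∫ y, g y ∂(G n)) atTop (𝓝 (c * ∫ y, g y ∂(kernMeasure a))) := by
  have hmass : Tendsto (fun n => w n * (G n).real univ) atTop (𝓝 c) := by
    simpa [tri_zero] using hG 0
  rcases eq_or_ne c 0 with rfl | hc
  · rw [zero_mul]
    refine squeeze_zero_norm (fun n => ?_) (by simpa using hmass.abs.mul_const C)
    rw [norm_mul, Real.norm_eq_abs, mul_assoc (|w n|), abs_of_nonneg (measureReal_nonneg (μ := G n) (s := univ))]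
    refine mul_le_mul_of_nonneg_left ?_ (abs_nonneg _)
    rw [mul_comm]
    exact norm_integral_le_of_norm_le_const (ae_of_all _ hC)
  classical
  set P : ℕ → Measure ℝ := fun n => if G n univ = 0 then Measure.dirac 0 else (G n univ)⁻¹ • G n with hPdef
  have hPp : ∀ n, IsProbabilityMeasure (P n) := by
    intro n
    simp only [hPdef]
    split_ifs with h
    · infer_instance
    · refine ⟨?_⟩
      rw [Measure.smul_apply, smul_eq_mul, ENNReal.inv_mul_cancel h (measure_ne_top _ _)]
  have hne := hmass.eventually_ne hc
  have hint : ∀ f : ℝ → ℝ, ∀ᶠ n in atTop,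
      (w n * (G n).real univ) * ∫ y, f y ∂(P n) = w n * ∫ y, f y ∂(G n) := by
    intro f
    filter_upwards [hne] with n hn
    have h0 : (G n).real univ ≠ 0 := right_ne_zero_of_mul hn
    have h0' : G n univ ≠ 0 := fun h => h0 (by simp [Measure.real, h])
    simp only [hPdef, if_neg h0']
    rw [integral_smul_measure, ENNReal.toReal_inv, smul_eq_mul]
    change _ * (((G n).real univ)⁻¹ * _) = _
    field_simp
  have hPc : ∀ l, Tendsto (fun n => ∫ y, Real.cos (l * y) ∂(P n)) atTop (𝓝 (tri a l)) := by
    intro l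
    have h1 := (hG l).div hmass hc
    rw [mul_div_cancel_left₀ _ hc] at h1
    refine h1.congr' ?_
    filter_upwards [hint (fun y => Real.cos (l * y)), hne] with n h2 h3
    rw [Pi.div_apply, ← h2, mul_div_cancel_left₀ _ h3]
  exact (hmass.mul (tendsto_integral_of_tendsto_integral_cos ha0 hPc hg hC heven)).congr' (hint g)

end

variable {F : Measure ℝ} [IsProbabilityMeasure F]

lemma charFun_ne_one (hF : ¬ Arithmetic F) {θ : ℝ} (hθ : 0 < θ) : charFun F θ ≠ 1 := by
  intro h
  apply hF
  have h1 := one_sub_charFun_re F θ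
  rw [h, sub_self, Complex.zero_re] at h1
  have h2 := (integral_eq_zero_iff_of_nonneg (μ := F) (f := fun x => 1 - Real.cos (θ * x))
    (fun x => sub_nonneg.2 (Real.cos_le_one _)) ((integrable_const 1).sub (integrable_cos F θ))).1 h1.symm
  refine ⟨2 * Real.pi / θ, by positivity, ?_⟩
  filter_upwards [h2] with x hx
  obtain ⟨k, hk⟩ := (Real.cos_eq_one_iff (θ * x)).1 (by simp only [Pi.zero_apply] at hx; linarith)
  refine ⟨k, ?_⟩
  rw [div_div_eq_mul_div, mul_comm x θ, ← hk]
  field_simp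

lemma exists_forall_charFun_ne_one (ha : Ha F) (hA : Tendsto (A F) atTop atTop) :
    ∃ δ > 0, ∀ θ ∈ Ioo 0 δ, charFun F θ ≠ 1 := by
  obtain ⟨δ, hδ, h⟩ := exists_le_norm_one_sub_charFun ha hA 1
  refine ⟨δ, hδ, fun θ hθ h1 => ?_⟩
  have := h θ hθ
  rw [h1, sub_self, norm_zero, one_mul] at this
  exact absurd hθ.1 (not_lt.2 this)

section

variable {a l : ℝ}

lemma integrable_kern_mul_cos_U (hinf : ¬ Integrable (fun x : ℝ => x) F) (ha : Ha F) (hb : Hb F)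
    (ha0 : 0 < a) (hN : ∀ θ ∈ Ioc 0 a, charFun F θ ≠ 1) (x : ℝ) :
    Integrable (fun y => kern a (y - x) * Real.cos (l * (y - x))) (U F) := by
  refine integrable_sum_measure (fun n => integrable_kern_sub_mul_cos ha0 _ x) ?_
  refine Summable.of_nonneg_of_le (fun n => integral_nonneg fun y => norm_nonneg _) (fun n => ?_)
    (summable_smoothTerm_zero hinf ha hb ha0 hN x)
  refine integral_mono (integrable_kern_sub_mul_cos ha0 _ x).norm
    (integrable_kern_sub_mul_cos ha0 _ x) fun y => ?_
  simp only [norm_mul, zero_mul, Real.cos_zero]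
  rw [Real.norm_of_nonneg (kern_nonneg ha0 _)]
  exact mul_le_mul_of_nonneg_left (Real.abs_cos_le_one _) (kern_nonneg ha0 _)

lemma integrable_kern_U (hinf : ¬ Integrable (fun x : ℝ => x) F) (ha : Ha F) (hb : Hb F)
    (ha0 : 0 < a) (hN : ∀ θ ∈ Ioc 0 a, charFun F θ ≠ 1) (x : ℝ) :
    Integrable (fun y => kern a (y - x)) (U F) := by
  simpa using integrable_kern_mul_cos_U (l := 0) hinf ha hb ha0 hN x

lemma integral_kern_mul_cos_U (hinf : ¬ Integrable (fun x : ℝ => x) F) (ha : Ha F) (hb : Hb F)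
    (ha0 : 0 < a) (hN : ∀ θ ∈ Ioc 0 (a + |l|), charFun F θ ≠ 1) (x : ℝ) :
    ∫ y, kern a (y - x) * Real.cos (l * (y - x)) ∂(U F)
      = ∫ θ in (0:ℝ)..(a + |l|), wt a l θ * osc F 1 x θ := by
  have hi := integrable_kern_mul_cos_U (l := l) hinf ha hb ha0
    (fun θ hθ => hN θ ⟨hθ.1, hθ.2.trans (by linarith [abs_nonneg l])⟩) x
  exact (hasSum_integral_measure hi).unique (hasSum_smoothTerm hinf ha hb ha0 hN x)

lemma exists_le_kern (ha0 : 0 < a) {y : ℝ} (hy : 0 < y) (hay : a * y < 2 * Real.pi) :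
    ∃ c > 0, ∀ z, |z| ≤ y → c ≤ kern a z := by
  obtain ⟨z₀, hz₀, hmin⟩ := (isCompact_Icc (a := -y) (b := y)).exists_isMinOn
    ⟨0, by constructor <;> linarith⟩ (continuous_kern a).continuousOn
  refine ⟨kern a z₀, kern_pos ha0 ?_, fun z hz => hmin (abs_le.1 hz)⟩
  have : |z₀| ≤ y := abs_le.2 hz₀
  nlinarith

lemma U_lt_top_of_isBounded (hinf : ¬ Integrable (fun x : ℝ => x) F) (ha : Ha F) (hb : Hb F)
    (x : ℝ) {y : ℝ} (hy : 0 < y) : U F (Icc (x - y) (x + y)) < ⊤ := by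
  obtain ⟨δ, hδ, h⟩ := exists_forall_charFun_ne_one ha (tendsto_A hinf ha hb)
  set a := min (δ / 2) (Real.pi / y)
  have hpi := Real.pi_pos
  have ha0 : 0 < a := by positivity
  have hay : a * y < 2 * Real.pi := by
    have : a * y ≤ Real.pi / y * y := mul_le_mul_of_nonneg_right (min_le_right _ _) hy.le
    rw [div_mul_cancel₀ _ hy.ne'] at this
    linarith
  obtain ⟨c, hc, hck⟩ := exists_le_kern ha0 hy hay
  have hi := integrable_kern_U hinf ha hb ha0 (fun θ hθ => h θ ⟨hθ.1, by
    have := min_le_left (δ / 2) (Real.pi / y)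
    have := hθ.2
    linarith⟩) x
  refine (measure_mono fun z hz => ?_).trans_lt (hi.measure_norm_ge_lt_top hc)
  have h1 := hck (z - x) (abs_le.2 ⟨by linarith [hz.1], by linarith [hz.2]⟩)
  exact h1.trans (le_abs_self _)

theorem transient (hinf : ¬ Integrable (fun x : ℝ => x) F) (ha : Ha F) (hb : Hb F) :
    Transient F := fun y hy => by
  simpa using U_lt_top_of_isBounded hinf ha hb 0 hy

variable {κ s : ℝ}

lemma tendsto_m_mul_integral_kern_U (hinf : ¬ Integrable (fun x : ℝ => x) F) (ha : Ha F) (hb : Hb F)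
    (hκ : Tendsto (fun x => m F x / A F x) atTop (𝓝 κ)) (hF : ¬ Arithmetic F)
    (ha0 : 0 < a) (hs : s = 1 ∨ s = -1) :
    Tendsto (fun x => m F x * ∫ y, kern a (y - s * x) * Real.cos (l * (y - s * x)) ∂(U F)) atTop
      (𝓝 (Real.pi * (1 + s * κ) * tri a l)) := by
  have h := tendsto_m_mul_integral_osc (l := l) hinf ha hb hκ ha0
    (fun θ hθ => charFun_ne_one hF hθ.1) hs
  rw [wt_zero, show 2 * tri a l * (Real.pi / 2) * (1 + s * κ) = Real.pi * (1 + s * κ) * tri a l by ring] at h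
  refine h.congr fun x => ?_
  rw [integral_kern_mul_cos_U hinf ha hb ha0 fun θ hθ => charFun_ne_one hF hθ.1]
  congr 2
  ext θ
  rcases hs with rfl | rfl <;> simp [osc]

end

end Renewal

namespace Renewal

/-- The even trapezoid equal to `1` on `[-b, b]` and to `0` outside `[-(b + δ), b + δ]`. -/
noncomputable def trap (b δ y : ℝ) : ℝ := max 0 (min 1 ((b + δ - |y|) / δ))

section

variable {b δ : ℝ}

lemma continuous_trap (b δ : ℝ) : Continuous (trap b δ) := by unfold trap; fun_prop

lemma trap_nonneg (b δ y : ℝ) : 0 ≤ trap b δ y := le_max_left _ _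

lemma trap_le_one (b δ y : ℝ) : trap b δ y ≤ 1 := max_le zero_le_one (min_le_left _ _)

lemma trap_neg (b δ y : ℝ) : trap b δ (-y) = trap b δ y := by simp [trap]

lemma trap_eq_one (hδ : 0 < δ) {y : ℝ} (hy : |y| ≤ b) : trap b δ y = 1 := by
  have : 1 ≤ (b + δ - |y|) / δ := by rw [le_div_iff₀ hδ]; linarith
  rw [trap, min_eq_left this, max_eq_right zero_le_one]

lemma trap_eq_zero (hδ : 0 < δ) {y : ℝ} (hy : b + δ ≤ |y|) : trap b δ y = 0 := by
  have : (b + δ - |y|) / δ ≤ 0 := div_nonpos_of_nonpos_of_nonneg (by linarith) hδ.le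
  rw [trap, max_eq_left ((min_le_right _ _).trans this)]

variable (μ : Measure ℝ) [IsFiniteMeasureOnCompacts μ]

lemma trap_sub_le_indicator (hδ : 0 < δ) (z y : ℝ) :
    trap b δ (y - z) ≤ (Ioo (z - (b + δ)) (z + (b + δ))).indicator 1 y := by
  by_cases hy : y ∈ Ioo (z - (b + δ)) (z + (b + δ))
  · rw [indicator_of_mem hy]; exact trap_le_one _ _ _
  · rw [indicator_of_notMem hy, trap_eq_zero hδ]
    by_contra! h
    rw [abs_lt] at h
    exact hy ⟨by linarith [h.1], by linarith [h.2]⟩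

lemma integrable_trap_sub (hδ : 0 < δ) (z : ℝ) : Integrable (fun y => trap b δ (y - z)) μ := by
  have hf : μ (Ioo (z - (b + δ)) (z + (b + δ))) < ⊤ :=
    (measure_mono Ioo_subset_Icc_self).trans_lt isCompact_Icc.measure_lt_top
  refine ((integrable_indicator_iff measurableSet_Ioo).2
    (integrableOn_const (C := (1:ℝ)) hf.ne)).mono'
    ((continuous_trap b δ).comp (continuous_sub_right z)).aestronglyMeasurable
    (ae_of_all _ fun y => ?_)
  rw [Real.norm_of_nonneg (trap_nonneg _ _ _)]
  exact trap_sub_le_indicator hδ z y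

lemma integral_trap_sub_le (hδ : 0 < δ) (z : ℝ) :
    ∫ y, trap b δ (y - z) ∂μ ≤ μ.real (Ioo (z - (b + δ)) (z + (b + δ))) := by
  have hf : μ (Ioo (z - (b + δ)) (z + (b + δ))) < ⊤ :=
    (measure_mono Ioo_subset_Icc_self).trans_lt isCompact_Icc.measure_lt_top
  rw [← integral_indicator_one measurableSet_Ioo]
  exact integral_mono (integrable_trap_sub μ hδ z) ((integrable_indicator_iff measurableSet_Ioo).2
    (integrableOn_const (C := (1:ℝ)) hf.ne)) (trap_sub_le_indicator hδ z)

lemma le_integral_trap_sub (hδ : 0 < δ) (z : ℝ) :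
    μ.real (Icc (z - b) (z + b)) ≤ ∫ y, trap b δ (y - z) ∂μ := by
  rw [← integral_indicator_one measurableSet_Icc]
  refine integral_mono ((integrable_indicator_iff measurableSet_Icc).2
    (integrableOn_const (C := (1:ℝ)) isCompact_Icc.measure_lt_top.ne)) (integrable_trap_sub μ hδ z)
    fun y => ?_
  by_cases hy : y ∈ Icc (z - b) (z + b)
  · rw [indicator_of_mem hy]
    change 1 ≤ trap b δ (y - z)
    rw [trap_eq_one hδ (abs_le.2 ⟨by linarith [hy.1], by linarith [hy.2]⟩)]
  · rw [indicator_of_notMem hy]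
    exact trap_nonneg _ _ _

end

variable {F : Measure ℝ} [IsProbabilityMeasure F]

section

variable {κ s : ℝ}

lemma isFiniteMeasureOnCompacts_U (hinf : ¬ Integrable (fun x : ℝ => x) F) (ha : Ha F) (hb : Hb F) :
    IsFiniteMeasureOnCompacts (U F) := by
  refine ⟨fun K hK => ?_⟩
  obtain ⟨r, hr⟩ := hK.isBounded.subset_closedBall 0
  rw [Real.closedBall_eq_Icc] at hr
  refine (measure_mono (hr.trans (Icc_subset_Icc ?_ ?_))).trans_lt
    (U_lt_top_of_isBounded hinf ha hb 0 (y := |r| + 1) (by positivity))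
  · linarith [le_abs_self r]
  · linarith [le_abs_self r]

lemma tendsto_m_mul_integral_U (hinf : ¬ Integrable (fun x : ℝ => x) F) (ha : Ha F) (hb : Hb F)
    (hκ : Tendsto (fun x => m F x / A F x) atTop (𝓝 κ)) (hF : ¬ Arithmetic F)
    (hs : s = 1 ∨ s = -1) {f : ℝ → ℝ} (hf : Continuous f) {C : ℝ} (hC : ∀ y, |f y| ≤ C)
    (heven : ∀ y, f (-y) = f y) {R : ℝ} (hR : 0 < R) (hsupp : ∀ y, R ≤ |y| → f y = 0) :
    Tendsto (fun x => m F x * ∫ y, f (y - s * x) ∂(U F)) atTop (𝓝 ((1 + s * κ) / 2 * ∫ y, f y)) := by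
  have hpi := Real.pi_pos
  set a := Real.pi / R
  have ha0 : 0 < a := by positivity
  obtain ⟨c, hc, hck⟩ := exists_le_kern ha0 hR
    (by rw [div_mul_cancel₀ _ hR.ne']; linarith : a * R < 2 * Real.pi)
  have hk := continuous_kern a
  have hmax : ∀ y, 0 < max (kern a y) c := fun y => hc.trans_le (le_max_right _ _)
  set g : ℝ → ℝ := fun y => f y / max (kern a y) c
  have hg : Continuous g := hf.div (by fun_prop) fun y => (hmax y).ne'
  have hkg : ∀ y, kern a y * g y = f y := by
    intro y
    rcases le_or_gt R |y| with h | h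
    · simp only [g, hsupp y h]; ring
    · simp only [g]
      rw [max_eq_left (hck y h.le)]
      field_simp [(hc.trans_le (hck y h.le)).ne']
  have hgC : ∀ y, |g y| ≤ C / c := by
    intro y
    simp only [g]
    rw [abs_div, abs_of_pos (hmax y)]
    exact div_le_div₀ ((abs_nonneg _).trans (hC y)) (hC y) hc (le_max_right _ _)
  have hge : ∀ y, g (-y) = g y := fun y => by simp only [g, heven, kern_neg]
  set G : ℝ → Measure ℝ := fun x =>
    ((U F).withDensity (fun y => ENNReal.ofReal (kern a (y - s * x)))).map (fun y => y - s * x) with hG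
  have hne : ∀ θ ∈ Ioc 0 a, charFun F θ ≠ 1 := fun θ hθ => charFun_ne_one hF hθ.1
  have hGf : ∀ x, IsFiniteMeasure (G x) := by
    intro x
    have := isFiniteMeasure_withDensity_ofReal (integrable_kern_U hinf ha hb ha0 hne (s * x)).2
    exact Measure.isFiniteMeasure_map _ _
  have hGi : ∀ x, ∀ q : ℝ → ℝ, Continuous q →
      ∫ y, q y ∂(G x) = ∫ y, kern a (y - s * x) * q (y - s * x) ∂(U F) := by
    intro x q hq
    rw [hG, integral_map (by fun_prop) hq.aestronglyMeasurable,
      integral_withDensity_eq_integral_toReal_smul (by fun_prop) (by simp)]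
    refine integral_congr_ae (ae_of_all _ fun y => ?_)
    simp only
    rw [ENNReal.toReal_ofReal (kern_nonneg ha0 _), smul_eq_mul]
  refine tendsto_of_seq_tendsto fun x hx => ?_
  have key := tendsto_mul_integral_of_tendsto_mul_integral_cos ha0 (G := fun n => G (x n))
    (w := fun n => m F (x n)) (c := Real.pi * (1 + s * κ)) (g := g) (fun l => ?_) hg hgC hge
  · have e1 : ∫ y, g y ∂(kernMeasure a) = (2 * Real.pi)⁻¹ * ∫ y, f y := by
      rw [integral_kernMeasure ha0, ← integral_const_mul]
      simp_rw [smul_eq_mul, mul_assoc, hkg]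
    rw [e1, show Real.pi * (1 + s * κ) * ((2 * Real.pi)⁻¹ * ∫ y, f y) = (1 + s * κ) / 2 * ∫ y, f y by
      field_simp] at key
    refine key.congr fun n => ?_
    rw [hGi _ g hg]
    simp_rw [hkg]
    rfl
  · refine ((tendsto_m_mul_integral_kern_U (l := l) hinf ha hb hκ hF ha0 hs).comp hx).congr fun n => ?_
    rw [hGi _ _ (by fun_prop)]
    rfl

lemma tendsto_m_mul_U_Ioc (hinf : ¬ Integrable (fun x : ℝ => x) F) (ha : Ha F) (hb : Hb F)
    (hκ : Tendsto (fun x => m F x / A F x) atTop (𝓝 κ)) (hF : ¬ Arithmetic F)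
    (hs : s = 1 ∨ s = -1) {b : ℝ} (hb0 : 0 < b) :
    Tendsto (fun x => m F x * (U F).real (Ioc (s * x - b) (s * x + b))) atTop
      (𝓝 ((1 + s * κ) / 2 * (2 * b))) := by
  have hU := isFiniteMeasureOnCompacts_U hinf ha hb
  set c := (1 + s * κ) / 2
  have hlim : ∀ {b δ : ℝ}, 0 ≤ b → 0 < δ →
      Tendsto (fun x => m F x * ∫ y, trap b δ (y - s * x) ∂(U F)) atTop (𝓝 (c * ∫ y, trap b δ y)) :=
    fun hb0 hδ => tendsto_m_mul_integral_U hinf ha hb hκ hF hs (continuous_trap _ _)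
      (fun y => abs_le.2 ⟨neg_one_lt_zero.le.trans (trap_nonneg _ _ y), trap_le_one _ _ y⟩) (trap_neg _ _)
      (by positivity) (fun y hy => trap_eq_zero hδ hy)
  have hmpos := eventually_m_pos hinf ha hb
  have hI1 : 0 < ∫ y, trap b 1 y := by
    have := le_integral_trap_sub (b := b) volume one_pos 0
    simp only [sub_zero, zero_add, zero_sub, Real.volume_real_Icc] at this
    refine lt_of_lt_of_le ?_ this
    exact lt_max_of_lt_left (by linarith)
  have hc : 0 ≤ c := by
    have : 0 ≤ c * ∫ y, trap b 1 y := by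
      refine ge_of_tendsto (hlim hb0.le one_pos) ?_
      filter_upwards [hmpos] with x hx
      exact mul_nonneg hx.le (integral_nonneg fun y => trap_nonneg _ _ _)
    exact nonneg_of_mul_nonneg_left this hI1
  refine tendsto_order.2 ⟨fun v hv => ?_, fun v hv => ?_⟩
  · obtain ⟨δ, ⟨hδ, hδb⟩, hδv⟩ : ∃ δ, (0 < δ ∧ δ < b) ∧ v < c * (2 * (b - δ)) := by
      have h1 : ∀ᶠ δ in 𝓝[>] (0:ℝ), v < c * (2 * (b - δ)) :=
        (Continuous.tendsto' (by fun_prop) 0 _ (by simp) : Tendsto (fun δ : ℝ => c * (2 * (b - δ)))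
          (𝓝 0) (𝓝 (c * (2 * b)))).eventually_const_lt hv |>.filter_mono nhdsWithin_le_nhds
      exact (Filter.Eventually.and (Ioo_mem_nhdsGT hb0) h1).exists
    have h2 : 2 * (b - δ) ≤ ∫ y, trap (b - δ) δ y := by
      have := le_integral_trap_sub (b := b - δ) volume hδ 0
      simp only [sub_zero, zero_add, zero_sub, Real.volume_real_Icc] at this
      exact (le_max_left _ _).trans' (by linarith) |>.trans this
    have h3 := (hlim (b := b - δ) (by linarith) hδ).eventually_const_lt
      (hδv.trans_le (mul_le_mul_of_nonneg_left h2 hc))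
    filter_upwards [h3, hmpos] with x hx hm
    refine hx.trans_le (mul_le_mul_of_nonneg_left ?_ hm.le)
    refine (integral_trap_sub_le (U F) hδ (s * x)).trans ?_
    rw [sub_add_cancel]
    exact measureReal_mono Ioo_subset_Ioc_self
      ((measure_mono Ioc_subset_Icc_self).trans_lt isCompact_Icc.measure_lt_top).ne
  · obtain ⟨δ, hδ, hδv⟩ : ∃ δ, 0 < δ ∧ c * (2 * (b + δ)) < v := by
      have h1 : ∀ᶠ δ in 𝓝[>] (0:ℝ), c * (2 * (b + δ)) < v :=
        (Continuous.tendsto' (by fun_prop) 0 _ (by simp) : Tendsto (fun δ : ℝ => c * (2 * (b + δ)))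
          (𝓝 0) (𝓝 (c * (2 * b)))).eventually_lt_const hv |>.filter_mono nhdsWithin_le_nhds
      obtain ⟨δ, h2, h3⟩ := (Filter.Eventually.and (Ioo_mem_nhdsGT hb0) h1).exists
      exact ⟨δ, h2.1, h3⟩
    have h2 : ∫ y, trap b δ y ≤ 2 * (b + δ) := by
      have := integral_trap_sub_le (b := b) volume hδ 0
      simp only [sub_zero, zero_add, zero_sub, Real.volume_real_Ioo] at this
      refine this.trans (max_le (by linarith) (by linarith))
    have h3 := (hlim hb0.le hδ).eventually_lt_const ((mul_le_mul_of_nonneg_left h2 hc).trans_lt hδv)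
    filter_upwards [h3, hmpos] with x hx hm
    refine lt_of_le_of_lt (mul_le_mul_of_nonneg_left ?_ hm.le) hx
    refine le_trans ?_ (le_integral_trap_sub (U F) hδ (s * x))
    exact measureReal_mono Ioc_subset_Icc_self isCompact_Icc.measure_lt_top.ne

end

/-- `m` is asymptotically invariant under translations. -/
lemma tendsto_m_add_div_m_of_nonneg (hinf : ¬ Integrable (fun x : ℝ => x) F) (ha : Ha F) (hb : Hb F)
    {t : ℝ} (ht : 0 ≤ t) : Tendsto (fun x => m F (x + t) / m F x) atTop (𝓝 1) := by
  obtain ⟨x₁, hx₁, hp, hi⟩ := hb.integrableOn ha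
  have hq : ∀ u, 0 ≤ H F u / A F u ^ 2 := fun u => div_nonneg (H_nonneg F u) (sq_nonneg _)
  obtain ⟨x₂, hx₂⟩ := eventually_atTop.1 ((eventually_inv_A_le hinf ha hb).and
    ((ha.eventually_bound one_pos).and (eventually_m_pos hinf ha hb)))
  have hlow : ∀ᶠ x in atTop, 1 - t / x ≤ m F x / m F (x + t) ∧ m F x / m F (x + t) ≤ 1 := by
    filter_upwards [eventually_ge_atTop x₁, eventually_ge_atTop x₂] with x h1 h2
    have hx0 : 0 < x := hx₁.trans_le h1
    have hix := hi.mono_set (Ioi_subset_Ioi h1)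
    have hmx := (hx₂ x h2).2.2
    have hmxt := (hx₂ (x + t) (by linarith)).2.2
    have hsplit : (m F x)⁻¹ = (∫ u in Ioc x (x + t), H F u / A F u ^ 2) + (m F (x + t))⁻¹ := by
      rw [m, m, inv_inv, inv_inv, ← Ioc_union_Ioi_eq_Ioi (by linarith : x ≤ x + t)]
      exact setIntegral_union (Ioc_disjoint_Ioi le_rfl) measurableSet_Ioi
        (hix.mono_set Ioc_subset_Ioi_self) (hix.mono_set (Ioi_subset_Ioi (by linarith)))
    have hnn : 0 ≤ ∫ u in Ioc x (x + t), H F u / A F u ^ 2 := integral_nonneg fun u => hq u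
    have hle : ∫ u in Ioc x (x + t), H F u / A F u ^ 2 ≤ t * ((m F x)⁻¹ / x) := by
      have : ∫ u in Ioc x (x + t), H F u / A F u ^ 2 ≤ ∫ u in Ioc x (x + t), (m F x)⁻¹ / x := by
        refine setIntegral_mono_on (hix.mono_set Ioc_subset_Ioi_self) (integrableOn_const (by simp))
          measurableSet_Ioc fun u hu => ?_
        obtain ⟨b1, ⟨b2, b3⟩, b4⟩ := hx₂ u (h2.trans hu.1.le)
        have hu0 : 0 < u := hx0.trans hu.1
        have b5 : (m F u)⁻¹ ≤ (m F x)⁻¹ := by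
          rw [m, m, inv_inv, inv_inv]
          exact setIntegral_mono_set hix (ae_of_all _ hq) (Ioi_subset_Ioi hu.1.le).eventuallyLE
        calc H F u / A F u ^ 2 = (u * H F u) / (u * A F u) * (A F u)⁻¹ := by field_simp
          _ ≤ (1 * A F u) / (u * A F u) * (m F x)⁻¹ := by
              have b6 := b1.trans b5
              gcongr ?_ / _ * ?_
          _ = (m F x)⁻¹ / u := by field_simp
          _ ≤ (m F x)⁻¹ / x := by
              have := hu.1.le
              gcongr
      simpa [ht] using this
    have e : m F x / m F (x + t) = 1 - m F x * ∫ u in Ioc x (x + t), H F u / A F u ^ 2 := by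
      rw [div_eq_mul_inv, ← sub_eq_iff_eq_add'.2 hsplit, mul_sub, mul_inv_cancel₀ hmx.ne']
    rw [e]
    refine ⟨?_, by nlinarith⟩
    have : m F x * ∫ u in Ioc x (x + t), H F u / A F u ^ 2 ≤ m F x * (t * ((m F x)⁻¹ / x)) :=
      mul_le_mul_of_nonneg_left hle hmx.le
    rw [show m F x * (t * ((m F x)⁻¹ / x)) = t / x by field_simp] at this
    linarith
  have hl : Tendsto (fun x : ℝ => 1 - t / x) atTop (𝓝 1) := by
    simpa using (tendsto_const_nhds (x := t).div_atTop tendsto_id).const_sub 1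
  have h := tendsto_of_tendsto_of_tendsto_of_le_of_le' hl tendsto_const_nhds
    (hlow.mono fun x h => h.1) (hlow.mono fun x h => h.2)
  simpa [inv_div] using h.inv₀ one_ne_zero

lemma tendsto_m_add_div_m (hinf : ¬ Integrable (fun x : ℝ => x) F) (ha : Ha F) (hb : Hb F)
    (t : ℝ) : Tendsto (fun x => m F (x + t) / m F x) atTop (𝓝 1) := by
  rcases le_total 0 t with ht | ht
  · exact tendsto_m_add_div_m_of_nonneg hinf ha hb ht
  · have h := ((tendsto_m_add_div_m_of_nonneg hinf ha hb (neg_nonneg.2 ht)).comp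
      (tendsto_atTop_add_const_right _ t tendsto_id)).inv₀ one_ne_zero
    simpa [Function.comp_def, inv_div] using h

lemma tendsto_m_add_mul_U_Ioc (hinf : ¬ Integrable (fun x : ℝ => x) F) (ha : Ha F) (hb : Hb F) {κ s : ℝ}
    (hκ : Tendsto (fun x => m F x / A F x) atTop (𝓝 κ)) (hF : ¬ Arithmetic F)
    (hs : s = 1 ∨ s = -1) {h : ℝ} (hh : 0 < h) (t : ℝ) :
    Tendsto (fun x => m F (x + t) * ((U F (Ioc (s * x - h / 2) (s * x + h / 2))).toReal / h)) atTop
      (𝓝 ((1 + s * κ) / 2)) := by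
  have h1 := ((tendsto_m_add_div_m hinf ha hb t).mul
    (tendsto_m_mul_U_Ioc hinf ha hb hκ hF hs (half_pos hh))).div_const h
  rw [show 1 * ((1 + s * κ) / 2 * (2 * (h / 2))) / h = (1 + s * κ) / 2 by field_simp] at h1
  refine h1.congr' ?_
  filter_upwards [eventually_m_pos hinf ha hb] with x hx
  rw [Measure.real]
  field_simp

end Renewal

theorem corollary1 (F : Measure ℝ) [IsProbabilityMeasure F]
    (hinf : ¬ Integrable (fun x : ℝ => x) F)
    (κ : ℝ) (ha : Renewal.Ha F) (hc : Renewal.Hc F κ) :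
    Renewal.Transient F ∧
      (¬ Renewal.Arithmetic F →
        ∀ h : ℝ, 0 < h →
          Tendsto (fun x : ℝ =>
              Renewal.m F |x| * ((Renewal.U F (Ioc x (x + h))).toReal / h))
            atTop (𝓝 ((1 + κ) / 2)) ∧
          Tendsto (fun x : ℝ =>
              Renewal.m F |x| * ((Renewal.U F (Ioc x (x + h))).toReal / h))
            atBot (𝓝 ((1 - κ) / 2))) := by
  refine ⟨Renewal.transient hinf ha hc.1, fun hF h hh => ⟨?_, ?_⟩⟩
  · have h1 := (Renewal.tendsto_m_add_mul_U_Ioc hinf ha hc.1 hc.2 hF (Or.inl rfl) hh (-(h / 2))).comp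
      (tendsto_atTop_add_const_right atTop (h / 2) tendsto_id)
    rw [one_mul] at h1
    refine h1.congr' ?_
    filter_upwards [eventually_ge_atTop 0] with x hx
    simp only [Function.comp_apply, id, one_mul, abs_of_nonneg hx]
    rw [show x + h / 2 + -(h / 2) = x by ring, show x + h / 2 - h / 2 = x by ring,
      show x + h / 2 + h / 2 = x + h by ring]
  · have h1 := (Renewal.tendsto_m_add_mul_U_Ioc hinf ha hc.1 hc.2 hF (Or.inr rfl) hh (h / 2)).comp
      (tendsto_atTop_add_const_right atBot (-(h / 2)) tendsto_neg_atBot_atTop)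
    rw [show 1 + -1 * κ = 1 - κ by ring] at h1
    refine h1.congr' ?_
    filter_upwards [eventually_le_atBot 0] with x hx
    simp only [Function.comp_apply, abs_of_nonpos hx]
    rw [show -x + -(h / 2) + h / 2 = -x by ring, show -1 * (-x + -(h / 2)) - h / 2 = x by ring,
      show -1 * (-x + -(h / 2)) + h / 2 = x + h by ring]
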